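/- **Conventions.** Inner products are linear in the second argument. Let $\mathcal H$ be a separable complex Hilbert space and $T$ a linear transformation in $\mathcal H$ whose domain need not be dense. $T$ is *symmetric* if $\langle Tx,y\rangle=\langle x,Ty\rangle$ on $\mathrm{dom}\,T$; *regular* if $T-t$ is bounded below on $\mathrm{dom}\,T$ for every $t\in\mathbb R$; *simple* if there is no non-trivial proper closed subspace $S$ such that $T|_{\mathrm{dom}\,T\cap S}$ is self-adjoint in $S$. $T^*$ is understood as a linear relation if $T$ is not densely defined, so that $\ker(T^*\mp i)=\mathrm{ran}(T\pm i)^\perp$; the deficiency indices are the dimensions of $\ker(T^*\mp i)$. $\mathcal S^R(\mathcal H)$ is the set of all closed, symmetric, simple, regular $T$ in $\mathcal H$ with deficiency indices $(1,1)$. The essential spectrum of $T$ is the set of all $z\in\mathbb C$ for which $T-z$ is not Fredholm. For closed symmetric $T$ with indices $(1,1)$ let $V$ be the partial isometry that maps $(T+i)x$ to $(T-i)x$ and vanishes on $\mathrm{ran}(T+i)^\perp$. Given nonzero $\phi_\pm\in\ker(T^*\mp i)$ of equal norm (*equal-norm deficiency vectors*), let $U_\theta=V+e^{2\pi i\theta}\|\phi_+\|^{-2}\langle\phi_+,\cdot\rangle\phi_-$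 for $\theta\in[0,1)$, and $T_\theta=i(1+U_\theta)(1-U_\theta)^{-1}$, which is defined, and is then a self-adjoint extension of $T$, if and only if $1$ is not an eigenvalue of $U_\theta$. A *spectral function* of $T\in\mathcal S^R(\mathcal H)$ for $\phi_\pm$ is a strictly increasing bijection $t:J\to\mathbb R$ of an open interval $J$ such that $\sigma(T_\theta)=\{t(n+\theta): n\in\mathbb Z,\ n+\theta\in J\}$ for all $\theta\in[0,1)$ for which $T_\theta$ is defined, and such that $\mathbb F=J\cap\mathbb Z$ is one of $\mathbb N\cup\{0\}$, $-\mathbb N\cup\{0\}$, $\mathbb Z$, $\{0,1,\dots,N\}$. A pair $(\mathbf t,\mathbf t')$ of real sequences $\mathbf t=(t_n)$, $\mathbf t'=(t'_n)$ indexed by such a set $\mathbb F$ is *admissible* if $\mathbf t$ is strictly increasing without finite accumulation point, $t'_n\ge0$ for all $n$, and $\sum t'_n/(1+t_n^2)<\infty$; it is a *bandlimit pair* if moreover $t'_n>0$ for all $n$. **Theorem.** (1) Let $(\mathbf t,\mathbf t')$ be an admissible pair with $\mathbf t'\neq0$, and let $T'$ be a self-adjoint operator on $\mathcal H$ with simple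 spectrum $\mathbf t$ (that is, $\sigma(T')=\{t_n\}$ and each $t_n$ is a simple eigenvalue). There are vectors $\phi_+\in\mathcal H$ such that $|\langle\psi_n,\phi_+\rangle|^2=t'_n/(1+t_n^2)$ for every orthonormal eigenbasis $(\psi_n)$ of $T'$ with $T'\psi_n=t_n\psi_n$. Fix such a $\phi_+$. Then there are a unique vector $\phi_-$ and an orthonormal eigenbasis $(\phi_n)$ of $T'$, $T'\phi_n=t_n\phi_n$, with $$\phi_\pm=\sum_n\frac{\sqrt{t'_n}}{t_n\mp i}\,\phi_n ,$$ and $\phi_n$ is unique for every $n$ with $t'_n>0$. There is a unique closed symmetric linear transformation $T$ in $\mathcal H$ with deficiency indices $(1,1)$ and no essential spectrum such that $\phi_\pm\in\ker(T^*\mp i)$ are equal-norm deficiency vectors for $T$ and, in the corresponding parametrization of the extensions of $T$, $T'=T_0$. This $T$ belongs to $\mathcal S^R(\mathcal H)$, i.e. is simple and regular, if and only if $t'_n>0$ for all $n$. $T$ is densely defined if and only if $\sum t'_n=+\infty$. (2) Conversely, let $T\in\mathcal S^R(\mathcal H)$ and let $\phi_\pm\in\ker(T^*\mp i)$ be equal-norm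 deficiency vectors for which $T_0$ is defined (which is automatic if $T$ is densely defined). Then $T$ has a spectral function for $\phi_\pm$. For every such spectral function $t:J\to\mathbb R$, $t$ is differentiable at each $n\in\mathbb F=J\cap\mathbb Z$, and $$\Big(\,(t(n))_{n\in\mathbb F},\ \Big(\tfrac{\|\phi_+\|^2}{\pi}\,t'(n)\Big)_{n\in\mathbb F}\Big)$$ is a bandlimit pair; it satisfies $\sum_{n}\tfrac{\|\phi_+\|^2}{\pi}t'(n)<\infty$ if and only if $T$ is not densely defined. -/

import Mathlib

open Complex

noncomputable section

namespace TVBand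

variable {H : Type*} [NormedAddCommGroup H] [InnerProductSpace ℂ H]

/-! ### Linear transformations with a domain that need not be dense -/

/-- The map `x ↦ T x - z x` on the domain of `T`. -/
def shift (T : H →ₗ.[ℂ] H) (z : ℂ) : T.domain →ₗ[ℂ] H :=
  T.toFun - z • T.domain.subtype

/-- `T` is symmetric: `⟪T x, y⟫ = ⟪x, T y⟫` for all `x`, `y` in the domain. -/
def IsSymmetric (T : H →ₗ.[ℂ] H) : Prop :=
  ∀ x y : T.domain, inner ℂ (T x) (y : H) = inner ℂ (x : H) (T y)

/-- `ker (T* - z)`. If `T` is not densely defined then `T*` is a linear relation, so the adjoint is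
taken on the level of graphs: `v` lies in `ker (T* - z)` when `(v, z v)` is in the graph
of `T*`. -/
def defectSpace (T : H →ₗ.[ℂ] H) (z : ℂ) : Submodule ℂ H :=
  T.graph.adjoint.comap (LinearMap.prod LinearMap.id (z • LinearMap.id))

/-- `T` has deficiency indices `(1,1)`, where `n_± = dim ker (T* ∓ i)`. -/
def HasIndicesOneOne (T : H →ₗ.[ℂ] H) : Prop :=
  Module.finrank ℂ (defectSpace T I) = 1 ∧ Module.finrank ℂ (defectSpace T (-I)) = 1

/-- `T` is regular: `T - t` is bounded below on the domain of `T`, for every real `t`. -/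
def IsRegular (T : H →ₗ.[ℂ] H) : Prop :=
  ∀ t : ℝ, ∃ c : ℝ, 0 < c ∧ ∀ x : T.domain, c * ‖(x : H)‖ ≤ ‖shift T t x‖

/-- The restriction of `T` to `dom T ∩ S`, as a linear transformation in `S`, for a subspace `S`
such that `T` maps `dom T ∩ S` into `S`. -/
def restrictTo (T : H →ₗ.[ℂ] H) (S : Submodule ℂ H)
    (hS : ∀ x : T.domain, (x : H) ∈ S → T x ∈ S) : S →ₗ.[ℂ] S where
  domain := T.domain.comap S.subtype
  toFun :=
    { toFun := fun x => ⟨T ⟨((x : S) : H), x.2⟩, hS _ (x : S).2⟩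
      map_add' := fun x y => Subtype.ext
        (T.map_add ⟨((x : S) : H), x.2⟩ ⟨((y : S) : H), y.2⟩)
      map_smul' := fun c x => Subtype.ext (T.map_smul c ⟨((x : S) : H), x.2⟩) }

/-- `T` is simple: there is no non-trivial proper (closed) subspace `S` such that the restriction
of `T` to `dom T ∩ S` is a self-adjoint operator in the Hilbert space `S`. -/
def IsSimple (T : H →ₗ.[ℂ] H) : Prop :=
  ∀ (S : Submodule ℂ H) [CompleteSpace S] (hS : ∀ x : T.domain, (x : H) ∈ S → T x ∈ S),
    S ≠ ⊥ → S ≠ ⊤ → ¬ IsSelfAdjoint (restrictTo T S hS)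

/-- The class `S^R`: closed regular simple symmetric linear transformations with deficiency
indices `(1,1)`. -/
structure MemSR (T : H →ₗ.[ℂ] H) : Prop where
  closed : T.IsClosed
  symm : IsSymmetric T
  indices : HasIndicesOneOne T
  simple : IsSimple T
  regular : IsRegular T

/-- The spectrum of a linear transformation: the complement of the set of all `z` such that
`T - z` maps `dom T` bijectively onto the whole space with bounded inverse `R`. -/
def spec (T : H →ₗ.[ℂ] H) : Set ℂ :=
  {z | ¬ ∃ R : H →L[ℂ] H, (∀ x : T.domain, R (shift T z x) = x) ∧
    ∀ y : H, ∃ x : T.domain, (x : H) = R y ∧ shift T z x = y}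

/-- The essential spectrum: the set of all `z` such that `T - z` is not Fredholm, i.e. fails to
have finite-dimensional kernel, closed range, and range of finite codimension. -/
def essSpec (T : H →ₗ.[ℂ] H) : Set ℂ :=
  {z | ¬ (FiniteDimensional ℂ (LinearMap.ker (shift T z)) ∧
    IsClosed (LinearMap.range (shift T z) : Set H) ∧
    FiniteDimensional ℂ (H ⧸ LinearMap.range (shift T z)))}

/-! ### Cayley transforms and self-adjoint extensions -/

/-- `x ↦ T x + i x`, with values in the closure of its range. -/
def shiftToClosure (T : H →ₗ.[ℂ] H) :
    T.domain →ₗ[ℂ] (LinearMap.range (shift T (-I))).topologicalClosure :=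
  (shift T (-I)).codRestrict _ fun x =>
    Submodule.le_topologicalClosure _ (LinearMap.mem_range_self _ x)

variable [CompleteSpace H]

/-- The Cayley transform `V = b(T)`, `b(z) = (z - i) / (z + i)`, of a symmetric `T`, as a partial
isometry on `H`: the isometry `(T + i) x ↦ (T - i) x` on (the closure of) the range of `T + i`,
and zero on the orthogonal complement. -/
def cayley (T : H →ₗ.[ℂ] H) : H →L[ℂ] H :=
  ((shift T I).extendOfNorm (shiftToClosure T)).comp
    (LinearMap.range (shift T (-I))).topologicalClosure.orthogonalProjectionOnto

/-- `U_θ = V + e^{2πiθ} ‖φ₊‖⁻² ⟪φ₊, ·⟫ φ₋`. -/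
def unitaryExt (T : H →ₗ.[ℂ] H) (φp φm : H) (θ : ℝ) : H →L[ℂ] H :=
  cayley T + (exp (2 * Real.pi * I * θ) / (‖φp‖ : ℂ) ^ 2) • (innerSL ℂ φp).smulRight φm

/-- The graph `{((1 - U) h, i (1 + U) h)}` of the inverse Cayley transform
`b⁻¹(U) = i (1 + U) (1 - U)⁻¹`. -/
def invCayleyGraph (U : H →L[ℂ] H) : Submodule ℂ (H × H) :=
  LinearMap.range
    (LinearMap.prod ((1 - U : H →L[ℂ] H) : H →ₗ[ℂ] H) ((I • (1 + U) : H →L[ℂ] H) : H →ₗ[ℂ] H))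

/-- `A = T_θ`, where `T_θ = b⁻¹(U_θ)` is the extension of `T` with parameter `θ` in the
parametrization given by the deficiency vectors `φ₊`, `φ₋`. No operator `A` satisfies this if `1`
is an eigenvalue of `U_θ`; otherwise exactly one does. -/
def IsExtension (T : H →ₗ.[ℂ] H) (φp φm : H) (θ : ℝ) (A : H →ₗ.[ℂ] H) : Prop :=
  A.graph = invCayleyGraph (unitaryExt T φp φm θ)

/-- `φ₊ ∈ ker (T* - i)` and `φ₋ ∈ ker (T* + i)` are deficiency vectors of equal (nonzero) norm. -/
structure IsDeficiencyPair (T : H →ₗ.[ℂ] H) (φp φm : H) : Prop where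
  memp : φp ∈ defectSpace T I
  memm : φm ∈ defectSpace T (-I)
  norm_eq : ‖φp‖ = ‖φm‖
  ne_zero : φp ≠ 0

/-! ### Bandlimit pairs -/

/-- The index sets `ℕ ∪ {0}`, `-ℕ ∪ {0}`, `ℤ` and `{0, 1, ..., N}`. -/
def IsIndexSet (F : Set ℤ) : Prop :=
  F = Set.Ici 0 ∨ F = Set.Iic 0 ∨ F = Set.univ ∨ ∃ N : ℕ, F = Set.Icc 0 (N : ℤ)

/-- Admissible pairs of real sequences. -/
structure IsAdmissible (F : Set ℤ) (t t' : F → ℝ) : Prop where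
  index : IsIndexSet F
  strictMono : StrictMono t
  no_accPt : ∀ x : ℝ, ¬ AccPt x (Filter.principal (Set.range t))
  nonneg : ∀ n, 0 ≤ t' n
  summable : Summable fun n => t' n / (1 + t n ^ 2)

/-- (Time-varying) bandlimit pairs. -/
structure IsBandlimitPair (F : Set ℤ) (t t' : F → ℝ) : Prop where
  admissible : IsAdmissible F t t'
  pos : ∀ n, 0 < t' n

/-- `A` is a self-adjoint operator with simple spectrum `t`: its spectrum is the set of the `t n`,
and each of them is a simple eigenvalue. -/
structure HasSimpleSpectrum {F : Set ℤ} (A : H →ₗ.[ℂ] H) (t : F → ℝ) : Prop where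
  selfAdjoint : IsSelfAdjoint A
  spec_eq : spec A = Set.range fun n => (t n : ℂ)
  simple : ∀ n, Module.finrank ℂ (LinearMap.ker (shift A (t n : ℂ))) = 1

/-- `ψ` is an orthonormal basis with `A (ψ n) = t n • ψ n`. -/
def IsEigenbasis {F : Set ℤ} (A : H →ₗ.[ℂ] H) (t : F → ℝ) (ψ : HilbertBasis F ℂ H) : Prop :=
  ∀ n, (ψ n, (t n : ℂ) • ψ n) ∈ A.graph

/-- In every orthonormal eigenbasis `ψ` of `A`, `|⟪ψ n, φ₊⟫|² = t' n / (1 + (t n)²)`. -/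
def HasCoefficients {F : Set ℤ} (A : H →ₗ.[ℂ] H) (t t' : F → ℝ) (φp : H) : Prop :=
  ∀ ψ : HilbertBasis F ℂ H, IsEigenbasis A t ψ →
    ∀ n, ‖inner ℂ (ψ n) φp‖ ^ 2 = t' n / (1 + t n ^ 2)

/-- `e` is an orthonormal eigenbasis of `A` and `φ_± = ∑ √(t' n) / (t n ∓ i) • e n`. -/
structure IsExpansion {F : Set ℤ} (A : H →ₗ.[ℂ] H) (t t' : F → ℝ) (φp φm : H)
    (e : HilbertBasis F ℂ H) : Prop where
  eigen : IsEigenbasis A t e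
  plus : HasSum (fun n => ((Real.sqrt (t' n) : ℂ) / ((t n : ℂ) - I)) • e n) φp
  minus : HasSum (fun n => ((Real.sqrt (t' n) : ℂ) / ((t n : ℂ) + I)) • e n) φm

/-- `T` is a closed symmetric linear transformation with deficiency indices `(1,1)` and no
essential spectrum, `φ₊`, `φ₋` are equal norm deficiency vectors for `T`, and `A = T_0` in the
corresponding parametrization of the self-adjoint extensions of `T`. -/
structure IsRealization (A : H →ₗ.[ℂ] H) (φp φm : H) (T : H →ₗ.[ℂ] H) : Prop where
  closed : T.IsClosed
  symm : IsSymmetric T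
  indices : HasIndicesOneOne T
  essSpec_eq : essSpec T = ∅
  pair : IsDeficiencyPair T φp φm
  ext_zero : IsExtension T φp φm 0 A

/-- `t`, considered on the open interval `J`, is a spectral function of `T` with respect to
`φ₊`, `φ₋`: a strictly increasing bijection from `J` onto `ℝ` such that the spectrum of the
self-adjoint extension `T_θ` consists of the points `t_n(θ) = t (n + θ)`. The integers in `J`,
which number the spectrum of `T_0`, form one of the four kinds of index sets. -/
structure IsSpectralFunction (T : H →ₗ.[ℂ] H) (φp φm : H) (J : Set ℝ) (t : ℝ → ℝ) : Prop where
  isOpen : IsOpen J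
  ordConnected : J.OrdConnected
  strictMono : StrictMonoOn t J
  bijOn : Set.BijOn t J Set.univ
  index : IsIndexSet {n : ℤ | (n : ℝ) ∈ J}
  spec_eq : ∀ θ ∈ Set.Ico (0 : ℝ) 1, ∀ A : H →ₗ.[ℂ] H, IsExtension T φp φm θ A →
    spec A = {z : ℂ | ∃ n : ℤ, (n : ℝ) + θ ∈ J ∧ z = (t (n + θ) : ℂ)}

end TVBand

end

open TVBand

open Complex

noncomputable section

namespace TVBand

section

variable {H : Type*} [NormedAddCommGroup H] [InnerProductSpace ℂ H]

/-! ### Graphs, defect spaces and ranges -/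

/-! Everything is computed in an eigenbasis `e` of the extension A = T_0. The link between T and its
extensions is `mem_graph_iff`: since ran(T+i) = φ₊^⊥, the graph of T consists of the pairs (x, y) in
the graph of an extension with φ₊ ⟂ y + ix.

Part (1). By that link the only candidate for T is `symmRestriction`, which settles uniqueness. The
coefficients √t'/(t ∓ i) of φ_± are such that ⟪φ₊,(A+i)x⟫ = ⟪φ₋,(A-i)x⟫ = ∑ √t'_n x_n. Hence φ_±
span the defect spaces, the Cayley transform of A carries φ₊ to φ₋, and A = T_0. If t'_n = 0, then
e_n survives as an eigenvector of T and regularity fails. If all t'_n are positive, the constraint ∑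
√t'_n x_n = 0 controls the coordinate along a given eigenvector (regularity) and leaves no
eigenvector of A in dom T (simplicity). A vector orthogonal to dom T must have coordinates c√t'_n,
and a nonzero one exists exactly when ∑ t'_n is finite.

Part (2). The domain of an extension exceeds dom T by one dimension, so regularity of T makes the
spectrum of the extension a set of isolated simple eigenvalues; functional calculus for a real
resolvent shows that the eigenvectors are total (`eq_zero_of_orthogonal_eigenvectors`). As U_θ is a
rank-one perturbation of U_0, the eigenvalue equation collapses to a scalar one
(`hasEigenvector_iff`): with G(s) = ∑ |⟪e_n,φ₊⟫|² (1 + t_n s)/(t_n - s), s is an eigenvalue of T_θ,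
0 < θ < 1, iff s is not a pole and G(s) = -‖φ₊‖² cot πθ. Between neighbouring poles G increases from
-∞ to +∞. So the number of poles passed plus the phase 1/2 + arctan(G/‖φ₊‖²)/π is continuous and
strictly increasing, and its inverse, after an integer shift, is a spectral function.

Conversely any spectral function satisfies G(t(x)) = -‖φ₊‖² cot πx near an integer n, x ≠ n.
Comparing the poles of both sides gives (‖φ₊‖²/π) t'(n) = |⟪e_n,φ₊⟫|² (1 + t_n²) (`hasDerivAt`).
This is the pair to which T belongs in part (1), so the density criterion proved there applies. -/

theorem graph_cases {T : H →ₗ.[ℂ] H} {x y : H} (h : (x, y) ∈ T.graph) :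
    ∃ hx : x ∈ T.domain, T ⟨x, hx⟩ = y := by
  obtain ⟨u, hu, hv⟩ := (LinearPMap.mem_graph_iff T).1 h
  dsimp only at hu hv
  subst hu
  exact ⟨u.2, hv⟩

theorem graph_unique {T : H →ₗ.[ℂ] H} {x y y' : H} (h : (x, y) ∈ T.graph)
    (h' : (x, y') ∈ T.graph) : y = y' := by
  obtain ⟨hx, rfl⟩ := graph_cases h
  obtain ⟨_, rfl⟩ := graph_cases h'
  rfl

theorem shift_apply (T : H →ₗ.[ℂ] H) (z : ℂ) (x : T.domain) : shift T z x = T x - z • (x : H) :=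
  rfl

theorem mem_range_shift {T : H →ₗ.[ℂ] H} {z : ℂ} {w : H} :
    w ∈ LinearMap.range (shift T z) ↔ ∃ x y, (x, y) ∈ T.graph ∧ y - z • x = w := by
  constructor
  · rintro ⟨x, rfl⟩
    exact ⟨x, T x, T.mem_graph x, rfl⟩
  · rintro ⟨x, y, h, rfl⟩
    obtain ⟨hx, rfl⟩ := graph_cases h
    exact ⟨⟨x, hx⟩, rfl⟩

theorem mem_defectSpace {T : H →ₗ.[ℂ] H} {z : ℂ} {v : H} :
    v ∈ defectSpace T z ↔ ∀ x y, (x, y) ∈ T.graph →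
      inner ℂ (y - (starRingEnd ℂ z) • x) v = 0 := by
  simp only [defectSpace, Submodule.mem_comap, Submodule.mem_adjoint_iff, LinearMap.prod_apply,
    Function.prod_apply, LinearMap.id_apply, LinearMap.smul_apply, inner_smul_right, inner_sub_left,
    inner_smul_left, Complex.conj_conj]

/-- Replaces the adjoint relation by ranges of T - z̄, so that density of the domain is never needed
when handling deficiency. -/
theorem defectSpace_eq_orthogonal (T : H →ₗ.[ℂ] H) (z : ℂ) :
    defectSpace T z = (LinearMap.range (shift T (starRingEnd ℂ z)))ᗮ := by
  ext v
  rw [mem_defectSpace, Submodule.mem_orthogonal]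
  constructor
  · intro h w hw
    obtain ⟨x, y, hxy, rfl⟩ := mem_range_shift.1 hw
    exact h x y hxy
  · intro h x y hxy
    exact h _ (mem_range_shift.2 ⟨x, y, hxy, rfl⟩)

theorem IsSymmetric.inner_graph {T : H →ₗ.[ℂ] H} (hT : IsSymmetric T) {x y u v : H}
    (h : (x, y) ∈ T.graph) (h' : (u, v) ∈ T.graph) : inner ℂ y u = inner ℂ x v := by
  obtain ⟨hx, rfl⟩ := graph_cases h
  obtain ⟨hu, rfl⟩ := graph_cases h'
  exact hT ⟨x, hx⟩ ⟨u, hu⟩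

theorem isSymmetric_of_graph {T : H →ₗ.[ℂ] H}
    (hT : ∀ x y u v, (x, y) ∈ T.graph → (u, v) ∈ T.graph → inner ℂ y u = inner ℂ x v) :
    IsSymmetric T :=
  fun x y => hT _ _ _ _ (T.mem_graph x) (T.mem_graph y)

theorem IsSymmetric.im_inner {T : H →ₗ.[ℂ] H} (hT : IsSymmetric T) {x y : H}
    (h : (x, y) ∈ T.graph) : (inner ℂ x y).im = 0 := by
  have := hT.inner_graph h h
  rw [← inner_conj_symm] at this
  exact Complex.conj_eq_iff_im.1 this

/-- `‖(T - (a + b i)) x‖² = ‖(T - a) x‖² + b² ‖x‖²`. -/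
theorem IsSymmetric.norm_sub_sq {T : H →ₗ.[ℂ] H} (hT : IsSymmetric T) {x y : H}
    (h : (x, y) ∈ T.graph) (z : ℂ) :
    ‖y - z • x‖ ^ 2 = ‖y - (z.re : ℂ) • x‖ ^ 2 + z.im ^ 2 * ‖x‖ ^ 2 := by
  have him : (inner ℂ y x).im = 0 := by
    rw [hT.inner_graph h h]; exact hT.im_inner h
  have e : y - z • x = (y - (z.re : ℂ) • x) - (z.im * I : ℂ) • x := by
    conv_lhs => rw [← Complex.re_add_im z]
    rw [add_smul]; abel
  rw [e, @_root_.norm_sub_sq ℂ]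
  have : RCLike.re (inner ℂ (y - (z.re : ℂ) • x) ((z.im * I : ℂ) • x)) = 0 := by
    rw [inner_smul_right, inner_sub_left, inner_smul_left,
      inner_self_eq_norm_sq_to_K]
    simp [him, ← Complex.ofReal_pow]
  rw [this, norm_smul]
  simp only [norm_mul, norm_real, norm_I, mul_one, Real.norm_eq_abs, mul_pow, sq_abs]
  ring

theorem IsSymmetric.abs_im_mul_norm_le {T : H →ₗ.[ℂ] H} (hT : IsSymmetric T) {x y : H}
    (h : (x, y) ∈ T.graph) (z : ℂ) : |z.im| * ‖x‖ ≤ ‖y - z • x‖ := by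
  refine le_of_sq_le_sq ?_ (norm_nonneg _)
  rw [hT.norm_sub_sq h, mul_pow, sq_abs]
  have := sq_nonneg ‖y - (z.re : ℂ) • x‖
  linarith

/-- Both squares equal ‖y‖² + ‖x‖². This is what makes the Cayley transform isometric. -/
theorem IsSymmetric.norm_add_I {T : H →ₗ.[ℂ] H} (hT : IsSymmetric T) {x y : H}
    (h : (x, y) ∈ T.graph) : ‖y + I • x‖ = ‖y - I • x‖ := by
  have h1 := hT.norm_sub_sq h I
  have h2 := hT.norm_sub_sq h (-I)
  rw [neg_smul, sub_neg_eq_add] at h2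
  simp at h1 h2
  exact (sq_eq_sq₀ (norm_nonneg _) (norm_nonneg _)).1 (h2.trans h1.symm)

theorem graph_smul {T : H →ₗ.[ℂ] H} {x y : H} (c : ℂ) (h : (x, y) ∈ T.graph) :
    (c • x, c • y) ∈ T.graph := T.graph.smul_mem c h

theorem graph_sub {T : H →ₗ.[ℂ] H} {x y u v : H} (h : (x, y) ∈ T.graph)
    (h' : (u, v) ∈ T.graph) : (x - u, y - v) ∈ T.graph := T.graph.sub_mem h h'

/-! ### Spectrum and eigenvectors -/

theorem bddBelow_of_not_mem_spec {A : H →ₗ.[ℂ] H} {z : ℂ} (hz : z ∉ spec A) :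
    ∃ c : ℝ, 0 < c ∧ ∀ x y, (x, y) ∈ A.graph → c * ‖x‖ ≤ ‖y - z • x‖ := by
  obtain ⟨R, hR, -⟩ := not_not.1 hz
  refine ⟨1 / (‖R‖ + 1), by positivity, fun x y hxy => ?_⟩
  obtain ⟨hx, rfl⟩ := graph_cases hxy
  have h1 := R.le_opNorm (shift A z ⟨x, hx⟩)
  rw [hR, shift_apply] at h1
  dsimp only at h1
  rw [one_div, inv_mul_eq_div, div_le_iff₀ (by positivity)]
  nlinarith [norm_nonneg (A ⟨x, hx⟩ - z • x)]

theorem mem_spec_of_eigenvector {A : H →ₗ.[ℂ] H} {z : ℂ} {x : H} (hx : x ≠ 0)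
    (h : (x, z • x) ∈ A.graph) : z ∈ spec A := by
  by_contra hz
  obtain ⟨c, hc, hb⟩ := bddBelow_of_not_mem_spec hz
  have := hb _ _ h
  rw [sub_self, norm_zero] at this
  have := mul_pos hc (norm_pos_iff.2 hx)
  linarith

/-- `A - z` maps onto the whole space if `z` is not in the spectrum. -/
theorem exists_graph_of_not_mem_spec {A : H →ₗ.[ℂ] H} {z : ℂ} (hz : z ∉ spec A) (w : H) :
    ∃ x y, (x, y) ∈ A.graph ∧ y - z • x = w := by
  obtain ⟨R, -, hR⟩ := not_not.1 hz
  obtain ⟨x, -, hx⟩ := hR w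
  exact ⟨x, A x, A.mem_graph x, hx⟩

theorem mem_ker_shift {A : H →ₗ.[ℂ] H} {z : ℂ} {x : A.domain} :
    x ∈ LinearMap.ker (shift A z) ↔ ((x : H), z • (x : H)) ∈ A.graph := by
  rw [LinearMap.mem_ker, shift_apply, sub_eq_zero]
  constructor
  · intro h
    rw [← h]; exact A.mem_graph x
  · intro h
    exact graph_unique (A.mem_graph x) h

/-- A simple eigenvalue: all eigenvectors are multiples of a given one. -/
theorem eigenvector_unique {A : H →ₗ.[ℂ] H} {z : ℂ}
    (h1 : Module.finrank ℂ (LinearMap.ker (shift A z)) = 1) {e x : H} (he : e ≠ 0)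
    (hg : (e, z • e) ∈ A.graph) (hx : (x, z • x) ∈ A.graph) : ∃ c : ℂ, x = c • e := by
  obtain ⟨he', -⟩ := graph_cases hg
  obtain ⟨hx', -⟩ := graph_cases hx
  let e' : LinearMap.ker (shift A z) := ⟨⟨e, he'⟩, mem_ker_shift.2 hg⟩
  let x' : LinearMap.ker (shift A z) := ⟨⟨x, hx'⟩, mem_ker_shift.2 hx⟩
  have hne : e' ≠ 0 := fun h => he (congrArg (fun v : LinearMap.ker (shift A z) => ((v : A.domain) : H)) h)
  obtain ⟨c, hc⟩ := (finrank_eq_one_iff_of_nonzero' e' hne).1 h1 x'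
  exact ⟨c, (congrArg (fun v : LinearMap.ker (shift A z) => ((v : A.domain) : H)) hc).symm⟩

theorem exists_eigenvector {A : H →ₗ.[ℂ] H} {z : ℂ}
    (h1 : Module.finrank ℂ (LinearMap.ker (shift A z)) = 1) :
    ∃ e : H, ‖e‖ = 1 ∧ (e, z • e) ∈ A.graph := by
  obtain ⟨v, hv, -⟩ := finrank_eq_one_iff'.1 h1
  have hv' : ((v : A.domain) : H) ≠ 0 := fun h => hv (Subtype.ext (Subtype.ext h))
  refine ⟨((‖((v : A.domain) : H)‖⁻¹ : ℝ) : ℂ) • ((v : A.domain) : H), ?_, ?_⟩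
  · rw [norm_smul, norm_real, norm_inv, norm_norm, inv_mul_cancel₀ (norm_ne_zero_iff.2 hv')]
  · rw [smul_comm]
    exact graph_smul _ (mem_ker_shift.1 v.2)

theorem finrank_ker_shift_eq_one {A : H →ₗ.[ℂ] H} {z : ℂ} {e : H} (he : e ≠ 0)
    (hg : (e, z • e) ∈ A.graph) (hx : ∀ x, (x, z • x) ∈ A.graph → ∃ c : ℂ, x = c • e) :
    Module.finrank ℂ (LinearMap.ker (shift A z)) = 1 := by
  obtain ⟨he', -⟩ := graph_cases hg
  let e' : LinearMap.ker (shift A z) := ⟨⟨e, he'⟩, mem_ker_shift.2 hg⟩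
  have hne : e' ≠ 0 := fun h => he (congrArg (fun v : LinearMap.ker (shift A z) => ((v : A.domain) : H)) h)
  refine (finrank_eq_one_iff_of_nonzero' e' hne).2 fun w => ?_
  obtain ⟨c, hc⟩ := hx _ (mem_ker_shift.1 w.2)
  exact ⟨c, Subtype.ext (Subtype.ext hc.symm)⟩

theorem inner_eigenvectors {A : H →ₗ.[ℂ] H} (hA : IsSymmetric A) {s r : ℝ} (hsr : s ≠ r) {x y : H}
    (hx : (x, (s : ℂ) • x) ∈ A.graph) (hy : (y, (r : ℂ) • y) ∈ A.graph) : inner ℂ x y = 0 := by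
  have := hA.inner_graph hx hy
  rw [inner_smul_left, inner_smul_right, Complex.conj_ofReal, ← sub_eq_zero, ← sub_mul] at this
  rcases mul_eq_zero.1 this with h | h
  · exact absurd (by exact_mod_cast sub_eq_zero.1 h) hsr
  · exact h

section Complete
variable [CompleteSpace H]

/-- The graph is complete and (x, y) ↦ y - zx is antilipschitz on it: the lower bound controls x,
and then y = (y - zx) + zx. The constant is the sum of the two bounds, which dominates the max norm
of the product. -/
theorem isClosed_range_shift {T : H →ₗ.[ℂ] H} (hT : T.IsClosed) (z : ℂ) {c : ℝ} (hc : 0 < c)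
    (h : ∀ x y, (x, y) ∈ T.graph → c * ‖x‖ ≤ ‖y - z • x‖) :
    IsClosed (LinearMap.range (shift T z) : Set H) := by
  have hcl : IsClosed (T.graph : Set (H × H)) := hT
  have : CompleteSpace T.graph := hcl.completeSpace_coe
  let f : T.graph →L[ℂ] H :=
    (ContinuousLinearMap.snd ℂ H H - z • ContinuousLinearMap.fst ℂ H H).comp T.graph.subtypeL
  have hf : ∀ p : T.graph, f p = (p : H × H).2 - z • (p : H × H).1 := fun p => rfl
  have hanti : AntilipschitzWith (Real.toNNReal (1 / c + (1 + ‖z‖ / c))) f := by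
    refine ContinuousLinearMap.antilipschitz_of_bound f fun p => ?_
    obtain ⟨⟨x, y⟩, hp⟩ := p
    have h1 := h x y hp
    rw [hf]
    rw [Real.coe_toNNReal _ (by positivity)]
    dsimp only
    have hx : ‖x‖ ≤ ‖y - z • x‖ / c := by rw [le_div_iff₀ hc]; linarith
    have hy : ‖y‖ ≤ ‖y - z • x‖ + ‖z‖ * (‖y - z • x‖ / c) := by
      calc ‖y‖ = ‖(y - z • x) + z • x‖ := by simp
        _ ≤ ‖y - z • x‖ + ‖z • x‖ := norm_add_le _ _
        _ ≤ _ := by rw [norm_smul]; gcongr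
    have hn := norm_nonneg (y - z • x)
    have e : (1 / c + (1 + ‖z‖ / c)) * ‖y - z • x‖
      = ‖y - z • x‖ / c + (‖y - z • x‖ + ‖z‖ * (‖y - z • x‖ / c)) := by ring
    rw [e]
    change ‖(x, y)‖ ≤ _
    rw [Prod.norm_mk]
    refine max_le ?_ ?_
    · have : 0 ≤ ‖z‖ * (‖y - z • x‖ / c) := by positivity
      linarith
    · have : 0 ≤ (‖y - z • x‖ / c) := by positivity
      linarith
  have := hanti.isClosed_range f.uniformContinuous
  convert this using 1
  ext w
  constructor
  · intro hw
    obtain ⟨x, y, hxy, rfl⟩ := mem_range_shift.1 hw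
    exact ⟨⟨(x, y), hxy⟩, rfl⟩
  · rintro ⟨⟨⟨x, y⟩, hxy⟩, rfl⟩
    exact mem_range_shift.2 ⟨x, y, hxy, rfl⟩

/-! ### Self-adjoint operators -/

theorem selfAdjoint_graph {A : H →ₗ.[ℂ] H} (hA : IsSelfAdjoint A) : A.graph.adjoint = A.graph := by
  rw [← LinearPMap.adjoint_graph_eq_graph_adjoint hA.dense_domain]
  exact congrArg _ hA

theorem isSelfAdjoint_of_graph {A : H →ₗ.[ℂ] H} (hd : Dense (A.domain : Set H))
    (h : A.graph.adjoint = A.graph) : IsSelfAdjoint A := by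
  refine LinearPMap.eq_of_eq_graph ?_
  change A.adjoint.graph = _
  rw [LinearPMap.adjoint_graph_eq_graph_adjoint hd, h]

theorem mem_graph_of_selfAdjoint {A : H →ₗ.[ℂ] H} (hA : IsSelfAdjoint A) {x y : H}
    (h : ∀ u v, (u, v) ∈ A.graph → inner ℂ v x = inner ℂ u y) : (x, y) ∈ A.graph := by
  rw [← selfAdjoint_graph hA, Submodule.mem_adjoint_iff]
  intro u v huv
  exact sub_eq_zero.2 (h u v huv)

theorem isSymmetric_of_selfAdjoint {A : H →ₗ.[ℂ] H} (hA : IsSelfAdjoint A) : IsSymmetric A := by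
  refine isSymmetric_of_graph fun x y u v h h' => ?_
  rw [← selfAdjoint_graph hA, Submodule.mem_adjoint_iff] at h'
  exact sub_eq_zero.1 (h' x y h)

/-- The range of A - z is closed by the bound, and its orthogonal complement is ker(A - z̄) by
self-adjointness, hence zero by `hk`. -/
theorem not_mem_spec_of_bddBelow {A : H →ₗ.[ℂ] H} (hA : IsSelfAdjoint A) {z : ℂ} {c : ℝ}
    (hc : 0 < c) (h : ∀ x y, (x, y) ∈ A.graph → c * ‖x‖ ≤ ‖y - z • x‖)
    (hk : ∀ x, (x, (starRingEnd ℂ z) • x) ∈ A.graph → x = 0) : z ∉ spec A := by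
  have hcl := isClosed_range_shift hA.isClosed z hc h
  have htop : LinearMap.range (shift A z) = ⊤ := by
    have : CompleteSpace (LinearMap.range (shift A z)) := hcl.completeSpace_coe
    rw [← Submodule.orthogonal_eq_bot_iff, Submodule.eq_bot_iff]
    intro v hv
    rw [← Complex.conj_conj z, ← defectSpace_eq_orthogonal] at hv
    refine hk v ?_
    rw [← selfAdjoint_graph hA]
    exact hv
  have hinj : Function.Injective (shift A z) := by
    rw [← LinearMap.ker_eq_bot, LinearMap.ker_eq_bot']
    intro x hx
    have := h _ _ (A.mem_graph x)
    rw [← shift_apply, hx, norm_zero] at this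
    have hx0 : ‖(x : H)‖ ≤ 0 := by
      by_contra hne
      push Not at hne
      have := mul_pos hc hne
      linarith
    exact Subtype.ext (norm_le_zero_iff.1 hx0)
  let E := LinearEquiv.ofBijective (shift A z) ⟨hinj, LinearMap.range_eq_top.1 htop⟩
  let R : H →L[ℂ] H := LinearMap.mkContinuous (A.domain.subtype.comp E.symm.toLinearMap) (1 / c) (by
    intro w
    have h1 := h _ _ (A.mem_graph (E.symm w))
    rw [← shift_apply] at h1
    have h2 : shift A z (E.symm w) = w := E.apply_symm_apply w
    rw [h2] at h1
    simp only [LinearMap.comp_apply, Submodule.subtype_apply, LinearEquiv.coe_coe]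
    rw [one_div, inv_mul_eq_div, le_div_iff₀ hc]
    linarith)
  refine fun hz => hz ⟨R, fun x => ?_, fun y => ⟨E.symm y, rfl, E.apply_symm_apply y⟩⟩
  change ((E.symm (E x) : A.domain) : H) = x
  rw [E.symm_apply_apply]

theorem not_mem_spec_iff {A : H →ₗ.[ℂ] H} (hA : IsSelfAdjoint A) (s : ℝ) : (s : ℂ) ∉ spec A ↔
    ∃ c : ℝ, 0 < c ∧ ∀ x y, (x, y) ∈ A.graph → c * ‖x‖ ≤ ‖y - (s : ℂ) • x‖ := by
  refine ⟨bddBelow_of_not_mem_spec, fun ⟨c, hc, h⟩ => not_mem_spec_of_bddBelow hA hc h ?_⟩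
  intro x hx
  have := h _ _ hx
  rw [Complex.conj_ofReal, sub_self, norm_zero] at this
  have hx0 : ‖x‖ ≤ 0 := by
    by_contra hne
    push Not at hne
    have := mul_pos hc hne
    linarith
  exact norm_le_zero_iff.1 hx0

theorem not_mem_spec_of_im_ne_zero {A : H →ₗ.[ℂ] H} (hA : IsSelfAdjoint A) {z : ℂ}
    (hz : z.im ≠ 0) : z ∉ spec A := by
  have hs := isSymmetric_of_selfAdjoint hA
  refine not_mem_spec_of_bddBelow hA (abs_pos.2 hz) (fun x y h => hs.abs_im_mul_norm_le h z) ?_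
  intro x hx
  have := hs.abs_im_mul_norm_le hx (starRingEnd ℂ z)
  rw [sub_self, norm_zero, Complex.conj_im, abs_neg] at this
  have hx0 : ‖x‖ ≤ 0 := by
    by_contra hne
    push Not at hne
    have := mul_pos (abs_pos.2 hz) hne
    linarith
  exact norm_le_zero_iff.1 hx0

theorem spec_real {A : H →ₗ.[ℂ] H} (hA : IsSelfAdjoint A) {z : ℂ} (hz : z ∈ spec A) :
    ((z.re : ℝ) : ℂ) = z := by
  by_contra h
  refine not_mem_spec_of_im_ne_zero hA (fun h0 => h ?_) hz
  exact Complex.ext rfl (by simp [h0])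

theorem exists_add_I {A : H →ₗ.[ℂ] H} (hA : IsSelfAdjoint A) (w : H) :
    ∃ x y, (x, y) ∈ A.graph ∧ y + I • x = w := by
  obtain ⟨x, y, h, e⟩ := exists_graph_of_not_mem_spec
    (not_mem_spec_of_im_ne_zero hA (z := -I) (by simp)) w
  exact ⟨x, y, h, by rw [← e, neg_smul, sub_neg_eq_add]⟩

end Complete

end

section

variable {H : Type*} [NormedAddCommGroup H] [InnerProductSpace ℂ H]

/-! ### Sets of reals without accumulation points -/

theorem exists_gap_of_not_accPt {S : Set ℝ} {s : ℝ} (h : ¬ AccPt s (Filter.principal S)) :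
    ∃ δ > 0, ∀ r ∈ S, r ≠ s → δ ≤ |r - s| := by
  rw [accPt_iff_frequently, Filter.not_frequently, Metric.eventually_nhds_iff] at h
  obtain ⟨δ, hδ, h⟩ := h
  refine ⟨δ, hδ, fun r hr hrs => ?_⟩
  by_contra hlt
  exact h (y := r) (by rw [Real.dist_eq]; linarith) ⟨hrs, hr⟩

theorem not_accPt_of_gap {S : Set ℝ} {s : ℝ} (h : ∃ δ > 0, ∀ r ∈ S, r ≠ s → δ ≤ |r - s|) :
    ¬ AccPt s (Filter.principal S) := by
  obtain ⟨δ, hδ, h⟩ := h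
  rw [accPt_iff_frequently, Filter.not_frequently, Metric.eventually_nhds_iff]
  refine ⟨δ, hδ, fun r hr hrs => ?_⟩
  rw [Real.dist_eq] at hr
  linarith [h r hrs.2 hrs.1]

theorem finite_inter_Icc_of_gap {S : Set ℝ} (h : ∀ s, ∃ δ > 0, ∀ r ∈ S, r ≠ s → δ ≤ |r - s|)
    (a b : ℝ) : (S ∩ Set.Icc a b).Finite := by
  by_contra hinf
  obtain ⟨x, -, hx⟩ := Set.Infinite.exists_accPt_of_subset_isCompact hinf isCompact_Icc
    Set.inter_subset_right
  exact not_accPt_of_gap (h x) (hx.mono (Filter.principal_mono.2 Set.inter_subset_left))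

theorem gap_of_range {ι : Type*} {t : ι → ℝ}
    (h : ∀ x : ℝ, ¬ AccPt x (Filter.principal (Set.range t))) (z : ℂ) :
    ∃ δ > 0, ∀ n, (t n : ℂ) ≠ z → δ ≤ ‖(t n : ℂ) - z‖ := by
  obtain ⟨δ, hδ, hg⟩ := exists_gap_of_not_accPt (h z.re)
  by_cases hz : z.im = 0
  · refine ⟨δ, hδ, fun n hn => ?_⟩
    have hz' : z = (z.re : ℂ) := Complex.ext rfl hz
    have hne : t n ≠ z.re := fun h0 => hn (by rw [hz', h0])
    have := hg (t n) ⟨n, rfl⟩ hne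
    rw [hz', ← Complex.ofReal_sub, Complex.norm_real]
    simpa using this
  · refine ⟨|z.im|, abs_pos.2 hz, fun n _ => ?_⟩
    have := Complex.abs_im_le_norm ((t n : ℂ) - z)
    simpa using this

/-! ### Coordinates with respect to an orthonormal basis -/

section Coord
variable {ι : Type*} (e : HilbertBasis ι ℂ H)

theorem eq_of_coord {x y : H} (h : ∀ n, inner ℂ (e n) x = inner ℂ (e n) y) : x = y := by
  apply e.repr.injective
  ext n
  rw [e.repr_apply_apply, e.repr_apply_apply, h]

theorem exists_of_coord {f : ι → ℂ} (hf : Summable fun n => ‖f n‖ ^ 2) :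
    ∃ x : H, ∀ n, inner ℂ (e n) x = f n := by
  have hm : Memℓp f 2 := memℓp_gen (by simpa using hf)
  refine ⟨e.repr.symm ⟨f, hm⟩, fun n => ?_⟩
  rw [← e.repr_apply_apply, LinearIsometryEquiv.apply_symm_apply]

theorem hasSum_coord_inner (x y : H) :
    HasSum (fun n => (starRingEnd ℂ) (inner ℂ (e n) x) * inner ℂ (e n) y) (inner ℂ x y) := by
  have := e.hasSum_inner_mul_inner x y
  simpa only [inner_conj_symm] using this

theorem hasSum_coord_norm_sq (x : H) :
    HasSum (fun n => ‖inner ℂ (e n) x‖ ^ 2) (‖x‖ ^ 2) := by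
  have := Complex.hasSum_re (hasSum_coord_inner e x x)
  rw [inner_self_eq_norm_sq_to_K] at this
  convert this using 1
  · ext n
    rw [Complex.conj_mul']
    norm_cast
  · simp [← Complex.ofReal_pow]

theorem summable_coord (x : H) : Summable fun n => ‖inner ℂ (e n) x‖ ^ 2 :=
  (hasSum_coord_norm_sq e x).summable

theorem norm_le_of_coord {x y : H} {C : ℝ} (hC : 0 ≤ C)
    (h : ∀ n, ‖inner ℂ (e n) x‖ ≤ C * ‖inner ℂ (e n) y‖) : ‖x‖ ≤ C * ‖y‖ := by
  refine le_of_sq_le_sq ?_ (by positivity)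
  rw [mul_pow]
  refine hasSum_le (fun n => ?_) (hasSum_coord_norm_sq e x)
    ((hasSum_coord_norm_sq e y).mul_left (C ^ 2))
  rw [← mul_pow]
  exact pow_le_pow_left₀ (norm_nonneg _) (h n) 2

theorem exists_of_coord_mul {c : ι → ℂ} {C : ℝ} (hc : ∀ n, ‖c n‖ ≤ C) (v : H) :
    ∃ x : H, ∀ n, inner ℂ (e n) x = c n * inner ℂ (e n) v := by
  refine exists_of_coord e (Summable.of_nonneg_of_le (fun n => by positivity) (fun n => ?_)
    ((summable_coord e v).mul_left (C ^ 2)))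
  rw [norm_mul, mul_pow]
  gcongr
  exact hc n

theorem coord_eq_zero_or {m n : ι} (h : n ≠ m) : inner ℂ (e n) (e m) = 0 :=
  e.orthonormal.2 h

theorem coord_self (m : ι) : inner ℂ (e m) (e m) = (1 : ℂ) := by
  rw [inner_self_eq_norm_sq_to_K, e.orthonormal.1]; simp

theorem basis_ne_zero (m : ι) : e m ≠ 0 := e.orthonormal.ne_zero m

end Coord

/-! ### Self-adjoint operators diagonalized by an orthonormal basis -/

section Diag
variable [CompleteSpace H] {ι : Type*} {e : HilbertBasis ι ℂ H} {t : ι → ℝ} {A : H →ₗ.[ℂ] H}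

/-- Sufficiency rests on maximality: a self-adjoint graph contains every pair that passes the
symmetry test against it, and Parseval evaluates that test in coordinates. -/
theorem mem_graph_iff_coord (hA : IsSelfAdjoint A)
    (he : ∀ n, (e n, (t n : ℂ) • e n) ∈ A.graph) {x y : H} :
    (x, y) ∈ A.graph ↔ ∀ n, inner ℂ (e n) y = t n * inner ℂ (e n) x := by
  have hs := isSymmetric_of_selfAdjoint hA
  have key : ∀ {x y : H}, (x, y) ∈ A.graph → ∀ n, inner ℂ (e n) y = t n * inner ℂ (e n) x := by
    intro x y h n
    rw [← hs.inner_graph (he n) h, inner_smul_left, Complex.conj_ofReal]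
  refine ⟨key, fun h => mem_graph_of_selfAdjoint hA fun u v huv => ?_⟩
  refine (hasSum_coord_inner e v x).unique ?_
  convert hasSum_coord_inner e u y using 2 with n
  rw [key huv n, h n, map_mul, Complex.conj_ofReal]
  ring

theorem coord_eigenvector (hA : IsSelfAdjoint A)
    (he : ∀ n, (e n, (t n : ℂ) • e n) ∈ A.graph) {z : ℂ} {x : H} (h : (x, z • x) ∈ A.graph) {n : ι}
    (hn : (t n : ℂ) ≠ z) : inner ℂ (e n) x = 0 := by
  have := (mem_graph_iff_coord hA he).1 h n
  rw [inner_smul_right, ← sub_eq_zero, ← sub_mul] at this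
  exact (mul_eq_zero.1 this).resolve_left (sub_ne_zero.2 hn.symm)

theorem eigenvector_eq_smul (hA : IsSelfAdjoint A)
    (he : ∀ n, (e n, (t n : ℂ) • e n) ∈ A.graph) (ht : Function.Injective t) {m : ι} {x : H}
    (h : (x, (t m : ℂ) • x) ∈ A.graph) : x = inner ℂ (e m) x • e m := by
  refine eq_of_coord e fun n => ?_
  rw [inner_smul_right]
  by_cases hn : n = m
  · subst hn; rw [coord_self, mul_one]
  · rw [coord_eq_zero_or e hn, mul_zero]
    refine coord_eigenvector hA he h fun h0 => hn (ht ?_)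
    exact_mod_cast h0

end Diag

/-! ### Self-adjoint operators with discrete spectrum have an eigenbasis -/

section Totality

/-- Contrapositive by the resolvent identity. With R = (A - l)⁻¹ and S = (A - r)⁻¹, r = l + μ⁻¹, one
has S - R = μ⁻¹RS = μ⁻¹SR, so μ⁻¹(1 + μ⁻¹S) inverts μ - R. -/
theorem mem_spec_of_mem_spectrum_resolvent {A : H →ₗ.[ℂ] H} {l : ℝ}
    {R : H →L[ℂ] H} (hR : ∀ x y, (x, y) ∈ A.graph → R (y - (l : ℂ) • x) = x)
    (hR' : ∀ w, (R w, w + (l : ℂ) • R w) ∈ A.graph) {μ : ℝ} (hμ : μ ≠ 0)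
    (h : μ ∈ spectrum ℝ R) : ((l + μ⁻¹ : ℝ) : ℂ) ∈ spec A := by
  by_contra hr
  refine h ?_
  obtain ⟨S, hS, hS'⟩ := not_not.1 hr
  set r : ℝ := l + μ⁻¹ with hrdef
  have hμ' : (μ : ℂ) ≠ 0 := by exact_mod_cast hμ
  have hg : ∀ w, (S w, w + (r : ℂ) • S w) ∈ A.graph := by
    intro w
    obtain ⟨x, hx, hx'⟩ := hS' w
    have := A.mem_graph x
    rw [shift_apply] at hx'
    rw [← hx, ← hx', sub_add_cancel]
    exact this
  have hRS : ∀ w, R w + (μ : ℂ)⁻¹ • R (S w) = S w := by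
    intro w
    have h1 := hR _ _ (hg w)
    rw [← map_smul, ← map_add]
    convert h1 using 2
    rw [hrdef]; push_cast; module
  have hSR : ∀ w, S w - (μ : ℂ)⁻¹ • S (R w) = R w := by
    intro w
    obtain ⟨hx, hx'⟩ := graph_cases (hR' w)
    have h1 := hS ⟨R w, hx⟩
    rw [shift_apply, hx'] at h1
    dsimp only at h1
    rw [← map_smul, ← map_sub, ← h1]
    congr 1
    rw [h1]
    rw [hrdef]; push_cast; module
  have hc : ∀ v : H, (μ : ℝ) • v = (μ : ℂ) • v := fun v => (Complex.coe_smul μ v).symm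
  let Q : H →L[ℂ] H := (μ : ℂ)⁻¹ • (1 + (μ : ℂ)⁻¹ • S)
  have e1 : (algebraMap ℝ (H →L[ℂ] H) μ - R) * Q = 1 := by
    ext w
    have : R (S w) = (μ : ℂ) • (S w - R w) := by
      rw [sub_eq_of_eq_add' (hRS w).symm, smul_inv_smul₀ hμ']
    simp only [Q, _root_.mul_apply_eq_comp, _root_.sub_apply,
      _root_.smul_apply, _root_.add_apply,
      _root_.one_apply_eq_self, Algebra.algebraMap_eq_smul_one, map_smul, map_add, this]
    simp only [hc, smul_add, smul_sub, smul_smul, inv_mul_cancel₀ hμ', one_smul]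
    abel
  have e2 : Q * (algebraMap ℝ (H →L[ℂ] H) μ - R) = 1 := by
    ext w
    have : S (R w) = (μ : ℂ) • (S w - R w) := by
      conv_rhs => rw [← hSR w]
      rw [sub_sub_cancel, smul_inv_smul₀ hμ']
    simp only [Q, _root_.mul_apply_eq_comp, _root_.sub_apply,
      _root_.smul_apply, _root_.add_apply,
      _root_.one_apply_eq_self, Algebra.algebraMap_eq_smul_one, map_sub]
    rw [hc, map_smul, this]
    simp only [smul_add, smul_sub, smul_smul, inv_mul_cancel₀ hμ', one_smul]
    abel
  exact ⟨⟨_, Q, e1, e2⟩, rfl⟩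

variable [CompleteSpace H]

/-- Totality of eigenvectors for locally finite spectrum. The resolvent R at a real point is bounded
and self-adjoint, and its spectrum can accumulate only at 0. Its parts at single points μ ≠ 0 map
into eigenspaces of A and so annihilate x; what remains of R has arbitrarily small norm. Hence Rx =
0, and R is injective. -/
theorem eq_zero_of_orthogonal_eigenvectors {A : H →ₗ.[ℂ] H} (hA : IsSelfAdjoint A)
    (hgap : ∀ s : ℝ, ∃ δ > 0, ∀ r ∈ {r : ℝ | (r : ℂ) ∈ spec A}, r ≠ s → δ ≤ |r - s|)
    {x : H} (hx : ∀ (s : ℝ) v, (v, (s : ℂ) • v) ∈ A.graph → inner ℂ v x = 0) : x = 0 := by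
  -- The resolvent point must be real for R to be self-adjoint; the gap δ around 0 leaves δ/2
  -- outside the spectrum.
  obtain ⟨l, hl⟩ : ∃ l : ℝ, (l : ℂ) ∉ spec A := by
    obtain ⟨δ, hδ, h⟩ := hgap 0
    refine ⟨δ / 2, fun hm => ?_⟩
    have := h (δ / 2) hm (by positivity)
    rw [sub_zero, abs_of_pos (by positivity)] at this
    linarith
  obtain ⟨R, hR, hRr⟩ := not_not.1 hl
  replace hR : ∀ x y, (x, y) ∈ A.graph → R (y - (l : ℂ) • x) = x := by
    intro x y h
    obtain ⟨hx, rfl⟩ := graph_cases h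
    exact hR ⟨x, hx⟩
  have hR' : ∀ w, (R w, w + (l : ℂ) • R w) ∈ A.graph := by
    intro w
    obtain ⟨x, hx, hx'⟩ := hRr w
    rw [shift_apply] at hx'
    rw [← hx, ← hx', sub_add_cancel]
    exact A.mem_graph x
  have hs := isSymmetric_of_selfAdjoint hA
  have hRsa : IsSelfAdjoint R := by
    rw [ContinuousLinearMap.isSelfAdjoint_iff_isSymmetric]
    intro w w'
    have := hs.inner_graph (hR' w) (hR' w')
    rw [inner_add_left, inner_add_right, inner_smul_left, inner_smul_right,
      Complex.conj_ofReal] at this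
    exact (add_right_cancel this).symm
  have hRx : ∀ y, R y = 0 → y = 0 := by
    intro y hy
    have := hR' y
    rw [hy, smul_zero, add_zero] at this
    exact graph_unique this A.graph.zero_mem
  refine hRx x ?_
  set σ := spectrum ℝ R
  -- The injective map μ ↦ l + μ⁻¹ sends this set into the spectrum of A within [l - ε⁻¹, l + ε⁻¹],
  -- which is finite.
  have hfin : ∀ ε > 0, (σ ∩ {μ | ε ≤ |μ|}).Finite := by
    intro ε hε
    have h1 := finite_inter_Icc_of_gap hgap (l - ε⁻¹) (l + ε⁻¹)
    refine Set.Finite.of_finite_image (f := fun μ => l + μ⁻¹) (h1.subset ?_) ?_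
    · rintro _ ⟨μ, ⟨hμ, hμε⟩, rfl⟩
      have hμ0 : μ ≠ 0 := by
        rintro rfl
        simp at hμε
        linarith
      refine ⟨mem_spec_of_mem_spectrum_resolvent hR hR' hμ0 hμ, ?_⟩
      have : |μ⁻¹| ≤ ε⁻¹ := by
        rw [abs_inv]
        exact inv_anti₀ hε hμε
      rw [abs_le] at this
      constructor <;> linarith
    · intro a _ b _ hab
      simpa using hab
  -- Nonzero points of σ are isolated in σ, so cutting down to one of them is continuous on σ.
  have hcont : ∀ μ : ℝ, μ ≠ 0 → ContinuousOn (fun y => if y = μ then y else 0) σ := by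
    intro μ hμ y hy
    by_cases hyμ : y = μ
    · subst hyμ
      have hmem : ∀ᶠ y' in nhdsWithin y σ, y' = y := by
        have hf := (hfin (|y| / 2) (by positivity)).subset (Set.sdiff_subset (t := {y}))
        have h1 : ((σ ∩ {μ | |y| / 2 ≤ |μ|}) \ {y})ᶜ ∈ nhds y :=
          hf.isClosed.isOpen_compl.mem_nhds (by simp)
        have h2 : {μ : ℝ | |y| / 2 < |μ|} ∈ nhds y :=
          (isOpen_lt continuous_const continuous_abs).mem_nhds (by
            have := abs_pos.2 hμ
            change |y| / 2 < |y|
            linarith)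
        filter_upwards [mem_nhdsWithin_of_mem_nhds h1, mem_nhdsWithin_of_mem_nhds h2,
          self_mem_nhdsWithin] with y' h1 h2 h3
        by_contra hne
        exact h1 ⟨⟨h3, le_of_lt h2⟩, hne⟩
      refine ContinuousWithinAt.congr_of_eventuallyEq (f := fun y => y) continuousWithinAt_id
        ?_ (if_pos rfl)
      filter_upwards [hmem] with y' h
      rw [if_pos h]
    · refine ContinuousWithinAt.congr_of_eventuallyEq (f := fun _ => (0 : ℝ))
        continuousWithinAt_const ?_ (if_neg hyμ)
      filter_upwards [mem_nhdsWithin_of_mem_nhds (isOpen_ne.mem_nhds hyμ)] with y' h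
      rw [if_neg h]
  -- RP = μP makes every Pv an eigenvector of A for l + μ⁻¹; since P is self-adjoint, ⟪v, Px⟫ = ⟪Pv,
  -- x⟫ = 0.
  have hzero : ∀ μ : ℝ, μ ≠ 0 → cfc (fun y : ℝ => if y = μ then y else 0) R x = 0 := by
    intro μ hμ
    set P := cfc (fun y : ℝ => if y = μ then y else 0) R with hP
    have hPsa : IsSelfAdjoint P := cfc_predicate _ R
    have hRP : R * P = (μ : ℂ) • P := by
      have hid : R = cfc (fun y : ℝ => y) R := (cfc_id' ℝ R).symm
      have e1 : R * P = cfc (fun y : ℝ => y * (if y = μ then y else 0)) R := by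
        rw [cfc_mul (fun y : ℝ => y) _ R continuousOn_id (hcont μ hμ), ← hid]
      have e2 : (μ : ℂ) • P = μ • P := Complex.coe_smul μ P
      rw [e1, e2, hP, ← cfc_smul μ _ R (hcont μ hμ)]
      congr 1
      ext y
      split_ifs with h
      · rw [h, smul_eq_mul]
      · simp
    refine ext_inner_left ℂ fun v => ?_
    rw [inner_zero_right]
    have hsym := (ContinuousLinearMap.isSelfAdjoint_iff_isSymmetric.1 hPsa) v x
    rw [← ContinuousLinearMap.coe_coe, ← hsym]
    refine hx (l + μ⁻¹) _ ?_
    have h1 : R (P v) = (μ : ℂ) • P v := congrArg (fun B : H →L[ℂ] H => B v) hRP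
    have h2 := graph_smul (μ⁻¹ : ℂ) (hR' (P v))
    have hμ' : (μ : ℂ) ≠ 0 := by exact_mod_cast hμ
    rw [h1, inv_smul_smul₀ hμ', smul_add, smul_comm, inv_smul_smul₀ hμ'] at h2
    refine (congrArg (fun w => (P v, w) ∈ A.graph) ?_).mp h2
    push_cast
    rw [add_smul, add_comm]
  have hle : ∀ ε > 0, ‖R x‖ ≤ ε * ‖x‖ := by
    intro ε hε
    let M := (hfin ε hε).toFinset
    have hM : ∀ μ ∈ M, μ ≠ 0 := by
      intro μ hμ h0
      have := ((hfin ε hε).mem_toFinset.1 hμ).2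
      rw [h0] at this
      simp at this
      linarith
    let F : ℝ → ℝ → ℝ := fun μ y => if y = μ then y else 0
    have hc : ContinuousOn (∑ μ ∈ M, F μ) σ := by
      have : (∑ μ ∈ M, F μ) = fun y => ∑ μ ∈ M, F μ y := by ext; simp
      rw [this]
      exact continuousOn_finsetSum _ fun μ hμ => hcont μ (hM μ hμ)
    have hsum : cfc (∑ μ ∈ M, F μ) R x = 0 := by
      rw [cfc_sum F R M fun μ hμ => hcont μ (hM μ hμ)]
      rw [_root_.sum_apply]
      exact Finset.sum_eq_zero fun μ hμ => hzero μ (hM μ hμ)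
    have hsplit : R = cfc (∑ μ ∈ M, F μ) R + cfc (fun y => y - (∑ μ ∈ M, F μ) y) R := by
      rw [cfc_sub (fun y : ℝ => y) (∑ μ ∈ M, F μ) R continuousOn_id hc, add_sub_cancel]
      exact (cfc_id' ℝ R).symm
    have hn : ‖cfc (fun y => y - (∑ μ ∈ M, F μ) y) R‖ ≤ ε := by
      refine norm_cfc_le hε.le fun y hy => ?_
      rw [Finset.sum_apply]
      by_cases hyM : y ∈ M
      · rw [Finset.sum_eq_single_of_mem y hyM (fun b _ hb => if_neg hb.symm)]
        simp [hε.le]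
      · rw [Finset.sum_eq_zero (fun b hb => if_neg (by rintro rfl; exact hyM hb)), sub_zero]
        by_contra hlt
        push Not at hlt
        exact hyM ((hfin ε hε).mem_toFinset.2 ⟨hy, hlt.le⟩)
    calc ‖R x‖ = ‖cfc (fun y => y - (∑ μ ∈ M, F μ) y) R x‖ := by
          conv_lhs => rw [hsplit]
          rw [_root_.add_apply, hsum, zero_add]
      _ ≤ _ := (ContinuousLinearMap.le_opNorm _ _).trans (by gcongr)
  by_contra hne
  have hx0 : 0 < ‖R x‖ := norm_pos_iff.2 hne
  have := hle (‖R x‖ / (2 * (‖x‖ + 1))) (by positivity)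
  have hlt : ‖R x‖ / (2 * (‖x‖ + 1)) * ‖x‖ < ‖R x‖ := by
    rw [div_mul_eq_mul_div, div_lt_iff₀ (by positivity)]
    nlinarith [norm_nonneg x]
  linarith

theorem exists_eigenbasis {A : H →ₗ.[ℂ] H} (hA : IsSelfAdjoint A) {ι : Type*} {t : ι → ℝ}
    (ht : Function.Injective t) (hspec : spec A = Set.range fun n => (t n : ℂ))
    (hacc : ∀ x : ℝ, ¬ AccPt x (Filter.principal (Set.range t)))
    (h1 : ∀ n, Module.finrank ℂ (LinearMap.ker (shift A (t n : ℂ))) = 1) :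
    ∃ e : HilbertBasis ι ℂ H, ∀ n, (e n, (t n : ℂ) • e n) ∈ A.graph := by
  have hs := isSymmetric_of_selfAdjoint hA
  choose v hv hvg using fun n => exists_eigenvector (h1 n)
  have hon : Orthonormal ℂ v :=
    ⟨hv, fun i j hij => inner_eigenvectors hs (ht.ne hij) (hvg i) (hvg j)⟩
  have hset : {r : ℝ | (r : ℂ) ∈ spec A} = Set.range t := by
    ext r
    simp [hspec]
  have hbot : (Submodule.span ℂ (Set.range v))ᗮ = ⊥ := by
    rw [Submodule.eq_bot_iff]
    intro x hx
    refine eq_zero_of_orthogonal_eigenvectors hA (fun s => ?_) fun s w hw => ?_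
    · rw [hset]
      exact exists_gap_of_not_accPt (hacc s)
    · by_cases hw0 : w = 0
      · rw [hw0, inner_zero_left]
      · have hmem := mem_spec_of_eigenvector hw0 hw
        rw [hspec] at hmem
        obtain ⟨n, hn⟩ := hmem
        dsimp only at hn
        rw [← hn] at hw
        obtain ⟨c, rfl⟩ := eigenvector_unique (h1 n) (hon.ne_zero n) (hvg n) hw
        rw [inner_smul_left, (Submodule.mem_orthogonal _ _).1 hx _
          (Submodule.subset_span ⟨n, rfl⟩), mul_zero]
  refine ⟨HilbertBasis.mkOfOrthogonalEqBot hon hbot, fun n => ?_⟩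
  rw [HilbertBasis.coe_mkOfOrthogonalEqBot]
  exact hvg n

end Totality

end

section

variable {H : Type*} [NormedAddCommGroup H] [InnerProductSpace ℂ H]

/-! ### Inverse Cayley transforms of unitary operators -/

/-- The equations (1 - U)h = x and i(1 + U)h = y say that 2ih = y + ix and 2iUh = y - ix. -/
theorem mem_invCayleyGraph {U : H →L[ℂ] H} {x y : H} :
    (x, y) ∈ invCayleyGraph U ↔ U (y + I • x) = y - I • x := by
  have hI : (2 * I : ℂ) ≠ 0 := by simp
  constructor
  · rintro ⟨h, hh⟩
    simp only [LinearMap.prod_apply, Function.prod_apply, Prod.mk.injEq, ContinuousLinearMap.coe_coe,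
      _root_.sub_apply, _root_.smul_apply, _root_.add_apply, one_apply_eq_self] at hh
    obtain ⟨rfl, rfl⟩ := hh
    have e1 : I • (h + U h) + I • (h - U h) = (2 * I) • h := by module
    have e2 : I • (h + U h) - I • (h - U h) = (2 * I) • U h := by module
    rw [e1, e2, map_smul]
  · intro h
    refine ⟨(2 * I)⁻¹ • (y + I • x), ?_⟩
    simp only [LinearMap.prod_apply, Function.prod_apply, ContinuousLinearMap.coe_coe,
      _root_.sub_apply, _root_.smul_apply, _root_.add_apply, one_apply_eq_self, map_smul, h]
    refine Prod.ext ?_ ?_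
    · change (2 * I)⁻¹ • (y + I • x - (y - I • x)) = x
      rw [add_sub_sub_cancel, ← two_smul ℂ (I • x), smul_smul 2 I, inv_smul_smul₀ hI]
    · change (2 * I)⁻¹ • I • (y + I • x + (y - I • x)) = y
      rw [smul_smul, add_add_sub_cancel, ← two_smul ℂ y, smul_smul]
      have : (2 * I)⁻¹ * I * 2 = 1 := by field_simp
      rw [this, one_smul]

/-- A pair (0, y) in the graph means Uy = y, so without fixed vectors the graph is single-valued. -/
theorem exists_graph_eq_invCayleyGraph {U : H →L[ℂ] H} (hU : ∀ h, U h = h → h = 0) :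
    ∃ A : H →ₗ.[ℂ] H, A.graph = invCayleyGraph U := by
  refine ⟨(invCayleyGraph U).toLinearPMap, Submodule.toLinearPMap_graph_eq _ ?_⟩
  rintro ⟨x, y⟩ hxy hx
  dsimp only at hx ⊢
  subst hx
  rw [mem_invCayleyGraph, smul_zero, add_zero, sub_zero] at hxy
  exact hU _ hxy

variable [CompleteSpace H]

/-- A vector v orthogonal to ran(1 - U) is fixed by the unitary U, so (0, v) lies in the graph of
the operator A and v = 0. This gives the dense domain. -/
theorem isSelfAdjoint_of_invCayleyGraph {U : H →L[ℂ] H} (hU : ∀ h, ‖U h‖ = ‖h‖)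
    (hsurj : Function.Surjective U) {A : H →ₗ.[ℂ] H} (hA : A.graph = invCayleyGraph U) :
    IsSelfAdjoint A := by
  have hin : ∀ x y, inner ℂ (U x) (U y) = inner ℂ x y :=
    (⟨U, hU⟩ : H →ₗᵢ[ℂ] H).inner_map_map
  refine isSelfAdjoint_of_graph ?_ ?_
  · rw [Submodule.dense_iff_topologicalClosure_eq_top, Submodule.topologicalClosure_eq_top_iff,
      Submodule.eq_bot_iff]
    intro v hv
    have h1 : ∀ h, inner ℂ (h - U h) v = 0 := by
      intro h
      have hg : (h - U h, I • (h + U h)) ∈ A.graph := by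
        rw [hA]
        exact ⟨h, rfl⟩
      exact (Submodule.mem_orthogonal _ _).1 hv _ (graph_cases hg).1
    have h2 : U v = v := by
      refine ext_inner_left ℂ fun w => ?_
      obtain ⟨h, rfl⟩ := hsurj w
      have := h1 h
      rw [inner_sub_left, sub_eq_zero] at this
      rw [hin, this]
    have h3 : ((0 : H), v) ∈ A.graph := by
      rw [hA, mem_invCayleyGraph, smul_zero, add_zero, sub_zero, h2]
    exact graph_unique h3 A.graph.zero_mem
  · ext ⟨u, v⟩
    rw [Submodule.mem_adjoint_iff, hA, mem_invCayleyGraph]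
    -- The adjoint condition on (u, v) becomes orthogonality of (v - iu) - U(v + iu) to ran U = H,
    -- which is membership in the graph.
    have key : ∀ h, inner ℂ (I • (h + U h)) u - inner ℂ (h - U h) v
        = inner ℂ (U h) (v - I • u) - inner ℂ (U h) (U (v + I • u)) := by
      intro h
      rw [hin]
      simp only [inner_smul_left, inner_add_left, inner_sub_left, inner_sub_right, inner_add_right,
        inner_smul_right, conj_I]
      ring
    constructor
    · intro h
      refine ext_inner_left ℂ fun w => ?_
      obtain ⟨k, rfl⟩ := hsurj w
      have := h (k - U k) (I • (k + U k)) ⟨k, rfl⟩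
      rw [key, sub_eq_zero] at this
      exact this.symm
    · rintro h a b ⟨k, hk⟩
      simp only [LinearMap.prod_apply, Function.prod_apply, Prod.mk.injEq, ContinuousLinearMap.coe_coe,
        _root_.sub_apply, _root_.smul_apply, _root_.add_apply, one_apply_eq_self] at hk
      obtain ⟨rfl, rfl⟩ := hk
      rw [key, h, sub_self]

/-! ### Symmetric transformations with deficiency indices `(1,1)` -/

/-- `T` is closed and symmetric with deficiency indices `(1,1)`, and `φp`, `φm` are deficiency
vectors of equal norm. -/
structure IsClosedDeficient (T : H →ₗ.[ℂ] H) (φp φm : H) : Prop where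
  closed : T.IsClosed
  symm : IsSymmetric T
  indices : HasIndicesOneOne T
  pair : IsDeficiencyPair T φp φm

omit [CompleteSpace H] in
theorem eq_span_of_finrank_eq_one {K : Submodule ℂ H} (hK : Module.finrank ℂ K = 1) {v : H}
    (hv : v ∈ K) (hv0 : v ≠ 0) : K = Submodule.span ℂ {v} := by
  ext w
  rw [Submodule.mem_span_singleton]
  constructor
  · intro hw
    have hne : (⟨v, hv⟩ : K) ≠ 0 := fun h => hv0 (congrArg Subtype.val h)
    obtain ⟨c, hc⟩ := (finrank_eq_one_iff_of_nonzero' _ hne).1 hK ⟨w, hw⟩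
    exact ⟨c, congrArg Subtype.val hc⟩
  · rintro ⟨c, rfl⟩
    exact K.smul_mem c hv

namespace IsClosedDeficient

variable {T : H →ₗ.[ℂ] H} {φp φm : H}

omit [CompleteSpace H] in
theorem φm_ne_zero (h : IsClosedDeficient T φp φm) : φm ≠ 0 := by
  rw [← norm_ne_zero_iff, ← h.pair.norm_eq, norm_ne_zero_iff]
  exact h.pair.ne_zero

omit [CompleteSpace H] in
theorem norm_pos (h : IsClosedDeficient T φp φm) : 0 < ‖φp‖ := norm_pos_iff.2 h.pair.ne_zero

/-- The range is closed by the estimate at |Im z| = 1, so it is its own double orthocomplement, and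
its orthocomplement is the line through v. -/
theorem range_shift (h : IsClosedDeficient T φp φm) {z : ℂ} (hz : |z.im| = 1) {v : H}
    (hv : v ∈ defectSpace T (starRingEnd ℂ z)) (hv0 : v ≠ 0)
    (h1 : Module.finrank ℂ (defectSpace T (starRingEnd ℂ z)) = 1) (w : H) :
    (∃ x y, (x, y) ∈ T.graph ∧ y - z • x = w) ↔ inner ℂ v w = 0 := by
  have hcl : IsClosed (LinearMap.range (shift T z) : Set H) :=
    isClosed_range_shift h.closed z one_pos fun x y hxy => by
      rw [← hz]; exact h.symm.abs_im_mul_norm_le hxy z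
  have : CompleteSpace (LinearMap.range (shift T z)) := hcl.completeSpace_coe
  have hspan := eq_span_of_finrank_eq_one h1 hv hv0
  rw [defectSpace_eq_orthogonal, Complex.conj_conj] at hspan
  rw [← mem_range_shift, ← Submodule.orthogonal_orthogonal (LinearMap.range (shift T z)), hspan,
    Submodule.mem_orthogonal_singleton_iff_inner_right]

theorem range_add_I (h : IsClosedDeficient T φp φm) (w : H) :
    (∃ x y, (x, y) ∈ T.graph ∧ y + I • x = w) ↔ inner ℂ φp w = 0 := by
  have := h.range_shift (z := -I) (v := φp) (by simp) (by simpa using h.pair.memp)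
    h.pair.ne_zero (by rw [map_neg, conj_I, neg_neg]; exact h.indices.1) w
  simpa only [neg_smul, sub_neg_eq_add] using this

theorem range_sub_I (h : IsClosedDeficient T φp φm) (w : H) :
    (∃ x y, (x, y) ∈ T.graph ∧ y - I • x = w) ↔ inner ℂ φm w = 0 :=
  h.range_shift (z := I) (v := φm) (by simp) (by simpa using h.pair.memm)
    h.φm_ne_zero (by rw [conj_I]; exact h.indices.2) w

/-- `extendOfNorm` has the intended value only for a dense range and a norm bound; here the range of
T + i is closed, so `shiftToClosure` is onto, and the bound holds with constant 1. -/
theorem cayley_apply (h : IsClosedDeficient T φp φm) {x y : H} (hxy : (x, y) ∈ T.graph) :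
    cayley T (y + I • x) = y - I • x := by
  obtain ⟨hx, rfl⟩ := graph_cases hxy
  have hdense : DenseRange (shiftToClosure T) := by
    have hcl : IsClosed (LinearMap.range (shift T (-I)) : Set H) :=
      isClosed_range_shift h.closed _ one_pos fun x y hxy => by
        have := h.symm.abs_im_mul_norm_le hxy (-I)
        simpa using this
    refine Function.Surjective.denseRange ?_
    rintro ⟨w, hw⟩
    rw [hcl.submodule_topologicalClosure_eq] at hw
    obtain ⟨u, hu⟩ := hw
    exact ⟨u, Subtype.ext hu⟩
  have hnorm : ∃ C, ∀ u, ‖shift T I u‖ ≤ C * ‖shiftToClosure T u‖ := by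
    refine ⟨1, fun u => ?_⟩
    rw [one_mul]
    change ‖T u - I • (u : H)‖ ≤ ‖T u - (-I) • (u : H)‖
    rw [neg_smul, sub_neg_eq_add, h.symm.norm_add_I (T.mem_graph u)]
  have hval : T ⟨x, hx⟩ + I • x = (shiftToClosure T ⟨x, hx⟩ : H) := by
    change _ = T ⟨x, hx⟩ - (-I) • x
    rw [neg_smul, sub_neg_eq_add]
  rw [cayley, ContinuousLinearMap.comp_apply, hval,
    Submodule.orthogonalProjectionOnto_mem_subspace_eq_self,
    LinearMap.extendOfNorm_eq hdense hnorm]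
  rfl

theorem cayley_φp (h : IsClosedDeficient T φp φm) : cayley T φp = 0 := by
  have hm : φp ∈ (LinearMap.range (shift T (-I))).topologicalClosureᗮ := by
    rw [Submodule.orthogonal_closure]
    have := h.pair.memp
    rwa [defectSpace_eq_orthogonal, conj_I] at this
  rw [cayley, ContinuousLinearMap.comp_apply,
    Submodule.orthogonalProjectionOnto_apply_of_mem_orthogonal hm, map_zero]

theorem unitaryExt_apply (h : IsClosedDeficient T φp φm) (θ : ℝ) {x y : H}
    (hxy : (x, y) ∈ T.graph) : unitaryExt T φp φm θ (y + I • x) = y - I • x := by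
  have h0 : inner ℂ φp (y + I • x) = 0 := (h.range_add_I _).1 ⟨x, y, hxy, rfl⟩
  simp [unitaryExt, h.cayley_apply hxy, h0]

theorem unitaryExt_φp (h : IsClosedDeficient T φp φm) (θ : ℝ) :
    unitaryExt T φp φm θ φp = exp (2 * Real.pi * I * θ) • φm := by
  have hn : (‖φp‖ : ℂ) ^ 2 ≠ 0 := by
    have := h.norm_pos.ne'
    exact_mod_cast pow_ne_zero 2 this
  simp only [unitaryExt, _root_.add_apply, h.cayley_φp, _root_.smul_apply,
    ContinuousLinearMap.smulRight_apply, innerSL_apply_apply, inner_self_eq_norm_sq_to_K, zero_add,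
    smul_smul]
  congr 1
  exact div_mul_cancel₀ _ hn

theorem exists_decomp (h : IsClosedDeficient T φp φm) (w : H) :
    ∃ (x y : H) (c : ℂ), (x, y) ∈ T.graph ∧ w = (y + I • x) + c • φp := by
  have hn : (‖φp‖ : ℂ) ^ 2 ≠ 0 := by
    have := h.norm_pos.ne'
    exact_mod_cast pow_ne_zero 2 this
  obtain ⟨x, y, hxy, e⟩ := (h.range_add_I
    (w - (inner ℂ φp w / (‖φp‖ : ℂ) ^ 2) • φp)).2 (by
      rw [inner_sub_right, inner_smul_right, inner_self_eq_norm_sq_to_K]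
      simp only [coe_algebraMap]
      rw [div_mul_cancel₀ _ hn, sub_self])
  exact ⟨x, y, _, hxy, by rw [e, sub_add_cancel]⟩

theorem exists_decomp_minus (h : IsClosedDeficient T φp φm) (w : H) :
    ∃ (x y : H) (c : ℂ), (x, y) ∈ T.graph ∧ w = (y - I • x) + c • φm := by
  have hn : (‖φm‖ : ℂ) ^ 2 ≠ 0 := by
    have := norm_ne_zero_iff.2 h.φm_ne_zero
    exact_mod_cast pow_ne_zero 2 this
  obtain ⟨x, y, hxy, e⟩ := (h.range_sub_I
    (w - (inner ℂ φm w / (‖φm‖ : ℂ) ^ 2) • φm)).2 (by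
      rw [inner_sub_right, inner_smul_right, inner_self_eq_norm_sq_to_K]
      simp only [coe_algebraMap]
      rw [div_mul_cancel₀ _ hn, sub_self])
  exact ⟨x, y, _, hxy, by rw [e, sub_add_cancel]⟩

theorem norm_exp_θ (θ : ℝ) : ‖exp (2 * Real.pi * I * θ)‖ = 1 := by
  have : (2 * Real.pi * I * θ : ℂ) = ((2 * Real.pi * θ : ℝ) : ℂ) * I := by push_cast; ring
  rw [this, norm_exp_ofReal_mul_I]

/-- U_θ carries the orthogonal sum ran(T+i) ⊕ ℂφ₊ to ran(T-i) ⊕ ℂφ₋, isometrically on each summand;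
the second summand needs the equal norms. -/
theorem norm_unitaryExt (h : IsClosedDeficient T φp φm) (θ : ℝ) (w : H) :
    ‖unitaryExt T φp φm θ w‖ = ‖w‖ := by
  obtain ⟨x, y, c, hxy, rfl⟩ := h.exists_decomp w
  have h1 : inner ℂ (y + I • x) (c • φp) = 0 := by
    rw [inner_smul_right, ← inner_conj_symm, (h.range_add_I _).1 ⟨x, y, hxy, rfl⟩]; simp
  have h2 : inner ℂ (y - I • x) (c • exp (2 * Real.pi * I * θ) • φm) = 0 := by
    rw [inner_smul_right, inner_smul_right, ← inner_conj_symm,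
      (h.range_sub_I _).1 ⟨x, y, hxy, rfl⟩]; simp
  have e1 := norm_add_sq_eq_norm_sq_add_norm_sq_of_inner_eq_zero _ _ h1
  have e2 := norm_add_sq_eq_norm_sq_add_norm_sq_of_inner_eq_zero _ _ h2
  rw [map_add, map_smul, h.unitaryExt_apply θ hxy, h.unitaryExt_φp]
  rw [norm_smul c, norm_smul, norm_exp_θ, one_mul, ← h.pair.norm_eq, ← h.symm.norm_add_I hxy,
    ← norm_smul c φp, ← e1] at e2
  nlinarith [norm_nonneg (y - I • x + c • exp (2 * Real.pi * I * θ) • φm),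
    norm_nonneg (y + I • x + c • φp)]

theorem surjective_unitaryExt (h : IsClosedDeficient T φp φm) (θ : ℝ) :
    Function.Surjective (unitaryExt T φp φm θ) := by
  intro w
  obtain ⟨x, y, c, hxy, rfl⟩ := h.exists_decomp_minus w
  refine ⟨(y + I • x) + (c * (exp (2 * Real.pi * I * θ))⁻¹) • φp, ?_⟩
  rw [map_add, map_smul, h.unitaryExt_apply θ hxy, h.unitaryExt_φp, smul_smul,
    inv_mul_cancel_right₀ (exp_ne_zero _)]

theorem isSelfAdjoint_ext (h : IsClosedDeficient T φp φm) {θ : ℝ} {A : H →ₗ.[ℂ] H}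
    (hA : IsExtension T φp φm θ A) : IsSelfAdjoint A :=
  isSelfAdjoint_of_invCayleyGraph (h.norm_unitaryExt θ) (h.surjective_unitaryExt θ) hA

theorem mem_ext_graph {θ : ℝ} {A : H →ₗ.[ℂ] H} (hA : IsExtension T φp φm θ A) {x y : H} :
    (x, y) ∈ A.graph ↔ unitaryExt T φp φm θ (y + I • x) = y - I • x := by
  rw [hA, mem_invCayleyGraph]

/-- If y + ix ⟂ φ₊, then y + ix = v + iu for some (u, v) in the graph of T. U_θ maps both
expressions to y - ix = v - iu, and the two equations give (x, y) = (u, v). So T is determined by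
one extension and φ₊. -/
theorem mem_graph_iff (h : IsClosedDeficient T φp φm) {θ : ℝ} {A : H →ₗ.[ℂ] H}
    (hA : IsExtension T φp φm θ A) {x y : H} :
    (x, y) ∈ T.graph ↔ (x, y) ∈ A.graph ∧ inner ℂ φp (y + I • x) = 0 := by
  constructor
  · intro hxy
    exact ⟨(mem_ext_graph hA).2 (h.unitaryExt_apply θ hxy), (h.range_add_I _).1 ⟨x, y, hxy, rfl⟩⟩
  · rintro ⟨hxy, h0⟩
    obtain ⟨u, v, huv, e⟩ := (h.range_add_I _).2 h0
    have h1 := (mem_ext_graph hA).1 hxy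
    rw [← e, h.unitaryExt_apply θ huv] at h1
    have e2 : (2 : ℂ) • v = (2 : ℂ) • y := by
      have : (v + I • u) + (v - I • u) = (y + I • x) + (y - I • x) := by rw [e, h1]
      rw [add_add_sub_cancel, add_add_sub_cancel] at this
      rw [two_smul, two_smul, this]
    have ev : v = y := smul_right_injective H (two_ne_zero (α := ℂ)) e2
    subst ev
    have eu : u = x := smul_right_injective H I_ne_zero (add_left_cancel e)
    rwa [← eu]

theorem exists_extension {θ : ℝ}
    (hU : ∀ w, unitaryExt T φp φm θ w = w → w = 0) : ∃ A, IsExtension T φp φm θ A :=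
  exists_graph_eq_invCayleyGraph hU

/-- `U_θ = U_0 (1 + (e^{2πiθ} - 1) P)` with the projection `P` to the span of `φ₊`. -/
theorem unitaryExt_eq (θ : ℝ) (w : H) :
    unitaryExt T φp φm θ w = unitaryExt T φp φm 0 w +
      ((exp (2 * Real.pi * I * θ) - 1) * (inner ℂ φp w / (‖φp‖ : ℂ) ^ 2)) • φm := by
  simp only [unitaryExt, _root_.add_apply, _root_.smul_apply, ContinuousLinearMap.smulRight_apply,
    innerSL_apply_apply, smul_smul, add_assoc, ← add_smul]
  congr 2
  simp
  ring

end IsClosedDeficient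

end

section

variable {H : Type*} [NormedAddCommGroup H] [InnerProductSpace ℂ H]

/-! ### Expansions of deficiency vectors -/

theorem ofReal_sub_I_ne_zero (s : ℝ) : (s : ℂ) - I ≠ 0 := fun h => by
  have := congrArg Complex.im h
  simp at this

theorem ofReal_add_I_ne_zero (s : ℝ) : (s : ℂ) + I ≠ 0 := fun h => by
  have := congrArg Complex.im h
  simp at this

theorem norm_ofReal_sub_I_sq (s : ℝ) : ‖(s : ℂ) - I‖ ^ 2 = 1 + s ^ 2 := by
  rw [← Complex.normSq_eq_norm_sq, Complex.normSq_apply]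
  simp; ring

theorem norm_ofReal_add_I_sq (s : ℝ) : ‖(s : ℂ) + I‖ ^ 2 = 1 + s ^ 2 := by
  rw [← Complex.normSq_eq_norm_sq, Complex.normSq_apply]
  simp; ring

theorem norm_plus_coeff_sq {s s' : ℝ} (hs' : 0 ≤ s') :
    ‖(Real.sqrt s' : ℂ) / ((s : ℂ) - I)‖ ^ 2 = s' / (1 + s ^ 2) := by
  rw [norm_div, div_pow, norm_ofReal_sub_I_sq, norm_real, Real.norm_eq_abs, sq_abs, Real.sq_sqrt hs']

theorem norm_minus_coeff_sq {s s' : ℝ} (hs' : 0 ≤ s') :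
    ‖(Real.sqrt s' : ℂ) / ((s : ℂ) + I)‖ ^ 2 = s' / (1 + s ^ 2) := by
  rw [norm_div, div_pow, norm_ofReal_add_I_sq, norm_real, Real.norm_eq_abs, sq_abs, Real.sq_sqrt hs']

section Basis
variable {ι : Type*} {e : HilbertBasis ι ℂ H}

theorem coord_of_hasSum {c : ι → ℂ} {x : H} (h : HasSum (fun n => c n • e n) x) (m : ι) :
    inner ℂ (e m) x = c m := by
  have h1 := h.mapL (innerSL ℂ (e m))
  simp only [innerSL_apply_apply, inner_smul_right] at h1
  refine h1.unique ?_
  have h2 := hasSum_single (f := fun n => c n * inner ℂ (e m) (e n)) m fun n hn => by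
    rw [coord_eq_zero_or e hn.symm, mul_zero]
  rwa [coord_self, mul_one] at h2

theorem hasSum_of_coord {c : ι → ℂ} {x : H} (h : ∀ n, inner ℂ (e n) x = c n) :
    HasSum (fun n => c n • e n) x := by
  have := e.hasSum_repr x
  simpa only [e.repr_apply_apply, h] using this

theorem exists_smul_basis [CompleteSpace H] (e : HilbertBasis ι ℂ H) {u : ι → ℂ} (hu : ∀ n, ‖u n‖ = 1) :
    ∃ f : HilbertBasis ι ℂ H, ∀ n, f n = u n • e n := by
  have hu0 : ∀ n, u n ≠ 0 := fun n h => by simpa [h] using hu n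
  have hon : Orthonormal ℂ fun n => u n • e n := by
    refine ⟨fun n => by rw [norm_smul, hu, e.orthonormal.1, one_mul], fun n m hnm => ?_⟩
    simp only
    rw [inner_smul_left, inner_smul_right, e.orthonormal.2 hnm, mul_zero, mul_zero]
  have hbot : (Submodule.span ℂ (Set.range fun n => u n • e n))ᗮ = ⊥ := by
    rw [Submodule.eq_bot_iff]
    intro x hx
    refine eq_of_coord e fun n => ?_
    have := (Submodule.mem_orthogonal _ _).1 hx _ (Submodule.subset_span ⟨n, rfl⟩)
    rw [inner_smul_left] at this
    rw [inner_zero_right]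
    exact (mul_eq_zero.1 this).resolve_left (by simpa using hu0 n)
  exact ⟨HilbertBasis.mkOfOrthogonalEqBot hon hbot, fun n => by
    rw [HilbertBasis.coe_mkOfOrthogonalEqBot]⟩

end Basis

section Existence
variable [CompleteSpace H] {F : Set ℤ} {t t' : F → ℝ} {A : H →ₗ.[ℂ] H}

theorem HasSimpleSpectrum.exists_eigenbasis (hA : HasSimpleSpectrum A t) (ht : IsAdmissible F t t') :
    ∃ e : HilbertBasis F ℂ H, IsEigenbasis A t e :=
  TVBand.exists_eigenbasis hA.selfAdjoint ht.strictMono.injective hA.spec_eq ht.no_accPt hA.simple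

theorem HasSimpleSpectrum.eigenbasis_unique (hA : HasSimpleSpectrum A t)
    {e f : HilbertBasis F ℂ H} (he : IsEigenbasis A t e) (hf : IsEigenbasis A t f) (n : F) :
    ∃ u : ℂ, ‖u‖ = 1 ∧ f n = u • e n := by
  obtain ⟨u, hu⟩ := eigenvector_unique (hA.simple n) (basis_ne_zero e n) (he n) (hf n)
  refine ⟨u, ?_, hu⟩
  have := congrArg norm hu
  rwa [norm_smul, e.orthonormal.1, f.orthonormal.1, mul_one, eq_comm] at this

theorem HasSimpleSpectrum.exists_hasCoefficients (hA : HasSimpleSpectrum A t)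
    (ht : IsAdmissible F t t') : ∃ φp : H, HasCoefficients A t t' φp := by
  obtain ⟨e, he⟩ := hA.exists_eigenbasis ht
  obtain ⟨φ, hφ⟩ := exists_of_coord e (f := fun n => (Real.sqrt (t' n) : ℂ) / ((t n : ℂ) - I)) (by
    simpa only [norm_plus_coeff_sq (ht.nonneg _)] using ht.summable)
  refine ⟨φ, fun ψ hψ n => ?_⟩
  obtain ⟨u, hu, hun⟩ := hA.eigenbasis_unique he hψ n
  rw [hun, inner_smul_left, norm_mul, RCLike.norm_conj, hu, one_mul, hφ,
    norm_plus_coeff_sq (ht.nonneg _)]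

/-- Only the moduli of the coefficients of φ₊ are given. Rotating each basis vector by a phase
corrects the arguments; where the coefficient vanishes the phase is free and taken to be 1. -/
theorem HasSimpleSpectrum.exists_isExpansion (hA : HasSimpleSpectrum A t) (ht : IsAdmissible F t t')
    {φp : H} (hφp : HasCoefficients A t t' φp) :
    ∃ (φm : H) (e : HilbertBasis F ℂ H), IsExpansion A t t' φp φm e := by
  obtain ⟨e₀, he₀⟩ := hA.exists_eigenbasis ht
  have hn : ∀ n, ‖inner ℂ (e₀ n) φp‖ = ‖(Real.sqrt (t' n) : ℂ) / ((t n : ℂ) - I)‖ := fun n => by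
    rw [← sq_eq_sq₀ (norm_nonneg _) (norm_nonneg _), hφp e₀ he₀ n, norm_plus_coeff_sq (ht.nonneg _)]
  have hu : ∀ n, ∃ u : ℂ, ‖u‖ = 1 ∧ (starRingEnd ℂ) u * inner ℂ (e₀ n) φp
      = (Real.sqrt (t' n) : ℂ) / ((t n : ℂ) - I) := by
    intro n
    by_cases h0 : inner ℂ (e₀ n) φp = 0
    · refine ⟨1, norm_one, ?_⟩
      have := hn n
      rw [h0, norm_zero, eq_comm, norm_eq_zero] at this
      rw [h0, this, mul_zero]
    · refine ⟨(starRingEnd ℂ) ((Real.sqrt (t' n) : ℂ) / ((t n : ℂ) - I) / inner ℂ (e₀ n) φp), ?_, ?_⟩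
      · rw [RCLike.norm_conj, norm_div, ← hn, div_self (norm_ne_zero_iff.2 h0)]
      · rw [Complex.conj_conj, div_mul_cancel₀ _ h0]
  choose u hu1 hu2 using hu
  obtain ⟨e, he⟩ := exists_smul_basis e₀ hu1
  obtain ⟨φm, hφm⟩ := exists_of_coord e (f := fun n => (Real.sqrt (t' n) : ℂ) / ((t n : ℂ) + I)) (by
    simpa only [norm_minus_coeff_sq (ht.nonneg _)] using ht.summable)
  refine ⟨φm, e, ⟨fun n => ?_, hasSum_of_coord fun n => ?_, hasSum_of_coord hφm⟩⟩
  · rw [he, smul_comm]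
    exact graph_smul _ (he₀ n)
  · rw [he, inner_smul_left, hu2]

/-- A nonzero coefficient pins the phase of its eigenvector. The remaining vectors carry the
coefficient √t'_n = 0 and do not affect φ₋. -/
theorem HasSimpleSpectrum.isExpansion_unique (hA : HasSimpleSpectrum A t)
    {φp φm φm₂ : H} {e e₂ : HilbertBasis F ℂ H} (h : IsExpansion A t t' φp φm e)
    (h₂ : IsExpansion A t t' φp φm₂ e₂) : φm = φm₂ ∧ ∀ n, 0 < t' n → e n = e₂ n := by
  have key : ∀ n, 0 < t' n → e n = e₂ n := by
    intro n hn
    obtain ⟨u, hu, hun⟩ := hA.eigenbasis_unique h.eigen h₂.eigen n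
    have h1 := coord_of_hasSum h.plus n
    have h2 := coord_of_hasSum h₂.plus n
    have h0 : (Real.sqrt (t' n) : ℂ) / ((t n : ℂ) - I) ≠ 0 :=
      div_ne_zero (by exact_mod_cast (Real.sqrt_pos.2 hn).ne') (ofReal_sub_I_ne_zero _)
    rw [hun, inner_smul_left, h1] at h2
    have h3 : (starRingEnd ℂ) u = 1 := mul_right_cancel₀ h0 (by rw [h2, one_mul])
    have h4 : u = 1 := by rw [← Complex.conj_conj u, h3, map_one]
    rw [hun, h4, one_smul]
  refine ⟨?_, key⟩
  have e1 : (fun n => ((Real.sqrt (t' n) : ℂ) / ((t n : ℂ) + I)) • e n)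
      = fun n => ((Real.sqrt (t' n) : ℂ) / ((t n : ℂ) + I)) • e₂ n := by
    ext n
    by_cases hn : 0 < t' n
    · rw [key n hn]
    · rw [Real.sqrt_eq_zero'.2 (not_lt.1 hn)]; simp
  exact h.minus.unique (e1 ▸ h₂.minus)

end Existence

/-! ### Codimension-one symmetric restrictions of a self-adjoint operator -/

/-- The restriction of `A` to `{x ∈ dom A | ⟪φ, (A + i) x⟫ = 0}`. -/
def symmRestriction (A : H →ₗ.[ℂ] H) (φ : H) : H →ₗ.[ℂ] H :=
  (A.graph ⊓ LinearMap.ker ((innerSL ℂ φ).comp (ContinuousLinearMap.snd ℂ H H +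
    I • ContinuousLinearMap.fst ℂ H H) : H × H →ₗ[ℂ] ℂ)).toLinearPMap

theorem symmRestriction_graph (A : H →ₗ.[ℂ] H) (φ : H) :
    (symmRestriction A φ).graph = A.graph ⊓ LinearMap.ker ((innerSL ℂ φ).comp
      (ContinuousLinearMap.snd ℂ H H + I • ContinuousLinearMap.fst ℂ H H) : H × H →ₗ[ℂ] ℂ) := by
  refine Submodule.toLinearPMap_graph_eq _ ?_
  rintro ⟨x, y⟩ ⟨hxy, -⟩ hx
  exact A.graph_fst_eq_zero_snd hxy hx

theorem mem_symmRestriction {A : H →ₗ.[ℂ] H} {φ x y : H} :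
    (x, y) ∈ (symmRestriction A φ).graph ↔ (x, y) ∈ A.graph ∧ inner ℂ φ (y + I • x) = 0 := by
  rw [symmRestriction_graph, Submodule.mem_inf]
  rfl

/-- `T` is the symmetric restriction of `A`, diagonalized by `e`, given by the pair `φ±` with
coordinates `√t' / (t ∓ i)`. -/
structure IsDiagRestriction {ι : Type*} (A T : H →ₗ.[ℂ] H) [CompleteSpace H]
    (e : HilbertBasis ι ℂ H) (t t' : ι → ℝ) (φp φm : H) : Prop where
  selfAdjoint : IsSelfAdjoint A
  inj : Function.Injective t
  no_accPt : ∀ x : ℝ, ¬ AccPt x (Filter.principal (Set.range t))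
  nonneg : ∀ n, 0 ≤ t' n
  eigen : ∀ n, (e n, (t n : ℂ) • e n) ∈ A.graph
  coord_plus : ∀ n, inner ℂ (e n) φp = (Real.sqrt (t' n) : ℂ) / ((t n : ℂ) - I)
  coord_minus : ∀ n, inner ℂ (e n) φm = (Real.sqrt (t' n) : ℂ) / ((t n : ℂ) + I)
  mem_graph : ∀ x y, (x, y) ∈ T.graph ↔ (x, y) ∈ A.graph ∧ inner ℂ φp (y + I • x) = 0

namespace IsDiagRestriction
variable [CompleteSpace H] {ι : Type*} {A T : H →ₗ.[ℂ] H} {e : HilbertBasis ι ℂ H} {t t' : ι → ℝ}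
  {φp φm : H}

theorem hasSum_plus (h : IsDiagRestriction A T e t t' φp φm) {x y : H} (hxy : (x, y) ∈ A.graph) :
    HasSum (fun n => (Real.sqrt (t' n) : ℂ) * inner ℂ (e n) x) (inner ℂ φp (y + I • x)) := by
  convert hasSum_coord_inner e φp (y + I • x) using 2 with n
  rw [h.coord_plus, inner_add_right, inner_smul_right,
    (mem_graph_iff_coord h.selfAdjoint h.eigen).1 hxy n, map_div₀, map_sub, conj_ofReal, conj_ofReal,
    conj_I, sub_neg_eq_add, ← add_mul, ← mul_assoc, div_mul_cancel₀ _ (ofReal_add_I_ne_zero _)]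

theorem hasSum_minus (h : IsDiagRestriction A T e t t' φp φm) {x y : H} (hxy : (x, y) ∈ A.graph) :
    HasSum (fun n => (Real.sqrt (t' n) : ℂ) * inner ℂ (e n) x) (inner ℂ φm (y - I • x)) := by
  convert hasSum_coord_inner e φm (y - I • x) using 2 with n
  rw [h.coord_minus, inner_sub_right, inner_smul_right,
    (mem_graph_iff_coord h.selfAdjoint h.eigen).1 hxy n, map_div₀, map_add, conj_ofReal, conj_ofReal,
    conj_I, ← sub_eq_add_neg, ← sub_mul, ← mul_assoc, div_mul_cancel₀ _ (ofReal_sub_I_ne_zero _)]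

/-- Both sides are ∑ √t'_n x_n, because the factors t_n ± i cancel. Thus the single constraint
defining T describes ran(T+i) and ran(T-i) at once. -/
theorem inner_plus_eq_inner_minus (h : IsDiagRestriction A T e t t' φp φm) {x y : H}
    (hxy : (x, y) ∈ A.graph) : inner ℂ φp (y + I • x) = inner ℂ φm (y - I • x) :=
  (h.hasSum_plus hxy).unique (h.hasSum_minus hxy)

theorem norm_eq (h : IsDiagRestriction A T e t t' φp φm) : ‖φp‖ = ‖φm‖ := by
  rw [← sq_eq_sq₀ (norm_nonneg _) (norm_nonneg _)]
  refine (hasSum_coord_norm_sq e φp).unique ?_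
  convert hasSum_coord_norm_sq e φm using 2 with n
  rw [h.coord_plus, h.coord_minus, norm_plus_coeff_sq (h.nonneg n), norm_minus_coeff_sq (h.nonneg n)]

theorem closed (h : IsDiagRestriction A T e t t' φp φm) : T.IsClosed := by
  have hg : T.graph = (symmRestriction A φp).graph := by
    ext ⟨x, y⟩
    rw [h.mem_graph, mem_symmRestriction]
  change IsClosed (T.graph : Set (H × H))
  rw [hg, symmRestriction_graph]
  exact h.selfAdjoint.isClosed.inter (ContinuousLinearMap.isClosed_ker _)

theorem symm (h : IsDiagRestriction A T e t t' φp φm) : IsSymmetric T :=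
  isSymmetric_of_graph fun _ _ _ _ hx hu =>
    (isSymmetric_of_selfAdjoint h.selfAdjoint).inner_graph ((h.mem_graph _ _).1 hx).1
      ((h.mem_graph _ _).1 hu).1

theorem defectSpace_I (h : IsDiagRestriction A T e t t' φp φm) :
    defectSpace T I = Submodule.span ℂ {φp} := by
  have hr : LinearMap.range (shift T (starRingEnd ℂ I)) = (Submodule.span ℂ {φp})ᗮ := by
    ext w
    rw [mem_range_shift, Submodule.mem_orthogonal_singleton_iff_inner_right, conj_I]
    simp only [neg_smul, sub_neg_eq_add]
    constructor
    · rintro ⟨x, y, hxy, rfl⟩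
      exact ((h.mem_graph _ _).1 hxy).2
    · intro hw
      obtain ⟨x, y, hxy, rfl⟩ := exists_add_I h.selfAdjoint w
      exact ⟨x, y, (h.mem_graph _ _).2 ⟨hxy, hw⟩, rfl⟩
  rw [defectSpace_eq_orthogonal, hr, Submodule.orthogonal_orthogonal]

theorem defectSpace_neg_I (h : IsDiagRestriction A T e t t' φp φm) :
    defectSpace T (-I) = Submodule.span ℂ {φm} := by
  have hr : LinearMap.range (shift T (starRingEnd ℂ (-I))) = (Submodule.span ℂ {φm})ᗮ := by
    ext w
    rw [mem_range_shift, Submodule.mem_orthogonal_singleton_iff_inner_right, map_neg, conj_I, neg_neg]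
    constructor
    · rintro ⟨x, y, hxy, rfl⟩
      rw [← h.inner_plus_eq_inner_minus ((h.mem_graph _ _).1 hxy).1]
      exact ((h.mem_graph _ _).1 hxy).2
    · intro hw
      obtain ⟨x, y, hxy, rfl⟩ := exists_graph_of_not_mem_spec
        (not_mem_spec_of_im_ne_zero h.selfAdjoint (z := I) (by simp)) w
      exact ⟨x, y, (h.mem_graph _ _).2 ⟨hxy, (h.inner_plus_eq_inner_minus hxy).trans hw⟩, rfl⟩
  rw [defectSpace_eq_orthogonal, hr, Submodule.orthogonal_orthogonal]

theorem isClosedDeficient (h : IsDiagRestriction A T e t t' φp φm) (h0 : φp ≠ 0) :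
    IsClosedDeficient T φp φm where
  closed := h.closed
  symm := h.symm
  indices := by
    have hm : φm ≠ 0 := by rw [← norm_ne_zero_iff, ← h.norm_eq, norm_ne_zero_iff]; exact h0
    rw [HasIndicesOneOne, h.defectSpace_I, h.defectSpace_neg_I]
    exact ⟨finrank_span_singleton h0, finrank_span_singleton hm⟩
  pair :=
    { memp := by rw [h.defectSpace_I]; exact Submodule.mem_span_singleton_self _
      memm := by rw [h.defectSpace_neg_I]; exact Submodule.mem_span_singleton_self _
      norm_eq := h.norm_eq
      ne_zero := h0 }

/-- The Cayley transform of A sends φ₊ to φ₋ and agrees with that of T on φ₊^⊥, hence it is U_0. -/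
theorem isExtension_zero (h : IsDiagRestriction A T e t t' φp φm) (h0 : φp ≠ 0) :
    IsExtension T φp φm 0 A := by
  have hT := h.isClosedDeficient h0
  obtain ⟨u, v, huv, hplus⟩ := exists_add_I h.selfAdjoint φp
  -- Coordinatewise, (t - i)/(t + i) turns √t'/(t - i) into √t'/(t + i).
  have hminus : v - I • u = φm := by
    refine eq_of_coord e fun n => ?_
    have hc := (mem_graph_iff_coord h.selfAdjoint h.eigen).1 huv n
    have h1 := h.coord_plus n
    rw [← hplus, inner_add_right, inner_smul_right, hc, ← add_mul] at h1
    have h2 : inner ℂ (e n) u = (Real.sqrt (t' n) : ℂ) / ((t n : ℂ) - I) / ((t n : ℂ) + I) := by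
      rw [eq_div_iff (ofReal_add_I_ne_zero _), mul_comm, h1]
    rw [h.coord_minus, inner_sub_right, inner_smul_right, hc, ← sub_mul, h2]
    field_simp [ofReal_add_I_ne_zero (t n), ofReal_sub_I_ne_zero (t n)]
  have hU : unitaryExt T φp φm 0 φp = φm := by
    rw [hT.unitaryExt_φp]; simp
  have hn : (‖φp‖ : ℂ) ^ 2 ≠ 0 := by
    have := hT.norm_pos.ne'
    exact_mod_cast pow_ne_zero 2 this
  have key : ∀ x y, (x, y) ∈ A.graph → unitaryExt T φp φm 0 (y + I • x) = y - I • x := by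
    intro x y hxy
    set c := inner ℂ φp (y + I • x) / (‖φp‖ : ℂ) ^ 2 with hc
    have e1 : y - c • v + I • (x - c • u) = (y + I • x) - c • φp := by rw [← hplus]; module
    have hmem : (x - c • u, y - c • v) ∈ T.graph := by
      refine (h.mem_graph _ _).2 ⟨graph_sub hxy (graph_smul c huv), ?_⟩
      rw [e1, inner_sub_right, inner_smul_right, inner_self_eq_norm_sq_to_K]
      simp only [coe_algebraMap]
      rw [hc, div_mul_cancel₀ _ hn, sub_self]
    have h1 := hT.unitaryExt_apply 0 hmem
    rw [e1, map_sub, map_smul, hU, sub_eq_iff_eq_add] at h1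
    rw [h1, ← hminus]; module
  ext ⟨x, y⟩
  rw [mem_invCayleyGraph]
  refine ⟨key x y, fun hxy => ?_⟩
  obtain ⟨x', y', hxy', hp⟩ := exists_add_I h.selfAdjoint (y + I • x)
  have h1 := key _ _ hxy'
  rw [hp, hxy] at h1
  have e2 : (2 : ℂ) • y' = (2 : ℂ) • y := by
    have : (y' + I • x') + (y' - I • x') = (y + I • x) + (y - I • x) := by rw [hp, h1]
    rw [add_add_sub_cancel, add_add_sub_cancel] at this
    rw [two_smul, two_smul, this]
  have ey : y' = y := smul_right_injective H (two_ne_zero (α := ℂ)) e2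
  subst ey
  have ex : x' = x := smul_right_injective H I_ne_zero (add_left_cancel hp)
  rwa [← ex]

/-! ### The essential spectrum is empty -/

/-- Solving (A - z)x = w coordinatewise is possible once w ⟂ e_m for the at most one m with t_m = z,
and x ∈ dom T is one further linear condition on w. So ran(T - z) contains K^⊥ with K of finite
dimension, which makes it closed and of finite codimension; the kernel lies in K. -/
theorem essSpec_eq (h : IsDiagRestriction A T e t t' φp φm) : essSpec T = ∅ := by
  rw [Set.eq_empty_iff_forall_notMem]
  intro z hz
  refine hz ?_
  have hN : {n | (t n : ℂ) = z}.Subsingleton := by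
    intro n hn m hm
    apply h.inj
    have : (t n : ℂ) = t m := hn.trans hm.symm
    exact_mod_cast this
  have hfinE : ∀ v : H, FiniteDimensional ℂ (Submodule.span ℂ (insert v (e '' {n | (t n : ℂ) = z}))) :=
    fun v => FiniteDimensional.span_of_finite ℂ ((hN.finite.image e).insert v)
  obtain ⟨δ, hδ, hgap⟩ := gap_of_range h.no_accPt z
  let c : ι → ℂ := fun n => if (t n : ℂ) = z then 0 else ((t n : ℂ) - z)⁻¹
  have hc : ∀ n, ‖c n‖ ≤ δ⁻¹ := by
    intro n
    by_cases hn : (t n : ℂ) = z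
    · simp only [c, hn, if_true, norm_zero]; positivity
    · simp only [c, hn, if_false, norm_inv]
      exact inv_anti₀ hδ (hgap n hn)
  -- With x = c(A)w and y = w + zx, one has y + ix = (1 + (z + i)c(A))w; ψ is the adjoint of this
  -- operator applied to φ₊, so the constraint reads ⟪ψ, w⟫ = 0.
  obtain ⟨ψ, hψ⟩ := exists_of_coord_mul e (c := fun n => (starRingEnd ℂ) (1 + (z + I) * c n))
    (C := 1 + ‖z + I‖ * δ⁻¹) (fun n => by
      rw [RCLike.norm_conj]
      refine (norm_add_le _ _).trans ?_
      rw [norm_one, norm_mul]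
      gcongr
      exact hc n) φp
  let K := Submodule.span ℂ (insert ψ (e '' {n | (t n : ℂ) = z}))
  have hKfin : FiniteDimensional ℂ K := hfinE ψ
  have hKle : Kᗮ ≤ LinearMap.range (shift T z) := by
    intro w hw
    have hwψ : inner ℂ ψ w = 0 :=
      (Submodule.mem_orthogonal _ _).1 hw _ (Submodule.subset_span (Set.mem_insert _ _))
    have hwe : ∀ n, (t n : ℂ) = z → inner ℂ (e n) w = 0 := fun n hn =>
      (Submodule.mem_orthogonal _ _).1 hw _
        (Submodule.subset_span (Set.mem_insert_of_mem _ ⟨n, hn, rfl⟩))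
    obtain ⟨x, hx⟩ := exists_of_coord_mul e hc w
    refine mem_range_shift.2 ⟨x, w + z • x, (h.mem_graph _ _).2 ⟨?_, ?_⟩, by simp⟩
    · refine (mem_graph_iff_coord h.selfAdjoint h.eigen).2 fun n => ?_
      rw [inner_add_right, inner_smul_right, hx]
      by_cases hn : (t n : ℂ) = z
      · simp [hwe n hn]
      · simp only [c, hn, if_false]
        field_simp [sub_ne_zero.2 hn]
        ring
    · refine (hasSum_coord_inner e φp _).unique ?_
      rw [← hwψ]
      convert hasSum_coord_inner e ψ w using 2 with n
      rw [hψ, map_mul, Complex.conj_conj, inner_add_right, inner_add_right, inner_smul_right,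
        inner_smul_right, hx]
      ring
  have hq : FiniteDimensional ℂ (H ⧸ Kᗮ) :=
    Module.Finite.equiv (Submodule.quotientEquivOfIsCompl Kᗮ K
      (Submodule.isCompl_orthogonal K).symm).symm
  refine ⟨?_, ?_, ?_⟩
  · let f : LinearMap.ker (shift T z) →ₗ[ℂ] H := T.domain.subtype.comp (LinearMap.ker (shift T z)).subtype
    have hf : Function.Injective f := fun a b hab => Subtype.ext (Subtype.ext hab)
    have hfr : ∀ v, f v ∈ K := by
      intro v
      have hv := ((h.mem_graph _ _).1 (mem_ker_shift.1 v.2)).1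
      by_cases hm : ∃ m, (t m : ℂ) = z
      · obtain ⟨m, rfl⟩ := hm
        have := eigenvector_eq_smul h.selfAdjoint h.eigen h.inj hv
        change ((v : T.domain) : H) ∈ K
        rw [this]
        exact K.smul_mem _ (Submodule.subset_span (Set.mem_insert_of_mem _ ⟨m, rfl, rfl⟩))
      · have : ((v : T.domain) : H) = 0 := eq_of_coord e fun n => by
          rw [inner_zero_right]
          exact coord_eigenvector h.selfAdjoint h.eigen hv fun h0 => hm ⟨n, h0⟩
        change ((v : T.domain) : H) ∈ K
        rw [this]
        exact K.zero_mem
    refine FiniteDimensional.of_injective (f.codRestrict K hfr) fun a b hab => hf ?_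
    exact congrArg (fun k : K => (k : H)) hab
  · exact Submodule.isClosed_mono_of_finiteDimensional_quotient (Submodule.isClosed_orthogonal K) hKle
  · exact Module.Finite.of_surjective (Submodule.factor hKle) (Submodule.factor_surjective hKle)

/-! ### Regularity, simplicity and density -/

/-- Off the eigenvalue s = t_m, A - s is bounded below by the gap. The lost e_m-coordinate is
recovered from the constraint ⟪φ₊, y + ix⟫ = 0, in which it has a nonzero coefficient. -/
theorem regular (h : IsDiagRestriction A T e t t' φp φm) (hpos : ∀ n, 0 < t' n) : IsRegular T := by
  intro s
  obtain ⟨δ, hδ, hgap⟩ := gap_of_range h.no_accPt (s : ℂ)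
  suffices ∃ c : ℝ, 0 < c ∧ ∀ x y, (x, y) ∈ T.graph → c * ‖x‖ ≤ ‖y - (s : ℂ) • x‖ by
    obtain ⟨c, hc, hb⟩ := this
    exact ⟨c, hc, fun x => hb _ _ (T.mem_graph x)⟩
  have hcoord : ∀ x y, (x, y) ∈ A.graph → ∀ n,
      inner ℂ (e n) (y - (s : ℂ) • x) = ((t n : ℂ) - s) * inner ℂ (e n) x := by
    intro x y hxy n
    rw [inner_sub_right, inner_smul_right, (mem_graph_iff_coord h.selfAdjoint h.eigen).1 hxy n,
      sub_mul]
  by_cases hm : ∃ m, t m = s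
  · obtain ⟨m, rfl⟩ := hm
    have hφm : inner ℂ (e m) φp ≠ 0 := by
      rw [h.coord_plus]
      exact div_ne_zero (by exact_mod_cast (Real.sqrt_pos.2 (hpos m)).ne') (ofReal_sub_I_ne_zero _)
    -- The coefficient (t_m + i)⟪φ₊, e_m⟫ of the e_m-coordinate of x in the constraint.
    set a := ((t m : ℂ) + I) * (starRingEnd ℂ) (inner ℂ (e m) φp) with ha
    have ha0 : a ≠ 0 := mul_ne_zero (ofReal_add_I_ne_zero _) ((map_ne_zero _).2 hφm)
    have ha' : 0 < ‖a‖ := norm_pos_iff.2 ha0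
    -- First term for the part x' of x off e_m, second for the coordinate along e_m.
    set C := δ⁻¹ + (‖φp‖ + ‖(t m : ℂ) + I‖ * ‖φp‖ * δ⁻¹) / ‖a‖ with hC
    have hC0 : 0 < C := by positivity
    refine ⟨C⁻¹, by positivity, fun x y hxy => ?_⟩
    obtain ⟨hg, h0⟩ := (h.mem_graph _ _).1 hxy
    set w := y - (t m : ℂ) • x with hw
    set x' := x - inner ℂ (e m) x • e m with hx'
    have hx'n : ‖x'‖ ≤ δ⁻¹ * ‖w‖ := by
      refine norm_le_of_coord e (by positivity) fun n => ?_
      rw [hx', inner_sub_right, inner_smul_right, hw, hcoord _ _ hg]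
      by_cases hn : n = m
      · subst hn
        rw [coord_self]; simp
      · rw [coord_eq_zero_or e hn, mul_zero, sub_zero, norm_mul, inv_mul_eq_div, le_div_iff₀ hδ,
          mul_comm]
        gcongr
        exact hgap n fun h0 => hn (h.inj (by exact_mod_cast h0))
    have hxm : inner ℂ (e m) x * a = -(inner ℂ φp w + ((t m : ℂ) + I) * inner ℂ φp x') := by
      have e1 : y + I • x = w + ((t m : ℂ) + I) • (x' + inner ℂ (e m) x • e m) := by
        rw [hx', hw]; module
      rw [e1, inner_add_right, inner_smul_right, inner_add_right, inner_smul_right] at h0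
      rw [ha, inner_conj_symm]
      linear_combination h0
    have hxm' : ‖inner ℂ (e m) x‖ ≤ (‖φp‖ + ‖(t m : ℂ) + I‖ * ‖φp‖ * δ⁻¹) / ‖a‖ * ‖w‖ := by
      rw [div_mul_eq_mul_div, le_div_iff₀ ha', ← norm_mul, hxm, norm_neg]
      refine (norm_add_le _ _).trans ?_
      rw [norm_mul, add_mul]
      refine add_le_add (norm_inner_le_norm _ _) ?_
      calc ‖(t m : ℂ) + I‖ * ‖inner ℂ φp x'‖ ≤ ‖(t m : ℂ) + I‖ * (‖φp‖ * (δ⁻¹ * ‖w‖)) := by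
            gcongr
            exact (norm_inner_le_norm _ _).trans (by gcongr)
        _ = _ := by ring
    rw [inv_mul_le_iff₀ hC0]
    calc ‖x‖ = ‖x' + inner ℂ (e m) x • e m‖ := by rw [hx', sub_add_cancel]
      _ ≤ ‖x'‖ + ‖inner ℂ (e m) x‖ := by
          refine (norm_add_le _ _).trans ?_
          rw [norm_smul, e.orthonormal.1, mul_one]
      _ ≤ _ := by rw [hC, add_mul]; gcongr
  · refine ⟨δ, hδ, fun x y hxy => ?_⟩
    obtain ⟨hg, -⟩ := (h.mem_graph _ _).1 hxy
    rw [← inv_inv δ, inv_mul_le_iff₀ (by positivity)]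
    refine norm_le_of_coord e (by positivity) fun n => ?_
    rw [hcoord _ _ hg, norm_mul, inv_mul_eq_div, le_div_iff₀ hδ, mul_comm]
    gcongr
    exact hgap n fun h0 => hm ⟨n, by exact_mod_cast h0⟩

theorem pos_of_regular (h : IsDiagRestriction A T e t t' φp φm) (hr : IsRegular T) (n : ι) :
    0 < t' n := by
  refine (h.nonneg n).lt_of_ne' fun h0 => ?_
  obtain ⟨c, hc, hb⟩ := hr (t n)
  have hg : (e n, (t n : ℂ) • e n) ∈ T.graph := by
    refine (h.mem_graph _ _).2 ⟨h.eigen n, ?_⟩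
    rw [← add_smul, inner_smul_right, ← inner_conj_symm, h.coord_plus, h0]
    simp
  obtain ⟨hx, hT⟩ := graph_cases hg
  have := hb ⟨e n, hx⟩
  rw [shift_apply, hT] at this
  simp only [sub_self, norm_zero, e.orthonormal.1, mul_one] at this
  linarith

/-- Projecting e_n to a self-adjoint part S gives a vector in the graph of T satisfying the
eigenvalue equation for t_n, hence a multiple of e_n in dom T. As ⟪φ₊, e_n⟫ ≠ 0, this multiple is 0;
so S is orthogonal to the whole basis. -/
theorem simple (h : IsDiagRestriction A T e t t' φp φm) (hpos : ∀ n, 0 < t' n) : IsSimple T := by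
  intro S _ hS hbot _ hsa
  set B := restrictTo T S hS with hB
  refine hbot ((Submodule.eq_bot_iff _).2 fun x hx => ?_)
  have hBg : ∀ u v : S, (u, v) ∈ B.graph ↔ ((u : H), (v : H)) ∈ T.graph := by
    intro u v
    constructor
    · intro huv
      obtain ⟨hu, rfl⟩ := graph_cases huv
      exact T.mem_graph ⟨(u : H), hu⟩
    · intro huv
      obtain ⟨hu, hv⟩ := graph_cases huv
      have : B ⟨u, hu⟩ = v := Subtype.ext hv
      rw [← this]
      exact B.mem_graph ⟨u, hu⟩
  have hp : ∀ n, S.orthogonalProjectionOnto (e n) = 0 := by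
    intro n
    set p := S.orthogonalProjectionOnto (e n) with hpdef
    have hin : ∀ u : S, inner ℂ u p = inner ℂ (u : H) (e n) := fun u => by
      rw [hpdef, Submodule.inner_orthogonalProjectionOnto_eq_of_mem_left]
    have hpg : (p, (t n : ℂ) • p) ∈ B.graph := by
      refine mem_graph_of_selfAdjoint hsa fun u v huv => ?_
      have h1 := ((h.mem_graph _ _).1 ((hBg u v).1 huv)).1
      rw [inner_smul_right, hin, hin,
        (isSymmetric_of_selfAdjoint h.selfAdjoint).inner_graph h1 (h.eigen n), inner_smul_right]
    obtain ⟨hpA, hp0⟩ := (h.mem_graph _ _).1 ((hBg _ _).1 hpg)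
    have hpe := eigenvector_eq_smul h.selfAdjoint h.eigen h.inj hpA
    rw [Submodule.coe_smul, ← add_smul, inner_smul_right, hpe, inner_smul_right,
      ← inner_conj_symm φp, h.coord_plus] at hp0
    have hne : (starRingEnd ℂ) ((Real.sqrt (t' n) : ℂ) / ((t n : ℂ) - I)) ≠ 0 := by
      rw [map_ne_zero]
      exact div_ne_zero (by exact_mod_cast (Real.sqrt_pos.2 (hpos n)).ne') (ofReal_sub_I_ne_zero _)
    have hc : inner ℂ (e n) (p : H) = 0 :=
      (mul_eq_zero.1 ((mul_eq_zero.1 hp0).resolve_left (ofReal_add_I_ne_zero _))).resolve_right hne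
    rw [hc, zero_smul] at hpe
    exact Subtype.ext hpe
  refine eq_of_coord e fun n => ?_
  have := Submodule.inner_orthogonalProjectionOnto_eq_of_mem_right (K := S) ⟨x, hx⟩ (e n)
  rw [hp n, inner_zero_left] at this
  rw [inner_zero_right]
  exact this.symm

/-- Regularity alone forces positivity, and positivity yields simplicity as well. -/
theorem memSR_iff (h : IsDiagRestriction A T e t t' φp φm) (h0 : φp ≠ 0) :
    MemSR T ↔ ∀ n, 0 < t' n :=
  ⟨fun hT => h.pos_of_regular hT.regular, fun hpos =>
    { closed := h.closed
      symm := h.symm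
      indices := (h.isClosedDeficient h0).indices
      simple := h.simple hpos
      regular := h.regular hpos }⟩

/-- If w ⟂ dom T, then u = (A - i)⁻¹w satisfies ⟪u, (A+i)x⟫ = ⟪w, x⟫ and is therefore orthogonal to
φ₊^⊥. So u = cφ₊ and w has coordinates c√t'_n. Conversely these coordinates, when square summable,
define a vector orthogonal to dom T. -/
theorem dense_iff (h : IsDiagRestriction A T e t t' φp φm) (h0 : φp ≠ 0) :
    Dense (T.domain : Set H) ↔ ¬ Summable t' := by
  rw [Submodule.dense_iff_topologicalClosure_eq_top, Submodule.topologicalClosure_eq_top_iff,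
    ← not_iff_not, not_not, Submodule.eq_bot_iff]
  push Not
  have hsq : ∀ n, ‖(Real.sqrt (t' n) : ℂ)‖ ^ 2 = t' n := fun n => by
    rw [norm_real, Real.norm_eq_abs, sq_abs, Real.sq_sqrt (h.nonneg n)]
  constructor
  · rintro ⟨w, hw, hw0⟩
    obtain ⟨u, hu⟩ := exists_of_coord_mul e (c := fun n => ((t n : ℂ) - I)⁻¹) (C := 1) (fun n => by
      rw [norm_inv]
      refine inv_le_one_of_one_le₀ ?_
      have := Complex.abs_im_le_norm ((t n : ℂ) - I)
      simpa using this) w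
    have hmem : u ∈ (Submodule.span ℂ {φp})ᗮᗮ := by
      rw [Submodule.mem_orthogonal']
      intro y hy
      rw [Submodule.mem_orthogonal_singleton_iff_inner_right] at hy
      obtain ⟨x, y', hxy, rfl⟩ := exists_add_I h.selfAdjoint y
      have hx := (Submodule.mem_orthogonal' _ _).1 hw x
        (graph_cases ((h.mem_graph _ _).2 ⟨hxy, hy⟩)).1
      rw [← hx]
      refine (hasSum_coord_inner e u _).unique ?_
      convert hasSum_coord_inner e w x using 2 with n
      rw [hu, inner_add_right, inner_smul_right,
        (mem_graph_iff_coord h.selfAdjoint h.eigen).1 hxy n, ← add_mul, map_mul, map_inv₀, map_sub,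
        conj_ofReal, conj_I, sub_neg_eq_add]
      field_simp [ofReal_add_I_ne_zero (t n)]
    rw [Submodule.orthogonal_orthogonal, Submodule.mem_span_singleton] at hmem
    obtain ⟨c, rfl⟩ := hmem
    have hw' : ∀ n, inner ℂ (e n) w = c * (Real.sqrt (t' n) : ℂ) := by
      intro n
      have := hu n
      rw [inner_smul_right, h.coord_plus, inv_mul_eq_div, ← mul_div_assoc] at this
      exact ((div_left_inj' (ofReal_sub_I_ne_zero _)).1 this).symm
    have hc : c ≠ 0 := by
      rintro rfl
      exact hw0 (eq_of_coord e fun n => by rw [hw', zero_mul, inner_zero_right])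
    have := summable_coord e w
    simp only [hw', norm_mul, mul_pow, hsq] at this
    exact (summable_mul_left_iff (pow_ne_zero 2 (norm_ne_zero_iff.2 hc))).1 this
  · intro hsum
    obtain ⟨w, hw⟩ := exists_of_coord e (f := fun n => (Real.sqrt (t' n) : ℂ))
      (by simpa only [hsq] using hsum)
    refine ⟨w, ?_, ?_⟩
    · rw [Submodule.mem_orthogonal']
      intro x hx
      obtain ⟨hxA, hx0⟩ := (h.mem_graph _ _).1 (T.mem_graph ⟨x, hx⟩)
      rw [← hx0]
      refine (hasSum_coord_inner e w x).unique ?_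
      convert h.hasSum_plus hxA using 2 with n
      rw [hw, conj_ofReal]
    · rintro rfl
      refine h0 (eq_of_coord e fun n => ?_)
      rw [h.coord_plus, ← hw, inner_zero_right, zero_div]

end IsDiagRestriction

end

section

variable {H : Type*} [NormedAddCommGroup H] [InnerProductSpace ℂ H] [CompleteSpace H]

/-! ### Realizations of admissible pairs -/

theorem IsRealization.isClosedDeficient {A T : H →ₗ.[ℂ] H} {φp φm : H}
    (h : IsRealization A φp φm T) : IsClosedDeficient T φp φm :=
  ⟨h.closed, h.symm, h.indices, h.pair⟩

section Realization
variable {F : Set ℤ} {t t' : F → ℝ} {A T : H →ₗ.[ℂ] H} {φp φm : H} {e : HilbertBasis F ℂ H}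

theorem IsExpansion.isDiagRestriction (h : IsExpansion A t t' φp φm e) (ht : IsAdmissible F t t')
    (hA : IsSelfAdjoint A)
    (hT : ∀ x y, (x, y) ∈ T.graph ↔ (x, y) ∈ A.graph ∧ inner ℂ φp (y + I • x) = 0) :
    IsDiagRestriction A T e t t' φp φm where
  selfAdjoint := hA
  inj := ht.strictMono.injective
  no_accPt := ht.no_accPt
  nonneg := ht.nonneg
  eigen := h.eigen
  coord_plus := coord_of_hasSum h.plus
  coord_minus := coord_of_hasSum h.minus
  mem_graph := hT

omit [CompleteSpace H] in
theorem IsExpansion.ne_zero (h : IsExpansion A t t' φp φm e) (ht : IsAdmissible F t t')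
    (h0 : ∃ n, t' n ≠ 0) : φp ≠ 0 := by
  rintro rfl
  obtain ⟨n, hn⟩ := h0
  have := coord_of_hasSum h.plus n
  rw [inner_zero_right, eq_comm, div_eq_zero_iff] at this
  rcases this with h1 | h1
  · exact hn ((Real.sqrt_eq_zero (ht.nonneg n)).1 (by exact_mod_cast h1))
  · exact ofReal_sub_I_ne_zero _ h1

theorem IsExpansion.existsUnique_isRealization (h : IsExpansion A t t' φp φm e)
    (ht : IsAdmissible F t t') (h0 : ∃ n, t' n ≠ 0) (hA : IsSelfAdjoint A) :
    ∃! T : H →ₗ.[ℂ] H, IsRealization A φp φm T := by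
  have hφ := h.ne_zero ht h0
  have hD := h.isDiagRestriction (T := symmRestriction A φp) ht hA fun _ _ => mem_symmRestriction
  have hC := hD.isClosedDeficient hφ
  refine ⟨symmRestriction A φp, ⟨hC.closed, hC.symm, hC.indices, hD.essSpec_eq, hC.pair,
    hD.isExtension_zero hφ⟩, fun T hT => LinearPMap.eq_of_eq_graph ?_⟩
  ext ⟨x, y⟩
  rw [mem_symmRestriction, hT.isClosedDeficient.mem_graph_iff hT.ext_zero]

end Realization

/-! ### The spectrum of extensions of regular transformations -/

theorem not_mem_spec_near {A : H →ₗ.[ℂ] H} (hA : IsSelfAdjoint A) {s : ℝ}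
    (hs : (s : ℂ) ∉ spec A) : ∃ δ > 0, ∀ r : ℝ, |r - s| < δ → (r : ℂ) ∉ spec A := by
  obtain ⟨c, hc, hb⟩ := (not_mem_spec_iff hA s).1 hs
  refine ⟨c, hc, fun r hr => (not_mem_spec_iff hA r).2 ⟨c - |r - s|, by linarith, fun x y hxy => ?_⟩⟩
  have h1 := hb x y hxy
  have e1 : y - (s : ℂ) • x = (y - (r : ℂ) • x) + ((r - s : ℝ) : ℂ) • x := by push_cast; module
  have h2 := norm_add_le (y - (r : ℂ) • x) (((r - s : ℝ) : ℂ) • x)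
  rw [← e1, norm_smul, norm_real, Real.norm_eq_abs] at h2
  linarith

namespace IsClosedDeficient
variable {T B : H →ₗ.[ℂ] H} {φp φm : H} {θ : ℝ}

omit [CompleteSpace H] in
theorem _root_.TVBand.IsRegular.bddBelow (hr : IsRegular T) (s : ℝ) :
    ∃ c : ℝ, 0 < c ∧ ∀ x y, (x, y) ∈ T.graph → c * ‖x‖ ≤ ‖y - (s : ℂ) • x‖ := by
  obtain ⟨c, hc, h⟩ := hr s
  refine ⟨c, hc, fun x y hxy => ?_⟩
  obtain ⟨hx, rfl⟩ := graph_cases hxy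
  exact h ⟨x, hx⟩

omit [CompleteSpace H] in
theorem _root_.TVBand.IsRegular.eq_zero (hr : IsRegular T) {s : ℝ} {x : H}
    (hx : (x, (s : ℂ) • x) ∈ T.graph) : x = 0 := by
  obtain ⟨c, hc, h⟩ := hr.bddBelow s
  have := h _ _ hx
  rw [sub_self, norm_zero] at this
  by_contra h0
  have := mul_pos hc (norm_pos_iff.2 h0)
  linarith

/-- An eigenvector of the extension orthogonal to φ₊ would belong to the graph of T, against
regularity. -/
theorem inner_eigenvector_ne_zero (h : IsClosedDeficient T φp φm) (hr : IsRegular T)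
    (hB : IsExtension T φp φm θ B) {s : ℝ} {x : H} (hx0 : x ≠ 0)
    (hx : (x, (s : ℂ) • x) ∈ B.graph) : inner ℂ φp x ≠ 0 := by
  intro h0
  refine hx0 (hr.eq_zero ((h.mem_graph_iff hB).2 ⟨hx, ?_⟩))
  rw [← add_smul, inner_smul_right, h0, mul_zero]

/-- dom B = dom T + ℂk: since ⟪φ₊, k⟫ ≠ 0, a multiple of k removes the defect of x. -/
theorem exists_decomp_eigenvector (h : IsClosedDeficient T φp φm) (hr : IsRegular T)
    (hB : IsExtension T φp φm θ B) {s : ℝ} {k : H} (hk0 : k ≠ 0)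
    (hk : (k, (s : ℂ) • k) ∈ B.graph) {x y : H} (hxy : (x, y) ∈ B.graph) :
    ∃ a : ℂ, (x - a • k, y - a • (s : ℂ) • k) ∈ T.graph := by
  have hne := h.inner_eigenvector_ne_zero hr hB hk0 hk
  have hne' : ((s : ℂ) + I) * inner ℂ φp k ≠ 0 := mul_ne_zero (ofReal_add_I_ne_zero s) hne
  refine ⟨inner ℂ φp (y + I • x) / (((s : ℂ) + I) * inner ℂ φp k),
    (h.mem_graph_iff hB).2 ⟨graph_sub hxy (graph_smul _ hk), ?_⟩⟩
  have e1 : ∀ a : ℂ, y - a • (s : ℂ) • k + I • (x - a • k)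
      = (y + I • x) - (a * ((s : ℂ) + I)) • k := fun a => by module
  rw [e1, inner_sub_right, inner_smul_right, mul_assoc, div_mul_cancel₀ _ hne', sub_self]

theorem finrank_ker_eigenvalue (h : IsClosedDeficient T φp φm) (hr : IsRegular T)
    (hB : IsExtension T φp φm θ B) {s : ℝ} {k : H} (hk0 : k ≠ 0)
    (hk : (k, (s : ℂ) • k) ∈ B.graph) :
    Module.finrank ℂ (LinearMap.ker (shift B (s : ℂ))) = 1 := by
  refine finrank_ker_shift_eq_one hk0 hk fun x hx => ?_
  obtain ⟨a, ha⟩ := h.exists_decomp_eigenvector hr hB hk0 hk hx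
  refine ⟨a, sub_eq_zero.1 (hr.eq_zero (s := s) ?_)⟩
  convert ha using 2
  module

/-- On k^⊥ the operator B - s inherits the bound c of T - s: x₂ - ak lies in dom T, has the same
image as x₂ under B - s, and is no shorter than x₂. -/
theorem not_mem_spec_near_eigenvalue (h : IsClosedDeficient T φp φm) (hr : IsRegular T)
    (hB : IsExtension T φp φm θ B) {s : ℝ} {k : H} (hk1 : ‖k‖ = 1)
    (hk : (k, (s : ℂ) • k) ∈ B.graph) :
    ∃ δ > 0, ∀ r : ℝ, r ≠ s → |r - s| < δ → (r : ℂ) ∉ spec B := by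
  obtain ⟨c, hc, hb⟩ := hr.bddBelow s
  have hBs := h.isSelfAdjoint_ext hB
  have hsym := isSymmetric_of_selfAdjoint hBs
  have hk0 : k ≠ 0 := by rw [← norm_pos_iff, hk1]; exact one_pos
  -- For |r - s| < c/2, B - r is bounded below on k^⊥ by c - |r - s| ≥ |r - s|, and on k its factor
  -- is |r - s| exactly.
  refine ⟨c / 2, by positivity, fun r hrs hrc => (not_mem_spec_iff hBs r).2
    ⟨|r - s|, abs_pos.2 (sub_ne_zero.2 hrs), fun x y hxy => ?_⟩⟩
  set β := inner ℂ k x with hβ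
  set x₂ := x - β • k with hx₂
  set y₂ := y - β • (s : ℂ) • k with hy₂
  have hkk : inner ℂ k k = (1 : ℂ) := by rw [inner_self_eq_norm_sq_to_K, hk1]; simp
  have hg₂ : (x₂, y₂) ∈ B.graph := graph_sub hxy (graph_smul β hk)
  have hkx : inner ℂ k x₂ = 0 := by
    rw [hx₂, inner_sub_right, inner_smul_right, hkk, mul_one, sub_self]
  have hky : inner ℂ k y₂ = 0 := by
    rw [← hsym.inner_graph hk hg₂, inner_smul_left, hkx, mul_zero]
  obtain ⟨a, ha⟩ := h.exists_decomp_eigenvector hr hB hk0 hk hg₂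
  have hle : ‖x₂‖ ≤ ‖x₂ - a • k‖ := by
    have h0 : inner ℂ x₂ (-(a • k)) = 0 := by
      rw [inner_neg_right, inner_smul_right, ← inner_conj_symm, hkx]; simp
    have := norm_add_sq_eq_norm_sq_add_norm_sq_of_inner_eq_zero _ _ h0
    rw [← sub_eq_add_neg] at this
    exact le_of_sq_le_sq (by nlinarith [norm_nonneg (-(a • k))]) (norm_nonneg _)
  have hb₂ : c * ‖x₂‖ ≤ ‖y₂ - (s : ℂ) • x₂‖ := by
    have := hb _ _ ha
    have e1 : y₂ - a • (s : ℂ) • k - (s : ℂ) • (x₂ - a • k) = y₂ - (s : ℂ) • x₂ := by module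
    rw [e1] at this
    exact (mul_le_mul_of_nonneg_left hle hc.le).trans this
  have hb₃ : |r - s| * ‖x₂‖ ≤ ‖y₂ - (r : ℂ) • x₂‖ := by
    have e1 : y₂ - (s : ℂ) • x₂ = (y₂ - (r : ℂ) • x₂) + ((r - s : ℝ) : ℂ) • x₂ := by
      push_cast; module
    have h1 := norm_add_le (y₂ - (r : ℂ) • x₂) (((r - s : ℝ) : ℂ) • x₂)
    rw [← e1, norm_smul, norm_real, Real.norm_eq_abs] at h1
    nlinarith [norm_nonneg x₂]
  have ex : ‖x‖ * ‖x‖ = ‖β‖ * ‖β‖ + ‖x₂‖ * ‖x₂‖ := by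
    have h0 : inner ℂ (β • k) x₂ = 0 := by rw [inner_smul_left, hkx, mul_zero]
    have := norm_add_sq_eq_norm_sq_add_norm_sq_of_inner_eq_zero _ _ h0
    rwa [hx₂, add_sub_cancel, norm_smul, hk1, mul_one] at this
  have ey : ‖y - (r : ℂ) • x‖ * ‖y - (r : ℂ) • x‖ =
      (‖β‖ * |r - s|) * (‖β‖ * |r - s|) + ‖y₂ - (r : ℂ) • x₂‖ * ‖y₂ - (r : ℂ) • x₂‖ := by
    have h0 : inner ℂ ((β * ((s - r : ℝ) : ℂ)) • k) (y₂ - (r : ℂ) • x₂) = 0 := by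
      rw [inner_smul_left, inner_sub_right, inner_smul_right, hkx, hky]; simp
    have := norm_add_sq_eq_norm_sq_add_norm_sq_of_inner_eq_zero _ _ h0
    have e1 : (β * ((s - r : ℝ) : ℂ)) • k + (y₂ - (r : ℂ) • x₂) = y - (r : ℂ) • x := by
      rw [hx₂, hy₂]; push_cast; module
    rwa [e1, norm_smul, hk1, mul_one, norm_mul, norm_real, Real.norm_eq_abs, abs_sub_comm s r] at this
  refine le_of_sq_le_sq ?_ (norm_nonneg _)
  have hsq : (|r - s| * ‖x₂‖) * (|r - s| * ‖x₂‖) ≤ ‖y₂ - (r : ℂ) • x₂‖ * ‖y₂ - (r : ℂ) • x₂‖ :=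
    mul_self_le_mul_self (by positivity) hb₃
  calc (|r - s| * ‖x‖) ^ 2 = |r - s| ^ 2 * (‖x‖ * ‖x‖) := by ring
    _ = (‖β‖ * |r - s|) * (‖β‖ * |r - s|) + (|r - s| * ‖x₂‖) * (|r - s| * ‖x₂‖) := by rw [ex]; ring
    _ ≤ ‖y - (r : ℂ) • x‖ * ‖y - (r : ℂ) • x‖ := by rw [ey]; linarith
    _ = _ := by ring

/-- Write dom B = dom T + ℂu with (B + i)u = φ₊. Without eigenvectors, v₀ = (B - s)u is outside the
closed space W = ran(T - s), so its component q orthogonal to W bounds the coefficient of u, and the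
rest is bounded by regularity. -/
theorem not_mem_spec_of_no_eigenvector (h : IsClosedDeficient T φp φm) (hr : IsRegular T)
    (hB : IsExtension T φp φm θ B) {s : ℝ} (hk : ∀ k, (k, (s : ℂ) • k) ∈ B.graph → k = 0) :
    (s : ℂ) ∉ spec B := by
  obtain ⟨c, hc, hb⟩ := hr.bddBelow s
  have hBs := h.isSelfAdjoint_ext hB
  obtain ⟨u, v, huv, hφ⟩ := exists_add_I hBs φp
  have hcl := isClosed_range_shift h.closed (s : ℂ) hc hb
  set W := LinearMap.range (shift T (s : ℂ)) with hW
  have : CompleteSpace W := hcl.completeSpace_coe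
  set v₀ := v - (s : ℂ) • u with hv₀
  have hφ0 : inner ℂ φp φp ≠ (0 : ℂ) := inner_self_ne_zero.2 h.pair.ne_zero
  have hTB : ∀ {x y}, (x, y) ∈ T.graph → (x, y) ∈ B.graph := fun hx => ((h.mem_graph_iff hB).1 hx).1
  have hvW : v₀ ∉ W := by
    intro hv
    obtain ⟨x, y, hxy, e⟩ := mem_range_shift.1 hv
    have hk' : u - x = 0 := by
      refine hk _ ?_
      have := graph_sub huv (hTB hxy)
      convert this using 2
      rw [hv₀] at e
      rw [smul_sub, eq_comm, sub_eq_sub_iff_sub_eq_sub]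
      exact e.symm
    rw [sub_eq_zero] at hk'
    subst hk'
    have hvy : v = y := graph_unique huv (hTB hxy)
    have := (h.range_add_I (v + I • u)).1 ⟨u, v, hvy ▸ hxy, rfl⟩
    rw [hφ] at this
    exact hφ0 this
  set q := v₀ - W.orthogonalProjectionOnto v₀ with hq
  have hqW : q ∈ Wᗮ := W.sub_starProjection_mem_orthogonal v₀
  have hq0 : q ≠ 0 := fun h0 => hvW (by
    rw [sub_eq_zero.1 h0]; exact (W.orthogonalProjectionOnto v₀).2)
  have hqv : inner ℂ q v₀ = inner ℂ q q := by
    conv_rhs => rw [hq, inner_sub_right, ← hq]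
    rw [(Submodule.mem_orthogonal' _ _).1 hqW _ (W.orthogonalProjectionOnto v₀).2, sub_zero]
  have hqn : 0 < ‖q‖ := norm_pos_iff.2 hq0
  have ha : ∀ (a : ℂ) (w : H), w ∈ W → ‖a‖ * ‖q‖ ≤ ‖w + a • v₀‖ := by
    intro a w hw
    have h1 := norm_inner_le_norm (𝕜 := ℂ) q (w + a • v₀)
    rw [inner_add_right, inner_smul_right, (Submodule.mem_orthogonal' _ _).1 hqW _ hw, zero_add, hqv,
      inner_self_eq_norm_sq_to_K, norm_mul] at h1
    have h2 : ‖((‖q‖ : ℂ)) ^ 2‖ = ‖q‖ * ‖q‖ := by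
      rw [norm_pow, norm_real, norm_norm, sq]
    simp only [coe_algebraMap] at h1
    rw [h2, ← mul_assoc, mul_comm (‖a‖ * ‖q‖)] at h1
    exact le_of_mul_le_mul_left h1 hqn
  set C := (1 + ‖v₀‖ / ‖q‖) / c + ‖u‖ / ‖q‖ + 1 with hC
  have hC0 : 0 < C := by positivity
  refine (not_mem_spec_iff hBs s).2 ⟨C⁻¹, by positivity, fun x y hxy => ?_⟩
  rw [inv_mul_le_iff₀ hC0]
  obtain ⟨a, hab⟩ : ∃ a : ℂ, (x - a • u, y - a • v) ∈ T.graph := by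
    refine ⟨inner ℂ φp (y + I • x) / inner ℂ φp φp,
      (h.mem_graph_iff hB).2 ⟨graph_sub hxy (graph_smul _ huv), ?_⟩⟩
    have e1 : ∀ a : ℂ, y - a • v + I • (x - a • u) = (y + I • x) - a • (v + I • u) := fun a => by
      module
    rw [e1, hφ, inner_sub_right, inner_smul_right, div_mul_cancel₀ _ hφ0, sub_self]
  set x' := x - a • u
  set w := (y - a • v) - (s : ℂ) • x' with hw
  have hwW : w ∈ W := mem_range_shift.2 ⟨_, _, hab, rfl⟩
  have ey : y - (s : ℂ) • x = w + a • v₀ := by rw [hw, hv₀]; module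
  set N := ‖y - (s : ℂ) • x‖ with hN
  have hN0 : 0 ≤ N := norm_nonneg _
  have h1 : ‖a‖ ≤ N / ‖q‖ := by
    rw [le_div_iff₀ hqn, hN, ey]
    exact ha a w hwW
  have h2 : ‖w‖ ≤ (1 + ‖v₀‖ / ‖q‖) * N := by
    have e1 : w = (y - (s : ℂ) • x) - a • v₀ := by rw [ey, add_sub_cancel_right]
    rw [e1]
    refine (norm_sub_le _ _).trans ?_
    rw [norm_smul]
    calc N + ‖a‖ * ‖v₀‖ ≤ N + N / ‖q‖ * ‖v₀‖ := by gcongr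
      _ = _ := by ring
  have h3 : ‖x'‖ ≤ (1 + ‖v₀‖ / ‖q‖) * N / c := by
    rw [le_div_iff₀ hc, mul_comm]
    exact (hb _ _ hab).trans h2
  calc ‖x‖ = ‖x' + a • u‖ := by rw [sub_add_cancel]
    _ ≤ ‖x'‖ + ‖a‖ * ‖u‖ := by
        refine (norm_add_le _ _).trans ?_
        rw [norm_smul]
    _ ≤ (1 + ‖v₀‖ / ‖q‖) * N / c + N / ‖q‖ * ‖u‖ := by gcongr
    _ ≤ C * N := by
        rw [hC]
        have : C * N = (1 + ‖v₀‖ / ‖q‖) * N / c + N / ‖q‖ * ‖u‖ + N := by rw [hC]; ring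
        rw [← hC, this]
        linarith

theorem exists_eigenvector_of_mem_spec (h : IsClosedDeficient T φp φm) (hr : IsRegular T)
    (hB : IsExtension T φp φm θ B) {s : ℝ} (hs : (s : ℂ) ∈ spec B) :
    ∃ k, ‖k‖ = 1 ∧ (k, (s : ℂ) • k) ∈ B.graph := by
  have : ∃ k, (k, (s : ℂ) • k) ∈ B.graph ∧ k ≠ 0 := by
    by_contra hcon
    push Not at hcon
    exact h.not_mem_spec_of_no_eigenvector hr hB hcon hs
  obtain ⟨k, hk, hk0⟩ := this
  exact exists_eigenvector (h.finrank_ker_eigenvalue hr hB hk0 hk)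

theorem finrank_ker_of_mem_spec (h : IsClosedDeficient T φp φm) (hr : IsRegular T)
    (hB : IsExtension T φp φm θ B) {s : ℝ} (hs : (s : ℂ) ∈ spec B) :
    Module.finrank ℂ (LinearMap.ker (shift B (s : ℂ))) = 1 := by
  obtain ⟨k, hk1, hk⟩ := h.exists_eigenvector_of_mem_spec hr hB hs
  exact h.finrank_ker_eigenvalue hr hB (by rw [← norm_pos_iff, hk1]; exact one_pos) hk

theorem gap_spec (h : IsClosedDeficient T φp φm) (hr : IsRegular T)
    (hB : IsExtension T φp φm θ B) (s : ℝ) :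
    ∃ δ > 0, ∀ r ∈ {r : ℝ | (r : ℂ) ∈ spec B}, r ≠ s → δ ≤ |r - s| := by
  by_cases hs : (s : ℂ) ∈ spec B
  · obtain ⟨k, hk1, hk⟩ := h.exists_eigenvector_of_mem_spec hr hB hs
    obtain ⟨δ, hδ, hd⟩ := h.not_mem_spec_near_eigenvalue hr hB hk1 hk
    exact ⟨δ, hδ, fun r hr hrs => not_lt.1 fun hlt => hd r hrs hlt hr⟩
  · obtain ⟨δ, hδ, hd⟩ := not_mem_spec_near (h.isSelfAdjoint_ext hB) hs
    exact ⟨δ, hδ, fun r hr _ => not_lt.1 fun hlt => hd r hlt hr⟩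

theorem spec_nonempty (h : IsClosedDeficient T φp φm) (hr : IsRegular T)
    (hB : IsExtension T φp φm θ B) : ∃ s : ℝ, (s : ℂ) ∈ spec B := by
  by_contra hcon
  push Not at hcon
  refine h.pair.ne_zero (eq_zero_of_orthogonal_eigenvectors (h.isSelfAdjoint_ext hB)
    (h.gap_spec hr hB) fun s v hv => ?_)
  by_cases hv0 : v = 0
  · rw [hv0, inner_zero_left]
  · exact absurd (mem_spec_of_eigenvector hv0 hv) (hcon s)

end IsClosedDeficient

end

section

/-! ### Herglotz functions with discrete spectrum -/

section Herglotz
variable {ι : Type*} {a t : ι → ℝ}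

/-- `∑ a_n (1 + t_n s) / (t_n - s)`. -/
def herglotz (a t : ι → ℝ) (s : ℝ) : ℝ := ∑' n, a n * ((1 + t n * s) / (t n - s))

/-- Isolates the pole, so that at distance δ from it the kernel is bounded independently of x and
summability of the weights suffices. -/
theorem herglotz_kernel_eq {x s : ℝ} (h : x ≠ s) :
    (1 + x * s) / (x - s) = s + (1 + s ^ 2) / (x - s) := by
  have := sub_ne_zero.2 h
  field_simp
  ring

theorem abs_herglotz_kernel_le {x s δ : ℝ} (hδ : 0 < δ) (h : δ ≤ |x - s|) :
    |(1 + x * s) / (x - s)| ≤ |s| + (1 + s ^ 2) / δ := by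
  have hne : x ≠ s := by
    rintro rfl
    rw [sub_self, abs_zero] at h
    linarith
  rw [herglotz_kernel_eq hne]
  refine (abs_add_le _ _).trans ?_
  rw [abs_div, abs_of_pos (by positivity : 0 < 1 + s ^ 2)]
  gcongr

theorem herglotz_kernel_sub {x r s : ℝ} (hr : x ≠ r) (hs : x ≠ s) :
    (1 + x * s) / (x - s) - (1 + x * r) / (x - r) = (1 + x ^ 2) * (s - r) / ((x - s) * (x - r)) := by
  have h1 := sub_ne_zero.2 hr
  have h2 := sub_ne_zero.2 hs
  field_simp
  ring

/-- The alternative a_n = 0 allows one weight to be deleted, as needed when a pole is split off. -/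
theorem summable_herglotz (ha : ∀ n, 0 ≤ a n) (hsum : Summable a) {s δ : ℝ} (hδ : 0 < δ)
    (h : ∀ n, a n = 0 ∨ δ ≤ |t n - s|) :
    Summable fun n => a n * ((1 + t n * s) / (t n - s)) := by
  refine Summable.of_norm_bounded (hsum.mul_right (|s| + (1 + s ^ 2) / δ)) fun n => ?_
  rw [Real.norm_eq_abs, abs_mul, abs_of_nonneg (ha n)]
  rcases h n with h0 | h0
  · simp [h0]
  · exact mul_le_mul_of_nonneg_left (abs_herglotz_kernel_le hδ h0) (ha n)

theorem continuousAt_herglotz (ha : ∀ n, 0 ≤ a n) (hsum : Summable a) {s δ : ℝ} (hδ : 0 < δ)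
    (h : ∀ n, a n = 0 ∨ δ ≤ |t n - s|) : ContinuousAt (herglotz a t) s := by
  have hcont : ContinuousOn (herglotz a t) (Metric.ball s (δ / 2)) := by
    -- Majorant on the ball of radius δ/2, where |r| ≤ |s| + δ and the distance to the poles is at
    -- least δ/2.
    refine continuousOn_tsum (u := fun n => a n * ((|s| + δ) + (1 + (|s| + δ) ^ 2) / (δ / 2)))
      (fun n => ?_) (hsum.mul_right _) fun n r hr => ?_
    · rcases h n with h0 | h0
      · simp only [h0, zero_mul]
        exact continuousOn_const
      · refine ContinuousOn.mul continuousOn_const (ContinuousOn.div (by fun_prop) (by fun_prop) ?_)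
        intro r hr h1
        rw [sub_eq_zero] at h1
        rw [Metric.mem_ball, Real.dist_eq, ← h1] at hr
        linarith
    · rw [Real.norm_eq_abs, abs_mul, abs_of_nonneg (ha n)]
      rcases h n with h0 | h0
      · simp [h0]
      · refine mul_le_mul_of_nonneg_left ?_ (ha n)
        rw [Metric.mem_ball, Real.dist_eq] at hr
        have h1 : δ / 2 ≤ |t n - r| := by
          have := abs_sub_le (t n) r s
          linarith
        have h2 : |r| ≤ |s| + δ := by
          have := abs_sub_abs_le_abs_sub r s
          linarith
        refine (abs_herglotz_kernel_le (by positivity) h1).trans ?_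
        rw [← sq_abs r]
        gcongr
  exact hcont.continuousAt (Metric.ball_mem_nhds s (by positivity))

theorem herglotz_lt (ha : ∀ n, 0 < a n) [Nonempty ι] (hsum : Summable a) {r s δ : ℝ} (hδ : 0 < δ)
    (hr : ∀ n, δ ≤ |t n - r|) (hs : ∀ n, δ ≤ |t n - s|) (hrs : r < s)
    (h : ∀ n, t n < r ∨ s < t n) : herglotz a t r < herglotz a t s := by
  have key : ∀ n, a n * ((1 + t n * r) / (t n - r)) < a n * ((1 + t n * s) / (t n - s)) := by
    intro n
    refine mul_lt_mul_of_pos_left ?_ (ha n)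
    have h1 : t n ≠ r := by rcases h n with h | h <;> intro h0 <;> linarith
    have h2 : t n ≠ s := by rcases h n with h | h <;> intro h0 <;> linarith
    rw [← sub_pos, herglotz_kernel_sub h1 h2]
    have : 0 < (t n - s) * (t n - r) := by
      rcases h n with h | h
      · exact mul_pos_of_neg_of_neg (by linarith) (by linarith)
      · exact mul_pos (by linarith) (by linarith)
    have hrs' : 0 < s - r := by linarith
    positivity
  have ha' := fun n => (ha n).le
  exact Summable.tsum_lt_tsum (fun n => (key n).le) (key (Classical.arbitrary ι))
    (summable_herglotz ha' hsum hδ fun n => Or.inr (hr n))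
    (summable_herglotz ha' hsum hδ fun n => Or.inr (hs n))

/-- After splitting off the m-th term, the product is a_m(1 + t_m s) plus (t_m - s) times a function
continuous at t_m. -/
theorem tendsto_mul_herglotz (ha : ∀ n, 0 ≤ a n) (hsum : Summable a)
    (hgap : ∀ s, ∃ δ > 0, ∀ n, t n ≠ s → δ ≤ |t n - s|) (ht : Function.Injective t) (m : ι) :
    Filter.Tendsto (fun s => (t m - s) * herglotz a t s) (nhdsWithin (t m) {t m}ᶜ)
      (nhds (a m * (1 + t m ^ 2))) := by
  classical
  obtain ⟨δ, hδ, hd⟩ := hgap (t m)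
  let a' : ι → ℝ := fun n => if n = m then 0 else a n
  have ha' : ∀ n, 0 ≤ a' n := fun n => by
    by_cases hn : n = m
    · simp [a', hn]
    · simp [a', hn, ha n]
  have hle : ∀ n, a' n ≤ a n := fun n => by
    by_cases hn : n = m
    · simp [a', hn, ha m]
    · simp [a', hn]
  have hsum' : Summable a' := Summable.of_nonneg_of_le ha' hle hsum
  have hcont : ContinuousAt (herglotz a' t) (t m) := continuousAt_herglotz ha' hsum' hδ fun n => by
    by_cases hn : n = m
    · exact Or.inl (if_pos hn)
    · exact Or.inr (hd n (ht.ne hn))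
  have hlim : Filter.Tendsto (fun s => a m * (1 + t m * s) + (t m - s) * herglotz a' t s)
      (nhdsWithin (t m) {t m}ᶜ) (nhds (a m * (1 + t m ^ 2))) := by
    have h1 : ContinuousAt (fun s => a m * (1 + t m * s) + (t m - s) * herglotz a' t s) (t m) := by
      fun_prop
    have h2 := h1.tendsto.mono_left (nhdsWithin_le_nhds (s := {t m}ᶜ))
    convert h2 using 2
    ring
  refine hlim.congr' ?_
  have hball : ∀ᶠ s in nhdsWithin (t m) {t m}ᶜ, |s - t m| < δ / 2 := by
    refine mem_nhdsWithin_of_mem_nhds ?_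
    have := Metric.ball_mem_nhds (t m) (half_pos hδ)
    filter_upwards [this] with s hs
    rwa [Metric.mem_ball, Real.dist_eq] at hs
  filter_upwards [hball, self_mem_nhdsWithin] with s hs hsne
  have hsne' : t m - s ≠ 0 := sub_ne_zero.2 fun h0 => hsne h0.symm
  have hδ' : 0 < min (δ / 2) |t m - s| := lt_min (half_pos hδ) (abs_pos.2 hsne')
  have hsumm := summable_herglotz ha hsum (s := s) hδ' (t := t) fun n => by
    right
    by_cases hn : n = m
    · rw [hn]; exact min_le_right _ _
    · refine (min_le_left _ _).trans ?_
      have h1 := hd n (ht.ne hn)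
      have h2 := abs_sub_le (t n) s (t m)
      linarith
  have hsplit : herglotz a t s = a m * ((1 + t m * s) / (t m - s)) + herglotz a' t s := by
    rw [herglotz, hsumm.tsum_eq_add_tsum_ite m]
    congr 1
    refine tsum_congr fun n => ?_
    by_cases hn : n = m <;> simp [a', hn]
  rw [hsplit, mul_add]
  field_simp

theorem tendsto_herglotz_right (ha : ∀ n, 0 < a n) (hsum : Summable a)
    (hgap : ∀ s, ∃ δ > 0, ∀ n, t n ≠ s → δ ≤ |t n - s|) (ht : Function.Injective t) (m : ι) :
    Filter.Tendsto (herglotz a t) (nhdsWithin (t m) (Set.Ioi (t m))) Filter.atBot := by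
  have h1 := (tendsto_mul_herglotz (fun n => (ha n).le) hsum hgap ht m).mono_left
    (nhdsWithin_mono _ fun s (hs : t m < s) => hs.ne')
  have h2 : Filter.Tendsto (fun s => (t m - s)⁻¹) (nhdsWithin (t m) (Set.Ioi (t m)))
      Filter.atBot := by
    refine tendsto_inv_nhdsLT_zero.comp (tendsto_nhdsWithin_iff.2 ⟨?_, ?_⟩)
    · have : ContinuousAt (fun s => t m - s) (t m) := by fun_prop
      simpa using this.tendsto.mono_left (nhdsWithin_le_nhds (s := Set.Ioi (t m)))
    · filter_upwards [self_mem_nhdsWithin] with s hs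
      exact sub_neg.2 (Set.mem_Ioi.1 hs)
  refine (h1.pos_mul_atBot (mul_pos (ha m) (by positivity)) h2).congr' ?_
  filter_upwards [self_mem_nhdsWithin] with s hs
  have : t m - s ≠ 0 := (sub_neg.2 (Set.mem_Ioi.1 hs)).ne
  field_simp

theorem tendsto_herglotz_left (ha : ∀ n, 0 < a n) (hsum : Summable a)
    (hgap : ∀ s, ∃ δ > 0, ∀ n, t n ≠ s → δ ≤ |t n - s|) (ht : Function.Injective t) (m : ι) :
    Filter.Tendsto (herglotz a t) (nhdsWithin (t m) (Set.Iio (t m))) Filter.atTop := by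
  have h1 := (tendsto_mul_herglotz (fun n => (ha n).le) hsum hgap ht m).mono_left
    (nhdsWithin_mono _ fun s (hs : s < t m) => hs.ne)
  have h2 : Filter.Tendsto (fun s => (t m - s)⁻¹) (nhdsWithin (t m) (Set.Iio (t m)))
      Filter.atTop := by
    refine tendsto_inv_nhdsGT_zero.comp (tendsto_nhdsWithin_iff.2 ⟨?_, ?_⟩)
    · have : ContinuousAt (fun s => t m - s) (t m) := by fun_prop
      simpa using this.tendsto.mono_left (nhdsWithin_le_nhds (s := Set.Iio (t m)))
    · filter_upwards [self_mem_nhdsWithin] with s hs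
      exact sub_pos.2 (Set.mem_Iio.1 hs)
  refine (h1.pos_mul_atTop (mul_pos (ha m) (by positivity)) h2).congr' ?_
  filter_upwards [self_mem_nhdsWithin] with s hs
  have : t m - s ≠ 0 := (sub_pos.2 (Set.mem_Iio.1 hs)).ne'
  field_simp

end Herglotz

theorem hasSum_of_eq {ι : Type*} {f g : ι → ℂ} {x y : ℂ} (h : HasSum f x) (hfg : ∀ n, g n = f n)
    (hxy : y = x) : HasSum g y := by
  rw [funext hfg, hxy]
  exact h

/-! ### The characteristic equation of the self-adjoint extensions -/

theorem exp_θ_ne_one {θ : ℝ} (hθ : θ ∈ Set.Ioo (0 : ℝ) 1) : exp (2 * Real.pi * I * θ) ≠ 1 := by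
  intro h
  obtain ⟨n, hn⟩ := Complex.exp_eq_one_iff.1 h
  have h2 : (2 * Real.pi * I : ℂ) ≠ 0 := Complex.two_pi_I_ne_zero
  rw [mul_comm (n : ℂ)] at hn
  have h3 : (θ : ℂ) = n := mul_left_cancel₀ h2 hn
  have h4 : θ = n := by exact_mod_cast h3
  rw [h4] at hθ
  have h5 : (0 : ℤ) < n := by exact_mod_cast hθ.1
  have h6 : n < (1 : ℤ) := by exact_mod_cast hθ.2
  omega

theorem exp_θ_injOn {θ η : ℝ} (hθ : θ ∈ Set.Ioo (0 : ℝ) 1) (hη : η ∈ Set.Ioo (0 : ℝ) 1)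
    (h : exp (2 * Real.pi * I * θ) = exp (2 * Real.pi * I * η)) : θ = η := by
  obtain ⟨n, hn⟩ := Complex.exp_eq_exp_iff_exists_int.1 h
  have h2 : (2 * Real.pi * I : ℂ) ≠ 0 := Complex.two_pi_I_ne_zero
  rw [mul_comm (n : ℂ), ← mul_add] at hn
  have h3 : (θ : ℂ) = η + n := mul_left_cancel₀ h2 hn
  have h4 : θ = η + n := by exact_mod_cast h3
  have h5 : (-1 : ℤ) < n := by
    have : (-1 : ℝ) < n := by linarith [hθ.1, hη.2]
    exact_mod_cast this
  have h6 : n < (1 : ℤ) := by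
    have : (n : ℝ) < 1 := by linarith [hθ.2, hη.1]
    exact_mod_cast this
  have : n = 0 := by omega
  rw [h4, this]; simp

theorem sin_pi_mul_pos {θ : ℝ} (hθ : θ ∈ Set.Ioo (0 : ℝ) 1) : 0 < Real.sin (Real.pi * θ) :=
  Real.sin_pos_of_pos_of_lt_pi (mul_pos Real.pi_pos hθ.1)
    (by nlinarith [Real.pi_pos, hθ.2])

/-- For ζ = e^{2πiθ} this is i(1 + ζ)/(1 - ζ) = -cot πθ: the inverse Cayley transform turns the
parameter of the extension into a real number. -/
theorem I_mul_one_add_exp {θ : ℝ} (hθ : θ ∈ Set.Ioo (0 : ℝ) 1) :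
    I * (1 + exp (2 * Real.pi * I * θ)) =
      -((Real.cos (Real.pi * θ) / Real.sin (Real.pi * θ) : ℝ) : ℂ) *
        (1 - exp (2 * Real.pi * I * θ)) := by
  have hs : (Real.sin (Real.pi * θ) : ℂ) ≠ 0 := by exact_mod_cast (sin_pi_mul_pos hθ).ne'
  have he : exp (2 * Real.pi * I * θ) =
      ((Real.cos (Real.pi * θ) : ℂ) + (Real.sin (Real.pi * θ) : ℂ) * I) ^ 2 := by
    rw [ofReal_cos, ofReal_sin, ← Complex.exp_mul_I, ← Complex.exp_nat_mul]
    congr 1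
    push_cast
    ring
  have h1 : (Real.cos (Real.pi * θ) : ℂ) ^ 2 + (Real.sin (Real.pi * θ) : ℂ) ^ 2 = 1 := by
    exact_mod_cast Real.cos_sq_add_sin_sq (Real.pi * θ)
  rw [he]
  push_cast [-ofReal_cos, -ofReal_sin]
  field_simp
  set c := (Real.cos (Real.pi * θ) : ℂ)
  set d := (Real.sin (Real.pi * θ) : ℂ)
  linear_combination (-(c + I * d)) * h1 + (c * d ^ 2 + I * d ^ 3) * I_sq

variable {H : Type*} [NormedAddCommGroup H] [InnerProductSpace ℂ H] [CompleteSpace H]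

namespace IsClosedDeficient
variable {T A B : H →ₗ.[ℂ] H} {φp φm : H} {ι : Type*} {t : ι → ℝ} {e : HilbertBasis ι ℂ H}

theorem coord_unitaryExt_zero (h : IsClosedDeficient T φp φm) (hA : IsExtension T φp φm 0 A)
    (he : ∀ n, (e n, (t n : ℂ) • e n) ∈ A.graph) (w : H) (n : ι) :
    ((t n : ℂ) + I) * inner ℂ (e n) (unitaryExt T φp φm 0 w) =
      ((t n : ℂ) - I) * inner ℂ (e n) w := by
  have hAs := h.isSelfAdjoint_ext hA
  obtain ⟨x, y, hxy, rfl⟩ := exists_add_I hAs w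
  rw [(mem_ext_graph hA).1 hxy, inner_sub_right, inner_add_right, inner_smul_right,
    (mem_graph_iff_coord hAs he).1 hxy n]
  ring

theorem coord_unitaryExt (h : IsClosedDeficient T φp φm) (hA : IsExtension T φp φm 0 A)
    (he : ∀ n, (e n, (t n : ℂ) • e n) ∈ A.graph) (θ : ℝ) (w : H) (n : ι) :
    ((t n : ℂ) + I) * inner ℂ (e n) (unitaryExt T φp φm θ w) =
      ((t n : ℂ) - I) * (inner ℂ (e n) w + (exp (2 * Real.pi * I * θ) - 1) *
        (inner ℂ φp w / (‖φp‖ : ℂ) ^ 2) * inner ℂ (e n) φp) := by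
  have h1 := h.coord_unitaryExt_zero hA he w n
  have h2 := h.coord_unitaryExt_zero hA he φp n
  have h3 : unitaryExt T φp φm 0 φp = φm := by rw [h.unitaryExt_φp]; simp
  rw [h3] at h2
  rw [unitaryExt_eq, inner_add_right, inner_smul_right, mul_add, h1, mul_left_comm, h2]
  ring

/-- The equation U_θ(s + i)x = (s - i)x in coordinates. Because the perturbation has rank one, every
coordinate with t_n ≠ s is determined by the single number ⟪φ₊, x⟫. -/
theorem mem_ext_graph_iff_coord (h : IsClosedDeficient T φp φm) (hA : IsExtension T φp φm 0 A)
    (he : ∀ n, (e n, (t n : ℂ) • e n) ∈ A.graph) {θ : ℝ} (hB : IsExtension T φp φm θ B) (s : ℝ)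
    (x : H) : (x, (s : ℂ) • x) ∈ B.graph ↔ ∀ n, 2 * I * ((t n : ℂ) - s) * inner ℂ (e n) x =
      (1 - exp (2 * Real.pi * I * θ)) * (inner ℂ φp x / (‖φp‖ : ℂ) ^ 2) *
        (((s : ℂ) + I) * ((t n : ℂ) - I)) * inner ℂ (e n) φp := by
  rw [mem_ext_graph hB, ← add_smul, ← sub_smul, map_smul]
  have key : ∀ n, ((t n : ℂ) + I) * (inner ℂ (e n) (((s : ℂ) + I) • unitaryExt T φp φm θ x) -
      inner ℂ (e n) (((s : ℂ) - I) • x)) = 2 * I * ((t n : ℂ) - s) * inner ℂ (e n) x -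
      (1 - exp (2 * Real.pi * I * θ)) * (inner ℂ φp x / (‖φp‖ : ℂ) ^ 2) *
        (((s : ℂ) + I) * ((t n : ℂ) - I)) * inner ℂ (e n) φp := by
    intro n
    rw [inner_smul_right, inner_smul_right, mul_sub, mul_left_comm, h.coord_unitaryExt hA he]
    ring
  constructor
  · intro hx n
    have := key n
    rw [hx, sub_self, mul_zero] at this
    exact sub_eq_zero.1 this.symm
  · intro hx
    refine eq_of_coord e fun n => ?_
    have := key n
    rw [hx n, sub_self] at this
    exact sub_eq_zero.1 ((mul_eq_zero.1 this).resolve_left (ofReal_add_I_ne_zero _))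

omit [CompleteSpace H] in
theorem hasSum_coeff (e : HilbertBasis ι ℂ H) (φp : H) {b : ι → ℝ} {g : ℝ}
    (hb : HasSum (fun n => ‖inner ℂ (e n) φp‖ ^ 2 * b n) g) (p q : ℂ) :
    HasSum (fun n => (starRingEnd ℂ) (inner ℂ (e n) φp) *
      ((p * b n + q) * inner ℂ (e n) φp)) (p * g + q * (‖φp‖ : ℂ) ^ 2) := by
  have h1 : HasSum (fun n => ((‖inner ℂ (e n) φp‖ ^ 2 * b n : ℝ) : ℂ)) (g : ℂ) :=
    hasSum_ofReal.2 hb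
  have h2 : HasSum (fun n => ((‖inner ℂ (e n) φp‖ ^ 2 : ℝ) : ℂ)) ((‖φp‖ ^ 2 : ℝ) : ℂ) :=
    hasSum_ofReal.2 (hasSum_coord_norm_sq e φp)
  have h3 := (h1.mul_left p).add (h2.mul_left q)
  push_cast at h3
  refine hasSum_of_eq h3 (fun n => ?_) rfl
  rw [← Complex.conj_mul']
  ring

/-- Solve the coordinate equations for x in terms of ⟪φ₊, x⟫, then pair with φ₊. The consistency
condition is (1 - ζ)(G/(2i) + ‖φ₊‖²/2) = ‖φ₊‖², which is the cotangent equation. -/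
theorem hasEigenvector_iff (h : IsClosedDeficient T φp φm) (hA : IsExtension T φp φm 0 A)
    (he : ∀ n, (e n, (t n : ℂ) • e n) ∈ A.graph) (ht : Function.Injective t)
    (hgap : ∀ s, ∃ δ > 0, ∀ n, t n ≠ s → δ ≤ |t n - s|) (hc : ∀ n, inner ℂ (e n) φp ≠ 0)
    {θ : ℝ} (hθ : θ ∈ Set.Ioo (0 : ℝ) 1) (hB : IsExtension T φp φm θ B) (s : ℝ) :
    (∃ x, x ≠ 0 ∧ (x, (s : ℂ) • x) ∈ B.graph) ↔ (∀ n, t n ≠ s) ∧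
      herglotz (fun n => ‖inner ℂ (e n) φp‖ ^ 2) t s =
        -(Real.cos (Real.pi * θ) / Real.sin (Real.pi * θ)) * ‖φp‖ ^ 2 := by
  have hn : (‖φp‖ : ℂ) ^ 2 ≠ 0 := by
    have := h.norm_pos.ne'
    exact_mod_cast pow_ne_zero 2 this
  have hζ : 1 - exp (2 * Real.pi * I * θ) ≠ 0 := sub_ne_zero.2 (exp_θ_ne_one hθ).symm
  have hcot := I_mul_one_add_exp hθ
  set ζ := exp (2 * Real.pi * I * θ) with hζdef
  set a : ι → ℝ := fun n => ‖inner ℂ (e n) φp‖ ^ 2 with ha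
  have hAs := h.isSelfAdjoint_ext hA
  have hsum : (∀ n, t n ≠ s) → HasSum (fun n => a n * ((1 + t n * s) / (t n - s)))
      (herglotz a t s) := by
    intro hts
    obtain ⟨δ, hδ, hd⟩ := hgap s
    exact (summable_herglotz (fun n => by positivity) (summable_coord e φp) hδ
      fun n => Or.inr (hd n (hts n))).hasSum
  -- From (s + i)(t - i) = (1 + ts) + i(t - s).
  have hker : ∀ n, t n ≠ s → ((s : ℂ) + I) * ((t n : ℂ) - I) / (2 * I * ((t n : ℂ) - s)) =
      (2 * I)⁻¹ * (((1 + t n * s) / (t n - s) : ℝ) : ℂ) + 1 / 2 := by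
    intro n hts
    have h1 : (t n : ℂ) - s ≠ 0 := sub_ne_zero.2 (by exact_mod_cast hts)
    push_cast
    field_simp
    ring_nf
    rw [I_sq]
    ring
  have hgiff : ((1 - ζ) * ((2 * I)⁻¹ * (herglotz a t s : ℂ) + 1 / 2 * (‖φp‖ : ℂ) ^ 2)
      = (‖φp‖ : ℂ) ^ 2) ↔ herglotz a t s =
        -(Real.cos (Real.pi * θ) / Real.sin (Real.pi * θ)) * ‖φp‖ ^ 2 := by
    have e1 : (herglotz a t s = -(Real.cos (Real.pi * θ) / Real.sin (Real.pi * θ)) * ‖φp‖ ^ 2) ↔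
        (1 - ζ) * (herglotz a t s : ℂ) = I * (1 + ζ) * (‖φp‖ : ℂ) ^ 2 := by
      rw [hcot]
      constructor
      · intro hg
        rw [hg]
        push_cast
        ring
      · intro hg
        have : (herglotz a t s : ℂ) =
            ((-(Real.cos (Real.pi * θ) / Real.sin (Real.pi * θ)) * ‖φp‖ ^ 2 : ℝ) : ℂ) := by
          refine mul_left_cancel₀ hζ (hg.trans ?_)
          push_cast
          ring
        exact_mod_cast this
    rw [e1]
    have hI : (2 * I)⁻¹ = -I / 2 := by
      rw [mul_inv, Complex.inv_I]; ring
    rw [hI]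
    constructor
    · intro hg
      linear_combination (2 * I) * hg + ((1 - ζ) * (herglotz a t s : ℂ)) * I_sq
    · intro hg
      linear_combination (-I / 2) * hg - (1 / 2 * (1 + ζ) * (‖φp‖ : ℂ) ^ 2) * I_sq
  constructor
  · rintro ⟨x, hx0, hx⟩
    rw [h.mem_ext_graph_iff_coord hA he hB] at hx
    -- If ⟪φ₊, x⟫ = 0, then x is supported on the eigenvector e_m with t_m = s, if any; since ⟪φ₊,
    -- e_m⟫ ≠ 0, x = 0.
    have hκ : inner ℂ φp x / (‖φp‖ : ℂ) ^ 2 ≠ 0 := by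
      intro hκ
      rw [hκ] at hx
      have hx' : ∀ n, t n ≠ s → inner ℂ (e n) x = 0 := by
        intro n hts
        have h1 : (t n : ℂ) - s ≠ 0 := sub_ne_zero.2 (by exact_mod_cast hts)
        have := hx n
        rw [mul_zero, zero_mul, zero_mul] at this
        exact (mul_eq_zero.1 this).resolve_left (mul_ne_zero (by simp) h1)
      by_cases hm : ∃ m, t m = s
      · obtain ⟨m, hm⟩ := hm
        have hxe : x = inner ℂ (e m) x • e m := eq_of_coord e fun n => by
          rw [inner_smul_right]
          by_cases hnm : n = m
          · rw [hnm, coord_self, mul_one]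
          · rw [coord_eq_zero_or e hnm, mul_zero]
            exact hx' n fun h0 => hnm (ht (h0.trans hm.symm))
        have h0 : inner ℂ φp x = 0 := (div_eq_zero_iff.1 hκ).resolve_right hn
        rw [hxe, inner_smul_right, ← inner_conj_symm φp] at h0
        have h1 := (mul_eq_zero.1 h0).resolve_right ((map_ne_zero _).2 (hc m))
        rw [h1, zero_smul] at hxe
        exact hx0 hxe
      · exact hx0 (eq_of_coord e fun n => by
          rw [inner_zero_right]; exact hx' n fun h0 => hm ⟨n, h0⟩)
    have hts : ∀ n, t n ≠ s := by
      intro n hns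
      have := hx n
      rw [hns, sub_self, mul_zero, zero_mul, eq_comm] at this
      have h1 := mul_ne_zero (mul_ne_zero (mul_ne_zero hζ hκ)
        (mul_ne_zero (ofReal_add_I_ne_zero s) (ofReal_sub_I_ne_zero s))) (hc n)
      exact h1 this
    refine ⟨hts, hgiff.1 ?_⟩
    set κ := inner ℂ φp x / (‖φp‖ : ℂ) ^ 2 with hκdef
    have hxn : ∀ n, inner ℂ (e n) x = (1 - ζ) * κ *
        (((2 * I)⁻¹ * (((1 + t n * s) / (t n - s) : ℝ) : ℂ) + 1 / 2) * inner ℂ (e n) φp) := by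
      intro n
      have h1 : (t n : ℂ) - s ≠ 0 := sub_ne_zero.2 (by exact_mod_cast hts n)
      have h2 : 2 * I * ((t n : ℂ) - s) ≠ 0 := mul_ne_zero (by simp) h1
      rw [← hker n (hts n)]
      refine mul_left_cancel₀ h2 ((hx n).trans ?_)
      rw [← hζdef]
      field_simp
    have h1 := hasSum_coord_inner e φp x
    have h2 := (hasSum_coeff e φp (hsum hts) (2 * I)⁻¹ (1 / 2)).mul_left ((1 - ζ) * κ)
    have h3 : inner ℂ φp x = _ := h1.unique (hasSum_of_eq h2 (fun n => by
      rw [hxn n]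
      ring) rfl)
    have h4 : inner ℂ φp x = κ * (‖φp‖ : ℂ) ^ 2 := by rw [hκdef, div_mul_cancel₀ _ hn]
    rw [h4] at h3
    refine mul_left_cancel₀ hκ (Eq.trans ?_ h3.symm)
    ring
  · rintro ⟨hts, hg⟩
    obtain ⟨δ, hδ, hd⟩ := hgap s
    obtain ⟨x, hx⟩ := exists_of_coord_mul e
      (c := fun n => (2 * I)⁻¹ * (((1 + t n * s) / (t n - s) : ℝ) : ℂ) + 1 / 2)
      (C := ‖(2 * I)⁻¹‖ * (|s| + (1 + s ^ 2) / δ) + ‖(1 / 2 : ℂ)‖) (fun n => by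
        refine (norm_add_le _ _).trans ?_
        rw [norm_mul, norm_real, Real.norm_eq_abs]
        gcongr
        exact abs_herglotz_kernel_le hδ (hd n (hts n))) φp
    have h1 : inner ℂ φp x = (2 * I)⁻¹ * (herglotz a t s : ℂ) + 1 / 2 * (‖φp‖ : ℂ) ^ 2 := by
      refine (hasSum_coord_inner e φp x).unique ?_
      convert hasSum_coeff e φp (hsum hts) (2 * I)⁻¹ (1 / 2) using 2 with n
      rw [hx n]
    have h2 : (1 - ζ) * inner ℂ φp x = (‖φp‖ : ℂ) ^ 2 := by rw [h1]; exact hgiff.2 hg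
    refine ⟨x, ?_, (h.mem_ext_graph_iff_coord hA he hB s x).2 fun n => ?_⟩
    · rintro rfl
      rw [inner_zero_right, mul_zero] at h2
      exact hn h2.symm
    · rw [← mul_div_assoc, h2, div_self hn, one_mul, hx n, ← hker n (hts n)]
      have h1 : (t n : ℂ) - s ≠ 0 := sub_ne_zero.2 (by exact_mod_cast hts n)
      field_simp

/-- At most one of the extensions `T_θ`, `0 < θ < 1`, is undefined. -/
theorem extension_undefined_unique (h : IsClosedDeficient T φp φm) (hA : IsExtension T φp φm 0 A)
    (he : ∀ n, (e n, (t n : ℂ) • e n) ∈ A.graph) {θ η : ℝ} (hθ : θ ∈ Set.Ioo (0 : ℝ) 1)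
    (hη : η ∈ Set.Ioo (0 : ℝ) 1) (hθu : ¬ ∃ B, IsExtension T φp φm θ B)
    (hηu : ¬ ∃ B, IsExtension T φp φm η B) : θ = η := by
  have hn : (‖φp‖ : ℂ) ^ 2 ≠ 0 := by
    have := h.norm_pos.ne'
    exact_mod_cast pow_ne_zero 2 this
  -- A fixed vector of U_θ has coordinates proportional to (t_n - i)⟪e_n, φ₊⟫. Pairing with φ₊ gives
  -- a sum that does not involve θ but whose value determines e^{2πiθ}.
  have key : ∀ θ ∈ Set.Ioo (0 : ℝ) 1, (¬ ∃ B, IsExtension T φp φm θ B) →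
      HasSum (fun n => (starRingEnd ℂ) (inner ℂ (e n) φp) * (((t n : ℂ) - I) * inner ℂ (e n) φp))
        (-(2 * I) * (‖φp‖ : ℂ) ^ 2 / (1 - exp (2 * Real.pi * I * θ))) := by
    intro θ hθ hu
    have hζ : 1 - exp (2 * Real.pi * I * θ) ≠ 0 := sub_ne_zero.2 (exp_θ_ne_one hθ).symm
    obtain ⟨w, hw, hw0⟩ : ∃ w, unitaryExt T φp φm θ w = w ∧ w ≠ 0 := by
      by_contra hcon
      push Not at hcon
      exact hu (exists_extension hcon)
    have hco : ∀ n, -(2 * I) * inner ℂ (e n) w = (1 - exp (2 * Real.pi * I * θ)) *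
        (inner ℂ φp w / (‖φp‖ : ℂ) ^ 2) * (((t n : ℂ) - I) * inner ℂ (e n) φp) := by
      intro n
      have := h.coord_unitaryExt hA he θ w n
      rw [hw] at this
      linear_combination -this
    have hI : -(2 * I) ≠ 0 := by simp
    have hκ : inner ℂ φp w ≠ 0 := by
      intro h0
      refine hw0 (eq_of_coord e fun n => ?_)
      have := hco n
      rw [h0, zero_div, mul_zero, zero_mul] at this
      rw [inner_zero_right]
      exact (mul_eq_zero.1 this).resolve_left hI
    have h1 := (hasSum_coord_inner e φp w).mul_left
      (-(2 * I) * (‖φp‖ : ℂ) ^ 2 / ((1 - exp (2 * Real.pi * I * θ)) * inner ℂ φp w))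
    have hn' : (‖φp‖ : ℂ) ≠ 0 := fun h0 => hn (by rw [h0, zero_pow two_ne_zero])
    generalize exp (2 * Real.pi * I * θ) = ζ at hζ hco h1 ⊢
    refine hasSum_of_eq h1 (fun n => ?_) ?_
    · have e1 : inner ℂ (e n) w = (-(2 * I))⁻¹ * ((1 - ζ) *
        (inner ℂ φp w / (‖φp‖ : ℂ) ^ 2) * (((t n : ℂ) - I) * inner ℂ (e n) φp)) := by
        rw [← hco n, inv_mul_cancel_left₀ hI]
      rw [e1]
      field_simp
    · field_simp
  have h1 := (key θ hθ hθu).unique (key η hη hηu)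
  have hζθ : 1 - exp (2 * Real.pi * I * θ) ≠ 0 := sub_ne_zero.2 (exp_θ_ne_one hθ).symm
  have hζη : 1 - exp (2 * Real.pi * I * η) ≠ 0 := sub_ne_zero.2 (exp_θ_ne_one hη).symm
  have hne : -(2 * I) * (‖φp‖ : ℂ) ^ 2 ≠ 0 := mul_ne_zero (by simp) hn
  rw [div_eq_div_iff hζθ hζη] at h1
  have h2 := mul_left_cancel₀ hne h1
  exact exp_θ_injOn hθ hη (sub_right_injective h2).symm

end IsClosedDeficient

end

section

/-! ### Counting functions of locally finite sets -/

/-- The number of points of `S` in `(0, s]`, or minus the number of those in `(s, 0]`. -/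
def signedCount (S : Set ℝ) (s : ℝ) : ℤ :=
  ((S ∩ Set.Ioc 0 s).ncard : ℤ) - ((S ∩ Set.Ioc s 0).ncard : ℤ)

section Count
variable {S : Set ℝ}

theorem finite_inter_Ioc (hS : ∀ s, ∃ δ > 0, ∀ r ∈ S, r ≠ s → δ ≤ |r - s|) (a b : ℝ) :
    (S ∩ Set.Ioc a b).Finite :=
  (finite_inter_Icc_of_gap hS a b).subset
    (Set.inter_subset_inter_right _ Set.Ioc_subset_Icc_self)

theorem ncard_inter_Ioc_add (hS : ∀ s, ∃ δ > 0, ∀ r ∈ S, r ≠ s → δ ≤ |r - s|) {a b c : ℝ}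
    (hab : a ≤ b) (hbc : b ≤ c) :
    (S ∩ Set.Ioc a c).ncard = (S ∩ Set.Ioc a b).ncard + (S ∩ Set.Ioc b c).ncard := by
  rw [← Set.ncard_union_eq _ (finite_inter_Ioc hS a b) (finite_inter_Ioc hS b c),
    ← Set.inter_union_distrib_left, Set.Ioc_union_Ioc_eq_Ioc hab hbc]
  rw [Set.disjoint_left]
  rintro x ⟨-, hx⟩ ⟨-, hx'⟩
  exact absurd hx.2 (not_le.2 hx'.1)

theorem signedCount_add (hS : ∀ s, ∃ δ > 0, ∀ r ∈ S, r ≠ s → δ ≤ |r - s|) {r s : ℝ} (hrs : r ≤ s) :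
    signedCount S s = signedCount S r + ((S ∩ Set.Ioc r s).ncard : ℤ) := by
  have hempty : ∀ {a b : ℝ}, b ≤ a → (S ∩ Set.Ioc a b).ncard = 0 := fun h => by
    rw [Set.Ioc_eq_empty (not_lt.2 h), Set.inter_empty, Set.ncard_empty]
  unfold signedCount
  rcases le_total 0 r with h | h
  · have := ncard_inter_Ioc_add hS h hrs
    have := hempty h
    have := hempty (h.trans hrs)
    omega
  · rcases le_total 0 s with h' | h'
    · have := ncard_inter_Ioc_add hS h h'
      have := hempty h
      have := hempty h'
      omega
    · have := ncard_inter_Ioc_add hS hrs h'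
      have := hempty h
      have := hempty h'
      omega

theorem signedCount_eq (hS : ∀ s, ∃ δ > 0, ∀ r ∈ S, r ≠ s → δ ≤ |r - s|) {r s : ℝ} (hrs : r ≤ s)
    (h : ∀ x ∈ Set.Ioc r s, x ∉ S) : signedCount S s = signedCount S r := by
  rw [signedCount_add hS hrs]
  have : S ∩ Set.Ioc r s = ∅ := by
    rw [Set.eq_empty_iff_forall_notMem]
    exact fun x hx => h x hx.2 hx.1
  rw [this, Set.ncard_empty]
  simp

theorem signedCount_lt (hS : ∀ s, ∃ δ > 0, ∀ r ∈ S, r ≠ s → δ ≤ |r - s|) {r s x : ℝ}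
    (hx : x ∈ Set.Ioc r s) (hxS : x ∈ S) : signedCount S r + 1 ≤ signedCount S s := by
  rw [signedCount_add hS (hx.1.le.trans hx.2)]
  have : 0 < (S ∩ Set.Ioc r s).ncard :=
    (Set.ncard_pos (finite_inter_Ioc hS r s)).2 ⟨x, hxS, hx⟩
  omega

theorem signedCount_eq_add_one (hS : ∀ s, ∃ δ > 0, ∀ r ∈ S, r ≠ s → δ ≤ |r - s|) {r s : ℝ}
    (hrs : r < s) (hs : s ∈ S) (h : ∀ x ∈ Set.Ioo r s, x ∉ S) :
    signedCount S s = signedCount S r + 1 := by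
  rw [signedCount_add hS hrs.le]
  have : S ∩ Set.Ioc r s = {s} := by
    ext x
    constructor
    · rintro ⟨hxS, hx⟩
      by_contra hne
      exact h x ⟨hx.1, lt_of_le_of_ne hx.2 hne⟩ hxS
    · rintro rfl
      exact ⟨hs, hrs, le_refl _⟩
  rw [this, Set.ncard_singleton]
  simp

end Count

/-! ### Index sets -/

/-- Shift so that the least element becomes 0, or the greatest if there is no least. -/
theorem exists_shift_isIndexSet {K : Set ℤ} (hne : K.Nonempty) (hK : K.OrdConnected) :
    ∃ k : ℤ, IsIndexSet {n | n - k ∈ K} := by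
  by_cases hb : BddBelow K
  · obtain ⟨m, hm⟩ : ∃ m, IsLeast K m :=
      ⟨sInf K, Int.csInf_mem hne hb, fun x hx => csInf_le hb hx⟩
    refine ⟨-m, ?_⟩
    by_cases ha : BddAbove K
    · obtain ⟨M, hM⟩ : ∃ M, IsGreatest K M :=
        ⟨sSup K, Int.csSup_mem hne ha, fun x hx => le_csSup ha hx⟩
      have hmM : m ≤ M := hm.2 hM.1
      refine Or.inr (Or.inr (Or.inr ⟨(M - m).toNat, ?_⟩))
      ext n
      rw [Int.toNat_of_nonneg (by omega)]
      constructor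
      · intro hn
        have h1 := hm.2 hn
        have h2 := hM.2 hn
        constructor <;> omega
      · rintro ⟨h1, h2⟩
        exact hK.out hm.1 hM.1 ⟨by omega, by omega⟩
    · refine Or.inl ?_
      ext n
      constructor
      · intro hn
        have h1 := hm.2 hn
        change 0 ≤ n
        omega
      · intro h1
        change 0 ≤ n at h1
        obtain ⟨x, hx, hxn⟩ := not_bddAbove_iff.1 ha (n - -m)
        exact hK.out hm.1 hx ⟨by omega, hxn.le⟩
  · by_cases ha : BddAbove K
    · obtain ⟨M, hM⟩ : ∃ M, IsGreatest K M :=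
        ⟨sSup K, Int.csSup_mem hne ha, fun x hx => le_csSup ha hx⟩
      refine ⟨-M, Or.inr (Or.inl ?_)⟩
      ext n
      constructor
      · intro hn
        have h1 := hM.2 hn
        change n ≤ 0
        omega
      · intro h1
        change n ≤ 0 at h1
        obtain ⟨x, hx, hxn⟩ := not_bddBelow_iff.1 hb (n - -M)
        exact hK.out hx hM.1 ⟨hxn.le, by omega⟩
    · refine ⟨0, Or.inr (Or.inr (Or.inl ?_))⟩
      ext n
      refine ⟨fun _ => trivial, fun _ => ?_⟩
      obtain ⟨x, hx, hxn⟩ := not_bddAbove_iff.1 ha (n - 0)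
      obtain ⟨y, hy, hyn⟩ := not_bddBelow_iff.1 hb (n - 0)
      exact hK.out hy hx ⟨hyn.le, hxn.le⟩

/-! ### Spectral functions from phase functions -/

section Phase
variable {S : Set ℝ} {G : ℝ → ℝ}

theorem half_add_arctan_eq_iff {g θ : ℝ} (hθ : θ ∈ Set.Ioo (0 : ℝ) 1) :
    1 / 2 + Real.arctan g / Real.pi = θ ↔
      g = -(Real.cos (Real.pi * θ) / Real.sin (Real.pi * θ)) := by
  have hpi := Real.pi_pos
  have htan : Real.tan (Real.pi * θ - Real.pi / 2) =
      -(Real.cos (Real.pi * θ) / Real.sin (Real.pi * θ)) := by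
    rw [Real.tan_eq_sin_div_cos, Real.sin_sub_pi_div_two, Real.cos_sub_pi_div_two, neg_div]
  rw [← htan]
  constructor
  · intro h
    have h1 : Real.arctan g = Real.pi * θ - Real.pi / 2 := by
      rw [← h]; field_simp; ring
    rw [← h1, Real.tan_arctan]
  · rintro rfl
    rw [Real.arctan_tan]
    · field_simp; ring
    · nlinarith [hθ.1]
    · nlinarith [hθ.2]

theorem half_add_arctan_mem (g : ℝ) : 1 / 2 + Real.arctan g / Real.pi ∈ Set.Ioo (0 : ℝ) 1 := by
  have hpi := Real.pi_pos
  have h1 := Real.neg_pi_div_two_lt_arctan g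
  have h2 := Real.arctan_lt_pi_div_two g
  have h3 : Real.arctan g / Real.pi * Real.pi = Real.arctan g := div_mul_cancel₀ _ hpi.ne'
  constructor <;> nlinarith

open Classical in
/-- `0` on `S`, and `1/2 + arctan G / π` off `S`. -/
def phase (S : Set ℝ) (G : ℝ → ℝ) (s : ℝ) : ℝ :=
  if s ∈ S then 0 else 1 / 2 + Real.arctan (G s) / Real.pi

theorem phase_of_mem {s : ℝ} (h : s ∈ S) : phase S G s = 0 := if_pos h

theorem phase_of_notMem {s : ℝ} (h : s ∉ S) :
    phase S G s = 1 / 2 + Real.arctan (G s) / Real.pi := if_neg h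

theorem phase_mem (s : ℝ) : phase S G s ∈ Set.Ico (0 : ℝ) 1 := by
  by_cases h : s ∈ S
  · rw [phase_of_mem h]; simp
  · rw [phase_of_notMem h]
    exact Set.Ioo_subset_Ico_self (half_add_arctan_mem _)

theorem phase_eq_zero_iff {s : ℝ} : phase S G s = 0 ↔ s ∈ S := by
  refine ⟨fun h => ?_, phase_of_mem⟩
  by_contra hs
  rw [phase_of_notMem hs] at h
  exact (half_add_arctan_mem (G s)).1.ne' h

theorem phase_eq_iff {s θ : ℝ} (hθ : θ ∈ Set.Ioo (0 : ℝ) 1) : phase S G s = θ ↔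
    s ∉ S ∧ G s = -(Real.cos (Real.pi * θ) / Real.sin (Real.pi * θ)) := by
  by_cases hs : s ∈ S
  · rw [phase_of_mem hs]
    exact ⟨fun h => absurd h hθ.1.ne, fun h => absurd hs h.1⟩
  · rw [phase_of_notMem hs, half_add_arctan_eq_iff hθ]
    exact ⟨fun h => ⟨hs, h⟩, fun h => h.2⟩

/-- Passing a point of S raises the count by at least 1, which exceeds any drop of a phase in [0,
1); elsewhere G increases. -/
theorem strictMono_count_add_phase (hS : ∀ s, ∃ δ > 0, ∀ r ∈ S, r ≠ s → δ ≤ |r - s|)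
    (hmono : ∀ r s, r < s → (∀ x ∈ Set.Icc r s, x ∉ S) → G r < G s) :
    StrictMono fun s => (signedCount S s : ℝ) + phase S G s := by
  intro r s hrs
  dsimp only
  by_cases hx : ∃ x ∈ Set.Ioc r s, x ∈ S
  · obtain ⟨x, hx, hxS⟩ := hx
    have h1 : ((signedCount S r + 1 : ℤ) : ℝ) ≤ signedCount S s := by
      exact_mod_cast signedCount_lt hS hx hxS
    push_cast at h1
    have h2 := (phase_mem (S := S) (G := G) r).2
    have h3 := (phase_mem (S := S) (G := G) s).1
    linarith
  · push Not at hx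
    rw [signedCount_eq hS hrs.le hx]
    have hs : s ∉ S := hx s ⟨hrs, le_refl s⟩
    refine add_lt_add_right ?_ _
    by_cases hr : r ∈ S
    · rw [phase_of_mem hr, phase_of_notMem hs]
      exact (half_add_arctan_mem _).1
    · rw [phase_of_notMem hr, phase_of_notMem hs]
      have := hmono r s hrs fun x hx' => by
        rcases hx'.1.eq_or_lt with h | h
        · rwa [← h]
        · exact hx x ⟨h, hx'.2⟩
      have h2 := Real.arctan_strictMono this
      have hpi := Real.pi_pos
      gcongr

/-- At a point of S the phase tends to 1 from the left and to 0 from the right, and the unit jump of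
the count compensates. The half-open intervals make the count right-continuous, matching the phase 0
on S. -/
theorem continuous_count_add_phase (hS : ∀ s, ∃ δ > 0, ∀ r ∈ S, r ≠ s → δ ≤ |r - s|)
    (hcont : ∀ s, s ∉ S → ContinuousAt G s)
    (hright : ∀ s ∈ S, Filter.Tendsto G (nhdsWithin s (Set.Ioi s)) Filter.atBot)
    (hleft : ∀ s ∈ S, Filter.Tendsto G (nhdsWithin s (Set.Iio s)) Filter.atTop) :
    Continuous fun s => (signedCount S s : ℝ) + phase S G s := by
  have hpi := Real.pi_pos
  rw [continuous_iff_continuousAt]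
  intro s
  obtain ⟨δ, hδ, hd⟩ := hS s
  have hd' : ∀ r, r ≠ s → |r - s| < δ → r ∉ S := fun r hrs hr hrS => by
    linarith [hd r hrS hrs]
  have hball : Set.Ioo (s - δ) (s + δ) ∈ nhds s := Ioo_mem_nhds (by linarith) (by linarith)
  by_cases hs : s ∈ S
  · rw [continuousAt_iff_continuous_left'_right']
    constructor
    · have h1 : Filter.Tendsto (fun r => ((signedCount S s : ℝ) - 1) +
          (1 / 2 + Real.arctan (G r) / Real.pi)) (nhdsWithin s (Set.Iio s))
          (nhds (((signedCount S s : ℝ) - 1) + (1 / 2 + (Real.pi / 2) / Real.pi))) := by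
        refine Filter.Tendsto.const_add _ (Filter.Tendsto.const_add _ (Filter.Tendsto.div_const ?_ _))
        exact (Real.tendsto_arctan_atTop.mono_right nhdsWithin_le_nhds).comp (hleft s hs)
      have e1 : ((signedCount S s : ℝ) - 1) + (1 / 2 + (Real.pi / 2) / Real.pi) =
          (signedCount S s : ℝ) + phase S G s := by
        rw [phase_of_mem hs]; field_simp; ring
      rw [e1] at h1
      refine h1.congr' ?_
      filter_upwards [self_mem_nhdsWithin, mem_nhdsWithin_of_mem_nhds hball] with r hr hrb
      have hr' : r < s := hr
      have hfree : ∀ x, r ≤ x → x < s → x ∉ S := fun x hx hxs =>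
        hd' x hxs.ne (by rw [abs_lt]; constructor <;> linarith [hrb.1])
      rw [phase_of_notMem (hfree r le_rfl hr'),
        signedCount_eq_add_one hS hr' hs fun x hx => hfree x hx.1.le hx.2]
      push_cast
      ring
    · have h1 : Filter.Tendsto (fun r => (signedCount S s : ℝ) +
          (1 / 2 + Real.arctan (G r) / Real.pi)) (nhdsWithin s (Set.Ioi s))
          (nhds ((signedCount S s : ℝ) + (1 / 2 + (-(Real.pi / 2)) / Real.pi))) := by
        refine Filter.Tendsto.const_add _ (Filter.Tendsto.const_add _ (Filter.Tendsto.div_const ?_ _))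
        exact (Real.tendsto_arctan_atBot.mono_right nhdsWithin_le_nhds).comp (hright s hs)
      have e1 : (signedCount S s : ℝ) + (1 / 2 + (-(Real.pi / 2)) / Real.pi) =
          (signedCount S s : ℝ) + phase S G s := by
        rw [phase_of_mem hs]; field_simp; ring
      rw [e1] at h1
      refine h1.congr' ?_
      filter_upwards [self_mem_nhdsWithin, mem_nhdsWithin_of_mem_nhds hball] with r hr hrb
      have hr' : s < r := hr
      have hfree : ∀ x, s < x → x ≤ r → x ∉ S := fun x hx hxs =>
        hd' x hx.ne' (by rw [abs_lt]; constructor <;> linarith [hrb.2])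
      rw [phase_of_notMem (hfree r hr' le_rfl),
        signedCount_eq hS hr'.le fun x hx => hfree x hx.1 hx.2]
  · have h1 : ContinuousAt (fun r => (signedCount S s : ℝ) +
        (1 / 2 + Real.arctan (G r) / Real.pi)) s := by
      have := (Real.continuous_arctan.continuousAt (x := G s)).comp (hcont s hs)
      exact continuousAt_const.add (continuousAt_const.add (this.div_const _))
    refine h1.congr ?_
    filter_upwards [hball] with r hr
    have hfree : ∀ x ∈ Set.Ioo (s - δ) (s + δ), x ∉ S := by
      intro x hx
      by_cases hxs : x = s
      · rwa [hxs]
      · exact hd' x hxs (by rw [abs_lt]; constructor <;> linarith [hx.1, hx.2])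
    rw [phase_of_notMem (hfree r hr)]
    congr 2
    rcases le_total r s with h | h
    · exact signedCount_eq hS h fun x hx => hfree x ⟨by linarith [hx.1, hr.1], by linarith [hx.2]⟩
    · exact (signedCount_eq hS h fun x hx =>
        hfree x ⟨by linarith [hx.1], by linarith [hx.2, hr.2]⟩).symm

/-- t inverts f = count + phase + k. The phase is the fractional part of f, so the points t(n + θ)
are those of phase θ; the integer k normalizes the index set. -/
theorem exists_phase_inverse (hne : S.Nonempty)
    (hS : ∀ s, ∃ δ > 0, ∀ r ∈ S, r ≠ s → δ ≤ |r - s|)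
    (hcont : ∀ s, s ∉ S → ContinuousAt G s)
    (hmono : ∀ r s, r < s → (∀ x ∈ Set.Icc r s, x ∉ S) → G r < G s)
    (hright : ∀ s ∈ S, Filter.Tendsto G (nhdsWithin s (Set.Ioi s)) Filter.atBot)
    (hleft : ∀ s ∈ S, Filter.Tendsto G (nhdsWithin s (Set.Iio s)) Filter.atTop) :
    ∃ (J : Set ℝ) (t : ℝ → ℝ), IsOpen J ∧ J.OrdConnected ∧ StrictMonoOn t J ∧
      Set.BijOn t J Set.univ ∧ IsIndexSet {n : ℤ | (n : ℝ) ∈ J} ∧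
      (∀ s, (∃ n : ℤ, (n : ℝ) ∈ J ∧ t n = s) ↔ s ∈ S) ∧
      ∀ θ ∈ Set.Ioo (0 : ℝ) 1, ∀ s, (∃ n : ℤ, (n : ℝ) + θ ∈ J ∧ t (n + θ) = s) ↔
        s ∉ S ∧ G s = -(Real.cos (Real.pi * θ) / Real.sin (Real.pi * θ)) := by
  have hsm := strictMono_count_add_phase hS hmono
  have hc := continuous_count_add_phase hS hcont hright hleft
  obtain ⟨k, hk⟩ : ∃ k : ℤ, IsIndexSet
      {n | n - k ∈ {n : ℤ | (n : ℝ) ∈ Set.range fun s => (signedCount S s : ℝ) + phase S G s}} := by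
    refine exists_shift_isIndexSet ?_ ⟨fun a ha b hb c hcab => ?_⟩
    · obtain ⟨s, hs⟩ := hne
      exact ⟨signedCount S s, s, by simp [phase_of_mem hs]⟩
    · exact (isPreconnected_range hc).ordConnected.out ha hb
        ⟨by exact_mod_cast hcab.1, by exact_mod_cast hcab.2⟩
  set f : ℝ → ℝ := fun s => ((signedCount S s + k : ℤ) : ℝ) + phase S G s with hf
  have hfeq : ∀ s, f s = ((signedCount S s : ℝ) + phase S G s) + k := fun s => by
    simp only [hf]; push_cast; ring
  have hfm : StrictMono f := by
    intro r s hrs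
    rw [hfeq, hfeq]
    exact add_lt_add_left (hsm hrs) _
  have hfc : Continuous f := by
    rw [funext hfeq]
    exact hc.add continuous_const
  have hinv : ∀ s, Function.invFun f (f s) = s := Function.leftInverse_invFun hfm.injective
  have hrange : ∀ {x : ℝ}, x ∈ Set.range f → f (Function.invFun f x) = x := by
    rintro _ ⟨s, rfl⟩
    rw [hinv]
  have hsplit : ∀ (n : ℤ) (θ : ℝ), θ ∈ Set.Ico (0 : ℝ) 1 → ∀ s, f s = n + θ → phase S G s = θ := by
    intro n θ hθ s hs
    have h1 := phase_mem (S := S) (G := G) s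
    have h2 : Int.fract (f s) = phase S G s := by
      rw [hf]; dsimp only
      rw [Int.fract_intCast_add, Int.fract_eq_self.2 h1]
    have h3 : Int.fract ((n : ℝ) + θ) = θ := by
      rw [Int.fract_intCast_add, Int.fract_eq_self.2 hθ]
    rw [← h2, hs, h3]
  have hiff : ∀ θ ∈ Set.Ico (0 : ℝ) 1, ∀ s,
      (∃ n : ℤ, (n : ℝ) + θ ∈ Set.range f ∧ Function.invFun f (n + θ) = s) ↔ phase S G s = θ := by
    intro θ hθ s
    constructor
    · rintro ⟨n, hn, rfl⟩
      exact hsplit n θ hθ _ (hrange hn)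
    · intro h
      have : ((signedCount S s + k : ℤ) : ℝ) + θ = f s := by rw [← h]
      exact ⟨signedCount S s + k, ⟨s, this.symm⟩, by rw [this, hinv]⟩
  refine ⟨Set.range f, Function.invFun f, ?_, (isPreconnected_range hfc).ordConnected, ?_, ?_, ?_,
    ?_, ?_⟩
  · rw [isOpen_iff_mem_nhds]
    rintro _ ⟨s, rfl⟩
    have h1 := intermediate_value_Icc (by linarith : s - 1 ≤ s + 1) hfc.continuousOn
    refine Filter.mem_of_superset (Icc_mem_nhds (hfm (by linarith : s - 1 < s))
      (hfm (by linarith : s < s + 1))) (h1.trans (Set.image_subset_range _ _))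
  · intro x hx y hy hxy
    rw [← hfm.lt_iff_lt, hrange hx, hrange hy]
    exact hxy
  · refine ⟨fun _ _ => trivial, ?_, fun s _ => ⟨f s, ⟨s, rfl⟩, hinv s⟩⟩
    rintro _ ⟨x, rfl⟩ _ ⟨y, rfl⟩ hxy
    rw [hinv, hinv] at hxy
    rw [hxy]
  · convert hk using 1
    ext n
    change (∃ s, f s = n) ↔ ∃ s, (signedCount S s : ℝ) + phase S G s = ((n - k : ℤ) : ℝ)
    refine exists_congr fun s => ?_
    rw [hfeq]
    push_cast
    exact ⟨fun h => by linarith, fun h => by linarith⟩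
  · intro s
    have := hiff 0 ⟨le_rfl, one_pos⟩ s
    simp only [add_zero] at this
    rw [this, phase_eq_zero_iff]
  · intro θ hθ s
    rw [hiff θ (Set.Ioo_subset_Ico_self hθ) s, phase_eq_iff hθ]

end Phase

end

section

variable {H : Type*} [NormedAddCommGroup H] [InnerProductSpace ℂ H] [CompleteSpace H]

/-! ### Existence of spectral functions -/

namespace IsClosedDeficient
variable {T A B : H →ₗ.[ℂ] H} {φp φm : H}

theorem mem_spec_iff_eigenvector (h : IsClosedDeficient T φp φm) (hr : IsRegular T) {θ : ℝ}
    (hB : IsExtension T φp φm θ B) {s : ℝ} :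
    (s : ℂ) ∈ spec B ↔ ∃ x, x ≠ 0 ∧ (x, (s : ℂ) • x) ∈ B.graph := by
  constructor
  · intro hs
    obtain ⟨k, hk1, hk⟩ := h.exists_eigenvector_of_mem_spec hr hB hs
    exact ⟨k, by rw [← norm_pos_iff, hk1]; exact one_pos, hk⟩
  · rintro ⟨x, hx0, hx⟩
    exact mem_spec_of_eigenvector hx0 hx

theorem coord_ne_zero (h : IsClosedDeficient T φp φm) (hr : IsRegular T) {θ : ℝ}
    (hB : IsExtension T φp φm θ B) {ι : Type*} {t : ι → ℝ} {e : HilbertBasis ι ℂ H}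
    (he : ∀ n, (e n, (t n : ℂ) • e n) ∈ B.graph) (n : ι) : inner ℂ (e n) φp ≠ 0 := by
  rw [← inner_conj_symm, map_ne_zero]
  exact h.inner_eigenvector_ne_zero hr hB (basis_ne_zero e n) (he n)

theorem exists_isSpectralFunction (h : IsClosedDeficient T φp φm) (hr : IsRegular T)
    (hA : IsExtension T φp φm 0 A) :
    ∃ (J : Set ℝ) (t : ℝ → ℝ), IsSpectralFunction T φp φm J t := by
  have hAs := h.isSelfAdjoint_ext hA
  set S : Set ℝ := {r : ℝ | (r : ℂ) ∈ spec A} with hS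
  have hgapS : ∀ s, ∃ δ > 0, ∀ r ∈ S, r ≠ s → δ ≤ |r - s| := h.gap_spec hr hA
  -- The eigenvalues index themselves; an integer numbering only arises from the spectral function.
  let t : S → ℝ := fun n => n
  have hspec : spec A = Set.range fun n : S => (t n : ℂ) := by
    ext z
    constructor
    · intro hz
      have := spec_real hAs hz
      exact ⟨⟨z.re, by rw [hS, Set.mem_ofPred_eq, this]; exact hz⟩, this⟩
    · rintro ⟨n, rfl⟩
      exact n.2
  obtain ⟨e, he⟩ := exists_eigenbasis hAs (t := t) Subtype.val_injective hspec
    (fun x => by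
      refine not_accPt_of_gap ?_
      obtain ⟨δ, hδ, hd⟩ := hgapS x
      exact ⟨δ, hδ, by rintro _ ⟨n, rfl⟩; exact hd n n.2⟩)
    (fun n => h.finrank_ker_of_mem_spec hr hA n.2)
  have hgap : ∀ s, ∃ δ > 0, ∀ n, t n ≠ s → δ ≤ |t n - s| := fun s => by
    obtain ⟨δ, hδ, hd⟩ := hgapS s
    exact ⟨δ, hδ, fun n => hd n n.2⟩
  have hc := h.coord_ne_zero hr hA he
  set a : S → ℝ := fun n => ‖inner ℂ (e n) φp‖ ^ 2 with ha
  have hapos : ∀ n, 0 < a n := fun n => pow_pos (norm_pos_iff.2 (hc n)) 2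
  have hsum : Summable a := summable_coord e φp
  have hφ : 0 < ‖φp‖ ^ 2 := pow_pos h.norm_pos 2
  have hne : S.Nonempty := h.spec_nonempty hr hA
  have : Nonempty S := hne.to_subtype
  have htS : ∀ s, (∀ n, t n ≠ s) ↔ s ∉ S := fun s =>
    ⟨fun hs hsS => hs ⟨s, hsS⟩ rfl, fun hs n h0 => hs (h0 ▸ n.2)⟩
  obtain ⟨J, τ, hJo, hJc, hτm, hτb, hJi, hτ0, hτθ⟩ := exists_phase_inverse
    (G := fun s => herglotz a t s / ‖φp‖ ^ 2) hne hgapS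
    (fun s hs => by
      obtain ⟨δ, hδ, hd⟩ := hgap s
      exact (continuousAt_herglotz (fun n => (hapos n).le) hsum hδ
        fun n => Or.inr (hd n ((htS s).2 hs n))).div_const _)
    (fun r s hrs hfree => by
      obtain ⟨δ, hδ, hd⟩ := hgap r
      obtain ⟨ε, hε, hd'⟩ := hgap s
      have hr' : r ∉ S := hfree r ⟨le_rfl, hrs.le⟩
      have hs' : s ∉ S := hfree s ⟨hrs.le, le_rfl⟩
      refine div_lt_div_of_pos_right (herglotz_lt hapos hsum (lt_min hδ hε)
        (fun n => (min_le_left _ _).trans (hd n ((htS r).2 hr' n)))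
        (fun n => (min_le_right _ _).trans (hd' n ((htS s).2 hs' n))) hrs fun n => ?_) hφ
      by_contra hcon
      push Not at hcon
      exact hfree (t n) hcon n.2)
    (fun s hs => (tendsto_herglotz_right hapos hsum hgap Subtype.val_injective
      ⟨s, hs⟩).atBot_div_const hφ)
    (fun s hs => (tendsto_herglotz_left hapos hsum hgap Subtype.val_injective
      ⟨s, hs⟩).atTop_div_const hφ)
  refine ⟨J, τ, hJo, hJc, hτm, hτb, hJi, fun θ hθ B hB => ?_⟩
  have hBs := h.isSelfAdjoint_ext hB
  have key : ∀ s : ℝ, (s : ℂ) ∈ spec B ↔ ∃ n : ℤ, (n : ℝ) + θ ∈ J ∧ τ (n + θ) = s := by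
    intro s
    rcases hθ.1.eq_or_lt with h0 | h0
    · have hBA : B = A := LinearPMap.eq_of_eq_graph (by rw [hA, hB, h0])
      rw [hBA, ← h0]
      simp only [add_zero]
      exact (hτ0 s).symm
    · rw [h.mem_spec_iff_eigenvector hr hB, hτθ θ ⟨h0, hθ.2⟩, h.hasEigenvector_iff hA he
        Subtype.val_injective hgap hc ⟨h0, hθ.2⟩ hB, htS, div_eq_iff hφ.ne']
  ext z
  constructor
  · intro hz
    have hz' := spec_real hBs hz
    rw [← hz'] at hz ⊢
    obtain ⟨n, hn, hs⟩ := (key z.re).1 hz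
    exact ⟨n, hn, by rw [hs]⟩
  · rintro ⟨n, hn, rfl⟩
    exact (key _).2 ⟨n, hn, rfl⟩

end IsClosedDeficient

/-! ### Derivatives of spectral functions -/

/-- A monotone function whose image fills a neighbourhood cannot jump. -/
theorem IsSpectralFunction.continuousAt {T : H →ₗ.[ℂ] H} {φp φm : H} {J : Set ℝ} {t : ℝ → ℝ}
    (ht : IsSpectralFunction T φp φm J t) {x : ℝ} (hx : x ∈ J) : ContinuousAt t x :=
  ht.strictMono.continuousAt_of_image_mem_nhds (ht.isOpen.mem_nhds hx)
    (by rw [ht.bijOn.image_eq]; exact Filter.univ_mem)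

/-- (x - n)/sin πx is the reciprocal slope of sin πx at its zero n. -/
theorem tendsto_sub_mul_cot (n : ℤ) :
    Filter.Tendsto (fun x : ℝ => (x - n) * (Real.cos (Real.pi * x) / Real.sin (Real.pi * x)))
      (nhdsWithin (n : ℝ) {(n : ℝ)}ᶜ) (nhds (1 / Real.pi)) := by
  have hpi := Real.pi_pos
  have hc0 : Real.cos (Real.pi * n) ≠ 0 := by
    rw [mul_comm, Real.cos_int_mul_pi]
    exact zpow_ne_zero _ (by norm_num)
  have hs0 : Real.sin (Real.pi * n) = 0 := by rw [mul_comm, Real.sin_int_mul_pi]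
  have hd : HasDerivAt (fun x : ℝ => Real.sin (Real.pi * x)) (Real.cos (Real.pi * n) * Real.pi) n := by
    have := ((hasDerivAt_id (n : ℝ)).const_mul Real.pi).sin
    simpa using this
  have h1 := (hasDerivAt_iff_tendsto_slope.1 hd).inv₀ (mul_ne_zero hc0 hpi.ne')
  have h2 : Filter.Tendsto (fun x : ℝ => Real.cos (Real.pi * x)) (nhdsWithin (n : ℝ) {(n : ℝ)}ᶜ)
      (nhds (Real.cos (Real.pi * n))) :=
    (Continuous.tendsto (by fun_prop) _).mono_left nhdsWithin_le_nhds
  have h3 := h2.mul h1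
  have e1 : Real.cos (Real.pi * n) * (Real.cos (Real.pi * n) * Real.pi)⁻¹ = 1 / Real.pi := by
    field_simp
  rw [e1] at h3
  refine h3.congr fun x => ?_
  rw [slope_def_field, hs0, sub_zero, inv_div]
  ring

theorem cos_div_sin_add_int (θ : ℝ) (k : ℤ) :
    Real.cos (Real.pi * (k + θ)) / Real.sin (Real.pi * (k + θ)) =
      Real.cos (Real.pi * θ) / Real.sin (Real.pi * θ) := by
  have e1 : Real.pi * (k + θ) = Real.pi * θ + k * Real.pi := by ring
  rw [e1, Real.cos_add_int_mul_pi, Real.sin_add_int_mul_pi,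
    mul_div_mul_left _ _ (zpow_ne_zero k (by norm_num : (-1 : ℝ) ≠ 0))]

/-- Near n the fractional part is close to 0 or 1 and so misses η. This serves to avoid a parameter
whose extension is undefined. -/
theorem eventually_floor_fract (n : ℤ) (η : ℝ) (hη : η ∈ Set.Ioo (0 : ℝ) 1) :
    ∀ᶠ x in nhdsWithin (n : ℝ) {(n : ℝ)}ᶜ, Int.fract x ∈ Set.Ioo (0 : ℝ) 1 ∧ Int.fract x ≠ η := by
  have hδ : 0 < min η (1 - η) := lt_min hη.1 (by linarith [hη.2])
  have hball : Metric.ball (n : ℝ) (min η (1 - η)) ∈ nhdsWithin (n : ℝ) {(n : ℝ)}ᶜ :=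
    mem_nhdsWithin_of_mem_nhds (Metric.ball_mem_nhds _ hδ)
  filter_upwards [hball, self_mem_nhdsWithin] with x hx hxn
  rw [Metric.mem_ball, Real.dist_eq, lt_min_iff, abs_lt, abs_lt] at hx
  have h1 := Int.floor_add_fract x
  have h2 := Int.fract_nonneg x
  have h3 := Int.fract_lt_one x
  have hcase : ⌊x⌋ ≤ n - 1 ∨ ⌊x⌋ = n ∨ n + 1 ≤ ⌊x⌋ := by omega
  have hcast : (⌊x⌋ : ℝ) ≤ n - 1 ∨ ⌊x⌋ = n ∨ (n : ℝ) + 1 ≤ ⌊x⌋ := by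
    rcases hcase with h | h | h
    · left; exact_mod_cast h
    · right; left; exact h
    · right; right; exact_mod_cast h
  have hη1 := hη.1
  have hη2 := hη.2
  refine ⟨⟨h2.lt_of_ne fun h0 => ?_, h3⟩, fun h0 => ?_⟩
  · rw [← h0] at h1
    rcases hcast with h | h | h
    · linarith [hx.2.1]
    · exact hxn (by rw [← h1, h]; simp)
    · linarith [hx.1.2]
  · rw [h0] at h1
    rcases hcast with h | h | h
    · linarith [hx.2.1]
    · rw [h] at h1
      linarith [hx.1.2]
    · linarith [hx.1.2]

/-! ### From spectral functions to bandlimit pairs -/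

section Converse
variable {T A : H →ₗ.[ℂ] H} {φp φm : H} {J : Set ℝ} {t : ℝ → ℝ}

theorem IsSpectralFunction.spec_zero (ht : IsSpectralFunction T φp φm J t)
    (hA : IsExtension T φp φm 0 A) :
    spec A = Set.range fun n : {n : ℤ | (n : ℝ) ∈ J} => ((t (n : ℤ) : ℝ) : ℂ) := by
  rw [ht.spec_eq 0 ⟨le_rfl, one_pos⟩ A hA]
  ext z
  simp only [add_zero]
  constructor
  · rintro ⟨n, hn, rfl⟩
    exact ⟨⟨n, hn⟩, rfl⟩
  · rintro ⟨n, rfl⟩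
    exact ⟨n, n.2, rfl⟩

theorem IsSpectralFunction.strictMono_int (ht : IsSpectralFunction T φp φm J t) :
    StrictMono fun n : {n : ℤ | (n : ℝ) ∈ J} => t (n : ℤ) := fun n m hnm =>
  ht.strictMono n.2 m.2 (by exact_mod_cast hnm)

theorem IsSpectralFunction.hasSimpleSpectrum (ht : IsSpectralFunction T φp φm J t)
    (h : IsClosedDeficient T φp φm) (hr : IsRegular T) (hA : IsExtension T φp φm 0 A) :
    HasSimpleSpectrum A fun n : {n : ℤ | (n : ℝ) ∈ J} => t (n : ℤ) where
  selfAdjoint := h.isSelfAdjoint_ext hA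
  spec_eq := ht.spec_zero hA
  simple n := h.finrank_ker_of_mem_spec hr hA (by rw [ht.spec_zero hA]; exact ⟨n, rfl⟩)

theorem IsSpectralFunction.gap (ht : IsSpectralFunction T φp φm J t)
    (h : IsClosedDeficient T φp φm) (hr : IsRegular T) (hA : IsExtension T φp φm 0 A) (s : ℝ) :
    ∃ δ > 0, ∀ n : {n : ℤ | (n : ℝ) ∈ J}, t (n : ℤ) ≠ s → δ ≤ |t (n : ℤ) - s| := by
  obtain ⟨δ, hδ, hd⟩ := h.gap_spec hr hA s
  refine ⟨δ, hδ, fun n => hd _ ?_⟩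
  rw [Set.mem_ofPred_eq, ht.spec_zero hA]
  exact ⟨n, rfl⟩

theorem IsSpectralFunction.no_accPt (ht : IsSpectralFunction T φp φm J t)
    (h : IsClosedDeficient T φp φm) (hr : IsRegular T) (hA : IsExtension T φp φm 0 A) (s : ℝ) :
    ¬ AccPt s (Filter.principal (Set.range fun n : {n : ℤ | (n : ℝ) ∈ J} => t (n : ℤ))) := by
  refine not_accPt_of_gap ?_
  obtain ⟨δ, hδ, hd⟩ := ht.gap h hr hA s
  exact ⟨δ, hδ, by rintro _ ⟨n, rfl⟩; exact hd n⟩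

/-- Near n, G(t(x)) = -‖φ₊‖² cot πx. Dividing the limit of (t_n - s)G(s) at s = t(x) by that of (x -
n)‖φ₊‖² cot πx leaves the difference quotient of t. -/
theorem IsSpectralFunction.hasDerivAt (ht : IsSpectralFunction T φp φm J t)
    (h : IsClosedDeficient T φp φm) (hr : IsRegular T) (hA : IsExtension T φp φm 0 A)
    {e : HilbertBasis {n : ℤ | (n : ℝ) ∈ J} ℂ H}
    (he : ∀ n, (e n, ((t (n : ℤ) : ℝ) : ℂ) • e n) ∈ A.graph) (m : {n : ℤ | (n : ℝ) ∈ J}) :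
    HasDerivAt t (Real.pi / ‖φp‖ ^ 2 * (‖inner ℂ (e m) φp‖ ^ 2 * (1 + t (m : ℤ) ^ 2))) (m : ℤ) := by
  set a : {n : ℤ | (n : ℝ) ∈ J} → ℝ := fun n => ‖inner ℂ (e n) φp‖ ^ 2 with ha
  set τ : {n : ℤ | (n : ℝ) ∈ J} → ℝ := fun n => t (n : ℤ) with hτ
  have hinj := ht.strictMono_int.injective
  have hgap := ht.gap h hr hA
  have hc := h.coord_ne_zero hr hA he
  have hφ : 0 < ‖φp‖ ^ 2 := pow_pos h.norm_pos 2
  have hpi := Real.pi_pos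
  have hm : ((m : ℤ) : ℝ) ∈ J := m.2
  -- η is the one parameter in (0, 1) whose extension may be undefined; if there is none, 1/2 is an
  -- arbitrary choice.
  obtain ⟨η, hη, hηe⟩ : ∃ η ∈ Set.Ioo (0 : ℝ) 1, ∀ θ ∈ Set.Ioo (0 : ℝ) 1, θ ≠ η →
      ∃ B, IsExtension T φp φm θ B := by
    by_cases hu : ∃ η ∈ Set.Ioo (0 : ℝ) 1, ¬ ∃ B, IsExtension T φp φm η B
    · obtain ⟨η, hη, hηu⟩ := hu
      refine ⟨η, hη, fun θ hθ hne => ?_⟩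
      by_contra hθu
      exact hne (h.extension_undefined_unique hA he hθ hη hθu hηu)
    · push Not at hu
      exact ⟨1 / 2, by norm_num, fun θ hθ _ => hu θ hθ⟩
  have htlim : Filter.Tendsto t (nhdsWithin ((m : ℤ) : ℝ) {((m : ℤ) : ℝ)}ᶜ)
      (nhdsWithin (t (m : ℤ)) {t (m : ℤ)}ᶜ) := by
    refine tendsto_nhdsWithin_iff.2 ⟨(ht.continuousAt hm).tendsto.mono_left nhdsWithin_le_nhds, ?_⟩
    filter_upwards [mem_nhdsWithin_of_mem_nhds (ht.isOpen.mem_nhds hm), self_mem_nhdsWithin]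
      with x hx hxm h0
    exact hxm (ht.bijOn.injOn hx hm h0)
  have h1 := (tendsto_mul_herglotz (a := a) (t := τ) (fun n => by positivity) (summable_coord e φp)
    hgap hinj m).comp htlim
  have h2 := (tendsto_sub_mul_cot (m : ℤ)).mul_const (‖φp‖ ^ 2)
  have hne : 1 / Real.pi * ‖φp‖ ^ 2 ≠ 0 := by positivity
  have h3 := h1.div h2 hne
  rw [hasDerivAt_iff_tendsto_slope]
  have e1 : a m * (1 + τ m ^ 2) / (1 / Real.pi * ‖φp‖ ^ 2) =
      Real.pi / ‖φp‖ ^ 2 * (‖inner ℂ (e m) φp‖ ^ 2 * (1 + t (m : ℤ) ^ 2)) := by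
    rw [ha, hτ]; field_simp
  rw [e1] at h3
  refine h3.congr' ?_
  filter_upwards [mem_nhdsWithin_of_mem_nhds (ht.isOpen.mem_nhds hm), self_mem_nhdsWithin,
    eventually_floor_fract (m : ℤ) η hη, h2.eventually_ne hne] with x hx hxm hxη hxne
  obtain ⟨B, hB⟩ := hηe _ hxη.1 hxη.2
  have hspec : ((t x : ℝ) : ℂ) ∈ spec B := by
    rw [ht.spec_eq _ (Set.Ioo_subset_Ico_self hxη.1) B hB]
    exact ⟨⌊x⌋, by rw [Int.floor_add_fract]; exact hx, by rw [Int.floor_add_fract]⟩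
  obtain ⟨-, hG⟩ := (h.hasEigenvector_iff hA (t := τ) he hinj hgap hc hxη.1 hB (t x)).1
    ((h.mem_spec_iff_eigenvector hr hB).1 hspec)
  -- By periodicity of the cotangent, the parameter fract x may be replaced by x.
  have hcot := cos_div_sin_add_int (Int.fract x) ⌊x⌋
  rw [Int.floor_add_fract] at hcot
  rw [← hcot] at hG
  change (τ m - t x) * herglotz a τ (t x) / _ = _
  rw [ha, hG, slope_def_field, hτ]
  have hc0 : Real.cos (Real.pi * x) / Real.sin (Real.pi * x) ≠ 0 := by
    intro h0
    rw [h0] at hxne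
    simp at hxne
  have hxm' : x - (m : ℤ) ≠ 0 := sub_ne_zero.2 hxm
  have hφ : ‖φp‖ ≠ 0 := h.norm_pos.ne'
  dsimp only
  generalize Real.cos (Real.pi * x) / Real.sin (Real.pi * x) = c at hc0 ⊢
  field_simp
  ring

/-- The second sequence is |⟪e_n, φ₊⟫|²(1 + t_n²), so the summability required of a pair is Parseval
for φ₊, and positivity is regularity. -/
theorem IsSpectralFunction.isBandlimitPair (ht : IsSpectralFunction T φp φm J t)
    (h : IsClosedDeficient T φp φm) (hr : IsRegular T) (hA : IsExtension T φp φm 0 A) :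
    (∀ n : {n : ℤ | (n : ℝ) ∈ J}, DifferentiableAt ℝ t (n : ℤ)) ∧
      IsBandlimitPair {n : ℤ | (n : ℝ) ∈ J} (fun n => t (n : ℤ))
        (fun n => ‖φp‖ ^ 2 / Real.pi * deriv t (n : ℤ)) ∧
      ((Summable fun n : {n : ℤ | (n : ℝ) ∈ J} => ‖φp‖ ^ 2 / Real.pi * deriv t (n : ℤ)) ↔
        ¬ Dense (T.domain : Set H)) := by
  have hspec := ht.hasSimpleSpectrum h hr hA
  have hacc := ht.no_accPt h hr hA
  have hφ : 0 < ‖φp‖ ^ 2 := pow_pos h.norm_pos 2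
  have hpi := Real.pi_pos
  obtain ⟨e, he⟩ := exists_eigenbasis hspec.selfAdjoint ht.strictMono_int.injective hspec.spec_eq hacc
    hspec.simple
  have hc := h.coord_ne_zero hr hA he
  have hder := ht.hasDerivAt h hr hA he
  have hfun : (fun n : {n : ℤ | (n : ℝ) ∈ J} => ‖φp‖ ^ 2 / Real.pi * deriv t (n : ℤ)) =
      fun n => ‖inner ℂ (e n) φp‖ ^ 2 * (1 + t (n : ℤ) ^ 2) := by
    ext n
    rw [(hder n).deriv]
    have hφ : ‖φp‖ ≠ 0 := h.norm_pos.ne'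
    field_simp
  have hadm : IsAdmissible {n : ℤ | (n : ℝ) ∈ J} (fun n => t (n : ℤ))
      (fun n => ‖inner ℂ (e n) φp‖ ^ 2 * (1 + t (n : ℤ) ^ 2)) := by
    refine ⟨ht.index, ht.strictMono_int, hacc, fun n => by positivity, ?_⟩
    refine (summable_coord e φp).congr fun n => ?_
    rw [mul_div_cancel_right₀]
    positivity
  refine ⟨fun n => (hder n).differentiableAt, ?_, ?_⟩
  · rw [hfun]
    exact ⟨hadm, fun n => mul_pos (pow_pos (norm_pos_iff.2 (hc n)) 2) (by positivity)⟩
  · rw [hfun]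
    have hcoef : HasCoefficients A (fun n : {n : ℤ | (n : ℝ) ∈ J} => t (n : ℤ))
        (fun n => ‖inner ℂ (e n) φp‖ ^ 2 * (1 + t (n : ℤ) ^ 2)) φp := by
      intro ψ hψ n
      obtain ⟨u, hu, hun⟩ := hspec.eigenbasis_unique he hψ n
      rw [hun, inner_smul_left, norm_mul, RCLike.norm_conj, hu, one_mul, mul_div_cancel_right₀]
      positivity
    -- T is the restriction attached to this pair and φ₊. The vector ψm need not be compared with
    -- φ₋, since membership in the graph of T and the density criterion involve only φ₊.
    obtain ⟨ψm, f, hf⟩ := hspec.exists_isExpansion hadm hcoef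
    have hD := hf.isDiagRestriction (T := T) hadm hspec.selfAdjoint
      fun _ _ => h.mem_graph_iff hA
    rw [hD.dense_iff h.pair.ne_zero, not_not]

end Converse

end

end TVBand

end

/-! ### The theorem -/

open TVBand
theorem theorem2 {H : Type*} [NormedAddCommGroup H] [InnerProductSpace ℂ H] [CompleteSpace H]
    [TopologicalSpace.SeparableSpace H] :
    -- from admissible pairs to symmetric transformations
    (∀ (F : Set ℤ) (t t' : F → ℝ), IsAdmissible F t t' → (∃ n, t' n ≠ 0) →
      ∀ T' : H →ₗ.[ℂ] H, HasSimpleSpectrum T' t →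
        (∃ φp : H, HasCoefficients T' t t' φp) ∧
        ∀ φp : H, HasCoefficients T' t t' φp →
          (∃ (φm : H) (e : HilbertBasis F ℂ H), IsExpansion T' t t' φp φm e) ∧
          (∀ (φm φm₂ : H) (e e₂ : HilbertBasis F ℂ H),
            IsExpansion T' t t' φp φm e → IsExpansion T' t t' φp φm₂ e₂ →
              φm = φm₂ ∧ ∀ n, 0 < t' n → e n = e₂ n) ∧
          ∀ (φm : H) (e : HilbertBasis F ℂ H), IsExpansion T' t t' φp φm e →
            (∃! T : H →ₗ.[ℂ] H, IsRealization T' φp φm T) ∧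
            ∀ T : H →ₗ.[ℂ] H, IsRealization T' φp φm T →
              (MemSR T ↔ ∀ n, 0 < t' n) ∧
              (Dense (T.domain : Set H) ↔ ¬ Summable t')) ∧
    -- from symmetric transformations to bandlimit pairs
    (∀ T : H →ₗ.[ℂ] H, MemSR T → ∀ φp φm : H, IsDeficiencyPair T φp φm →
      (∃ T₀ : H →ₗ.[ℂ] H, IsExtension T φp φm 0 T₀) →
        (∃ (J : Set ℝ) (t : ℝ → ℝ), IsSpectralFunction T φp φm J t) ∧
        ∀ (J : Set ℝ) (t : ℝ → ℝ), IsSpectralFunction T φp φm J t →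
          (∀ n : {n : ℤ | (n : ℝ) ∈ J}, DifferentiableAt ℝ t (n : ℤ)) ∧
          IsBandlimitPair {n : ℤ | (n : ℝ) ∈ J} (fun n => t (n : ℤ))
            (fun n => ‖φp‖ ^ 2 / Real.pi * deriv t (n : ℤ)) ∧
          ((Summable fun n : {n : ℤ | (n : ℝ) ∈ J} => ‖φp‖ ^ 2 / Real.pi * deriv t (n : ℤ)) ↔
            ¬ Dense (T.domain : Set H))) := by
  constructor
  · intro F t t' ht h0 A hA
    refine ⟨hA.exists_hasCoefficients ht, fun φp hφp => ⟨hA.exists_isExpansion ht hφp,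
      fun φm φm₂ e e₂ h h₂ => hA.isExpansion_unique h h₂, fun φm e h =>
        ⟨h.existsUnique_isRealization ht h0 hA.selfAdjoint, fun T hT => ?_⟩⟩⟩
    have hD := h.isDiagRestriction (T := T) ht hA.selfAdjoint
      fun _ _ => hT.isClosedDeficient.mem_graph_iff hT.ext_zero
    exact ⟨hD.memSR_iff hT.pair.ne_zero, hD.dense_iff hT.pair.ne_zero⟩
  · rintro T hT φp φm hφ ⟨A, hA⟩
    have h : IsClosedDeficient T φp φm := ⟨hT.closed, hT.symm, hT.indices, hφ⟩
    exact ⟨h.exists_isSpectralFunction hT.regular hA,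
      fun J t ht => ht.isBandlimitPair h hT.regular hA⟩
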